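/- Consider planar piecewise linear systems $$\dot z=A^+z+b^+\ \text{ if } x>0,\qquad \dot z=A^-z+b^-\ \text{ if } x<0,\qquad z=(x,y)^\top\in\mathbb R^2,$$ with $A^\pm\in\mathbb R^{2\times2}$, $b^\pm\in\mathbb R^2$ and switching line $\Sigma=\{x=0\}$. Write $F^\pm(z)=A^\pm z+b^\pm$ and let $F_1^\pm$ be the first component. The crossing region is $\Sigma^c=\{z\in\Sigma: F_1^+F_1^->0\}$, the sliding region is $\Sigma^s=\{z\in\Sigma:F_1^+F_1^-\le0\}$, and the attractive and repulsive sliding regions are $\Sigma^s_a=\{z\in\Sigma:F_1^+<0<F_1^-\}$ and $\Sigma^s_r=\{z\in\Sigma:F_1^-<0<F_1^+\}$. The sliding field on $\Sigma^s$ is $F^s=(F_1^-F^+-F_1^+F^-)/(F_1^--F_1^+)$; where the denominator vanishes, $F^s$ is the continuous extension if there is one and $0$ otherwise. A (forward) solution is a continuous concatenation, with locally finitely many break points, of orbits of $F^+$ in $x>0$, of $F^-$ in $x<0$ and of $F^s$ in $\Sigma^s$; a solution at a point of the interior of $\Sigma^s$ relative to $\Sigma$ goes on sliding. A tangency point of $F^\pm$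 is a point of $\Sigma$ where $F^\pm_1=0$ and neither $F^+$ nor $F^-$ vanishes. A periodic orbit is the image of a nonconstant periodic solution. It is a crossing periodic orbit if it meets $\Sigma$, and only at isolated times, and a sliding periodic orbit if it contains a nontrivial segment of sliding motion; sliding periodic orbits that are periodic only backward in time (that is, for the time-reversed system) are counted too. A sliding periodic orbit is called * of type (a) on a side $\sigma\in\{x>0,\,x<0\}$ if it consists of one segment in $\Sigma^s_a$, at whose end it enters $\sigma$, and one arc in $\sigma$ back to the starting point (in $\Sigma^s_a$) of the segment; * of type (b) with exit side $\sigma$ if it consists of one segment in $\Sigma^s_a$, at whose end it enters $\sigma$, an arc in $\sigma$ that ends at a point of $\Sigma^c$, and an arc in the opposite half plane back to the starting point of the segment; * of type (c) if it is as in (b), except that the arc in $\sigma$ ends at a tangency point of the field of the opposite half plane; * of type (d) if it consists of a segment in $\Sigma^s_a$ at whose end it enters $\sigma$, an arc in $\sigma$ that ends in $\Sigma^s_a$, a second segment in $\Sigma^s_a$ at whose end it enters the opposite half plane, and an arc there back to the starting point of the first segment. Then the following hold. (i) If the system has a sliding periodic orbit of type (a) on one side, and its time reversal has one of type (a) on the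 opposite side (so that this second orbit slides on $\Sigma^s_r$), then the system has no crossing periodic orbit. (ii) Suppose that the system has two sliding periodic orbits of type (a), one on each side; or one of type (a) on a side $\sigma$ and one of type (b) whose exit side is opposite to $\sigma$; or one of type (c) or (d) (in particular, if it has a unique sliding periodic orbit and this orbit is of type (c) or (d)). Then it has exactly one crossing periodic orbit, and this orbit is unstable: it is not orbitally stable, and every solution that starts near it but not on it leaves a fixed neighbourhood of it. (iii) There is a system with $\det A^\pm\ne0$ that has exactly one sliding periodic orbit, of type (a), and exactly two crossing periodic orbits. (iv) There is a system with $\det A^\pm\ne0$ that has exactly one sliding periodic orbit, of type (b), and exactly two crossing periodic orbits. -/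

import Mathlib

open Set Filter Topology Matrix

/-- The two open half planes cut out by the switching line `x = 0`. -/
inductive Side
  | right
  | left

/-- The opposite side. -/
def Side.opp : Side → Side
  | .right => .left
  | .left => .right

/-- The half plane `x > 0` (right) or `x < 0` (left). -/
def Side.region : Side → Set (Fin 2 → ℝ)
  | .right => {z | 0 < z 0}
  | .left => {z | z 0 < 0}

/-- The switching line `x = 0`. -/
def switchingLine : Set (Fin 2 → ℝ) := {z | z 0 = 0}

/-- The planar piecewise linear system `ż = A⁺ z + b⁺` for `x > 0`, `ż = A⁻ z + b⁻` for `x < 0`. -/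
structure PWLSystem where
  A : Side → Matrix (Fin 2) (Fin 2) ℝ
  b : Side → Fin 2 → ℝ

namespace PWLSystem

/-- Both matrices are invertible. -/
def Nondegenerate (S : PWLSystem) : Prop := ∀ s, (S.A s).det ≠ 0

/-- The time-reversed system. -/
def reverse (S : PWLSystem) : PWLSystem := ⟨fun s => -S.A s, fun s => -S.b s⟩

/-- The affine vector field of the side `s`, on the whole plane. -/
def field (S : PWLSystem) (s : Side) (z : Fin 2 → ℝ) : Fin 2 → ℝ := S.A s *ᵥ z + S.b s

/-- The crossing region. -/
def crossingRegion (S : PWLSystem) : Set (Fin 2 → ℝ) :=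
  {z | z ∈ switchingLine ∧ 0 < S.field .right z 0 * S.field .left z 0}

/-- The sliding region. -/
def slidingRegion (S : PWLSystem) : Set (Fin 2 → ℝ) :=
  {z | z ∈ switchingLine ∧ S.field .right z 0 * S.field .left z 0 ≤ 0}

/-- The attractive sliding region. -/
def attractiveRegion (S : PWLSystem) : Set (Fin 2 → ℝ) :=
  {z | z ∈ switchingLine ∧ S.field .right z 0 < 0 ∧ 0 < S.field .left z 0}

/-- The interior of the sliding region relative to the switching line. -/
def slidingInterior (S : PWLSystem) : Set (Fin 2 → ℝ) :=
  {z | z ∈ switchingLine ∧ ∀ᶠ w in 𝓝[switchingLine] z, w ∈ S.slidingRegion}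

/-- `z` is a tangency point of the field of side `s`. -/
def IsTangency (S : PWLSystem) (s : Side) (z : Fin 2 → ℝ) : Prop :=
  z ∈ switchingLine ∧ S.field s z 0 = 0 ∧ ∀ s', S.field s' z ≠ 0

/-- Filippov's formula for the sliding vector field. -/
noncomputable def filippovField (S : PWLSystem) (z : Fin 2 → ℝ) : Fin 2 → ℝ :=
  (S.field .left z 0 - S.field .right z 0)⁻¹ •
    (S.field .left z 0 • S.field .right z - S.field .right z 0 • S.field .left z)

/-- The sliding points where the denominator of Filippov's formula does not vanish. -/
def regularSliding (S : PWLSystem) : Set (Fin 2 → ℝ) :=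
  {z | z ∈ S.slidingRegion ∧ S.field .left z 0 ≠ S.field .right z 0}

open Classical in
/-- The sliding vector field: Filippov's formula at regular sliding points; at a singular sliding
point its continuous extension along the sliding region if there is one, and `0` otherwise. -/
noncomputable def slidingField (S : PWLSystem) (z : Fin 2 → ℝ) : Fin 2 → ℝ :=
  if S.field .left z 0 ≠ S.field .right z 0 then S.filippovField z
  else if h : (𝓝[S.regularSliding] z).NeBot ∧
      ∃ v, Tendsto S.filippovField (𝓝[S.regularSliding] z) (𝓝 v) then h.2.choose
  else 0

/-- `γ` is a forward solution on the time interval `I`: a continuous concatenation, with locally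
finitely many break points, of orbits of the two affine fields in their open half planes and of
orbits of the sliding field in the sliding region. A solution that is at a point of the relative
interior of the sliding region goes on sliding. -/
def IsSolutionOn (S : PWLSystem) (γ : ℝ → Fin 2 → ℝ) (I : Set ℝ) : Prop :=
  ContinuousOn γ I ∧
  (∃ D : Set ℝ, (∀ a b, (D ∩ Icc a b).Finite) ∧ ∀ t ∈ interior I, t ∉ D →
    (∃ s : Side, γ t ∈ s.region ∧ HasDerivAt γ (S.field s (γ t)) t) ∨
    ((∀ᶠ u in 𝓝 t, γ u ∈ S.slidingRegion) ∧ HasDerivAt γ (S.slidingField (γ t)) t)) ∧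
  ∀ t ∈ I, γ t ∈ S.slidingInterior → ∀ᶠ u in 𝓝[>] t, γ u ∈ switchingLine

/-- `γ` is a nonconstant `T`-periodic forward solution, `T > 0`. -/
def IsPeriodicSolution (S : PWLSystem) (γ : ℝ → Fin 2 → ℝ) (T : ℝ) : Prop :=
  0 < T ∧ S.IsSolutionOn γ univ ∧ Function.Periodic γ T ∧ ∃ t, γ t ≠ γ 0

/-- `Γ` is a crossing periodic orbit: a periodic orbit that meets the switching line, and meets it
only at isolated times. -/
def IsCrossingPeriodicOrbit (S : PWLSystem) (Γ : Set (Fin 2 → ℝ)) : Prop :=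
  ∃ γ T, S.IsPeriodicSolution γ T ∧ Γ = range γ ∧
    {t ∈ Ico 0 T | γ t ∈ switchingLine}.Nonempty ∧ {t ∈ Ico 0 T | γ t ∈ switchingLine}.Finite

/-- `Γ` is the orbit of a periodic forward solution that contains a nontrivial sliding segment. -/
def IsForwardSlidingPeriodicOrbit (S : PWLSystem) (Γ : Set (Fin 2 → ℝ)) : Prop :=
  ∃ γ T, S.IsPeriodicSolution γ T ∧ Γ = range γ ∧
    ∃ a b, a < b ∧ γ a ≠ γ b ∧ ∀ t ∈ Icc a b, γ t ∈ switchingLine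

/-- `Γ` is a sliding periodic orbit, forward or backward in time. -/
def IsSlidingPeriodicOrbit (S : PWLSystem) (Γ : Set (Fin 2 → ℝ)) : Prop :=
  S.IsForwardSlidingPeriodicOrbit Γ ∨ S.reverse.IsForwardSlidingPeriodicOrbit Γ

/-- Between the times `a < b` the curve `γ` slides along the attractive sliding region. -/
def SlidesOn (S : PWLSystem) (γ : ℝ → Fin 2 → ℝ) (a b : ℝ) : Prop :=
  a < b ∧ ∀ t ∈ Ico a b, γ t ∈ S.attractiveRegion

/-- Between the times `a < b` the curve `γ` runs through the open half plane `s`, from the switching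
line to the switching line. -/
def LoopsOn (γ : ℝ → Fin 2 → ℝ) (s : Side) (a b : ℝ) : Prop :=
  a < b ∧ γ a ∈ switchingLine ∧ γ b ∈ switchingLine ∧ ∀ t ∈ Ioo a b, γ t ∈ s.region

/-- One attractive sliding segment, left into side `s`, and one arc in side `s` that returns to
the starting point of the sliding segment. -/
def IsTypeA (S : PWLSystem) (s : Side) (Γ : Set (Fin 2 → ℝ)) : Prop :=
  ∃ γ T, S.IsPeriodicSolution γ T ∧ Γ = range γ ∧
    ∃ t₁, S.SlidesOn γ 0 t₁ ∧ LoopsOn γ s t₁ T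

/-- One attractive sliding segment, left into side `s`, an arc in side `s` that ends at a point of
the crossing region, and an arc in the opposite side that returns to the starting point of the
sliding segment. -/
def IsTypeB (S : PWLSystem) (s : Side) (Γ : Set (Fin 2 → ℝ)) : Prop :=
  ∃ γ T, S.IsPeriodicSolution γ T ∧ Γ = range γ ∧
    ∃ t₁ t₂, S.SlidesOn γ 0 t₁ ∧ LoopsOn γ s t₁ t₂ ∧ γ t₂ ∈ S.crossingRegion ∧
      LoopsOn γ s.opp t₂ T

/-- As type B, but the arc in side `s` ends at a tangency point of the field of the opposite
side. -/
def IsTypeC (S : PWLSystem) (s : Side) (Γ : Set (Fin 2 → ℝ)) : Prop :=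
  ∃ γ T, S.IsPeriodicSolution γ T ∧ Γ = range γ ∧
    ∃ t₁ t₂, S.SlidesOn γ 0 t₁ ∧ LoopsOn γ s t₁ t₂ ∧ S.IsTangency s.opp (γ t₂) ∧
      LoopsOn γ s.opp t₂ T

/-- Two attractive sliding segments, the first left into side `s` and the second into the opposite
side, joined by one arc in each side. -/
def IsTypeD (S : PWLSystem) (s : Side) (Γ : Set (Fin 2 → ℝ)) : Prop :=
  ∃ γ T, S.IsPeriodicSolution γ T ∧ Γ = range γ ∧
    ∃ t₁ t₂ t₃, S.SlidesOn γ 0 t₁ ∧ LoopsOn γ s t₁ t₂ ∧ S.SlidesOn γ t₂ t₃ ∧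
      LoopsOn γ s.opp t₃ T

/-- Two sliding periodic orbits in opposite closed half planes: one of type A, and one that is of
type A backward in time (so that it slides along the repulsive sliding region). -/
def HasPairA (S : PWLSystem) : Prop :=
  ∃ s Γ₁ Γ₂, S.IsTypeA s Γ₁ ∧ S.reverse.IsTypeA s.opp Γ₂

/-- Two sliding periodic orbits of type A in opposite closed half planes. -/
def HasPairB (S : PWLSystem) : Prop :=
  ∃ s Γ₁ Γ₂, S.IsTypeA s Γ₁ ∧ S.IsTypeA s.opp Γ₂

/-- A sliding periodic orbit of type A in one closed half plane, and one of type B that leaves its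
sliding segment into the opposite half plane. -/
def HasPairC (S : PWLSystem) : Prop :=
  ∃ s Γ₁ Γ₂, S.IsTypeA s Γ₁ ∧ S.IsTypeB s.opp Γ₂

/-- Orbital (Lyapunov) stability of a set `Γ`, forward in time. -/
def IsOrbitallyStable (S : PWLSystem) (Γ : Set (Fin 2 → ℝ)) : Prop :=
  ∀ U, IsOpen U → Γ ⊆ U → ∃ V, IsOpen V ∧ Γ ⊆ V ∧
    ∀ γ, S.IsSolutionOn γ (Ici 0) → γ 0 ∈ V → ∀ t, 0 ≤ t → γ t ∈ U

/-- `Γ` is unstable: it is not orbitally stable, and it is not even semistable, as every solution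
that starts near `Γ` but not on `Γ` leaves a fixed neighbourhood of `Γ`. -/
def IsUnstable (S : PWLSystem) (Γ : Set (Fin 2 → ℝ)) : Prop :=
  ¬ S.IsOrbitallyStable Γ ∧ ∃ U, IsOpen U ∧ Γ ⊆ U ∧
    ∀ γ, S.IsSolutionOn γ (Ici 0) → γ 0 ∈ U → γ 0 ∉ Γ → ∃ t, 0 ≤ t ∧ γ t ∉ U

end PWLSystem

/-! On one side of the switching line the distance `n` to the line satisfies `n'' = tr n' - dt n +
kap`, where trace and determinant are those of the matrix of that side. If an orbit leaves the line
at a tangency and comes back transversally, this scalar equation leaves one possibility: an unstable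
focus in the open half plane (`IsArc.visibleUnstable`). Real eigenvalues would make `n` monotone up
to an exponential factor, and a nonpositive trace would keep the spiral from getting back
transversally. A sliding segment can be left only at a tangency of the exit side
(`SlidesOn.vel_exit`), so every sliding orbit in the hypotheses provides such foci.

After scaling, a focus has one parameter `g`, and its half return map `focusMap g` is given
implicitly by `focusPrim (-g) v = focusPrim g u + 2πg`, which is the law of the logarithmic spiral.
Implicit differentiation yields the three facts used: the map is increasing, convex, and lies above
`exp (πg) u`.

Nonexistence: one side has an unstable focus, the other one a stable focus, and every return from
the first side lands in the interior of the sliding segment. A crossing orbit would thus use only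
the second side, but an arc there that ends on the line cannot be followed by another one, because a
stable focus is left behind with strictly positive normal velocity.

Uniqueness and instability (`ReturnMap.exists_unique_unstable`): with two unstable foci the full
return map is increasing and convex on the whole line and eventually above the diagonal. All the
listed configurations say that some orbit through a tangency lands in the sliding segment, which
puts the map below the diagonal at a point left of every possible crossing orbit. A convex function
that passes from below to above the diagonal does so once, and all its secants at the fixed point
from there on have slope at least some `c > 1`. Hence the crossing orbit is unique, and it repels on
both sides.

Two crossing orbits: in `focusNode c` the left field is a node with eigenvalue ratio two, whose half
return map is a Möbius map (`nodeMap`). The fixed point equation reads `nodeDefect c V = 2π`. The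
sign of the derivative of `nodeDefect` is that of a quartic with negative constant, linear and
leading coefficients, so Rolle's theorem excludes three solutions, while the intermediate value
theorem gives two. Sliding has constant upward velocity and ends at the origin, so every sliding
periodic orbit passes through the origin and is unique; the choice of `c` against `focusMap 1 0`
decides whether it is of type (a) or (b). -/

/-! ### The half return map of the normalized unstable focus -/

/-- A primitive of `u / (1 + (u + g)²)`. -/
noncomputable def focusPrim (g u : ℝ) : ℝ :=
  1 / 2 * Real.log (1 + (u + g) ^ 2) - g * Real.arctan (u + g)

lemma hasDerivAt_focusPrim (g u : ℝ) :
    HasDerivAt (focusPrim g) (u / (1 + (u + g) ^ 2)) u := by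
  have h1 : HasDerivAt (fun u : ℝ => u + g) 1 u := (hasDerivAt_id u).add_const g
  have hpos : 1 + (u + g) ^ 2 ≠ 0 := by positivity
  have h2 := (((h1.pow 2).const_add 1).log hpos).const_mul (1 / 2)
  have h3 := (h1.arctan).const_mul g
  refine (h2.sub h3).congr_deriv ?_
  simp only [Pi.pow_apply]
  field_simp
  norm_num
  ring

lemma continuous_focusPrim (g : ℝ) : Continuous (focusPrim g) :=
  continuous_iff_continuousAt.2 fun u => (hasDerivAt_focusPrim g u).continuousAt

lemma strictMonoOn_focusPrim (g : ℝ) : StrictMonoOn (focusPrim g) (Ici 0) := by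
  refine strictMonoOn_of_deriv_pos (convex_Ici 0) (continuous_focusPrim g).continuousOn ?_
  intro u hu
  rw [interior_Ici] at hu
  rw [(hasDerivAt_focusPrim g u).deriv]
  have : (0 : ℝ) < u := hu
  positivity

lemma tendsto_focusPrim (g : ℝ) : Tendsto (focusPrim g) atTop atTop := by
  have h1 : Tendsto (fun u : ℝ => 1 / 2 * Real.log (1 + (u + g) ^ 2)) atTop atTop := by
    refine Tendsto.const_mul_atTop (by norm_num) (Real.tendsto_log_atTop.comp ?_)
    refine tendsto_atTop_add_const_left _ _ ?_
    exact (tendsto_pow_atTop (by norm_num)).comp (tendsto_atTop_add_const_right _ g tendsto_id)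
  refine tendsto_atTop_mono (fun u => ?_)
    (tendsto_atTop_add_const_right atTop (-(|g| * (Real.pi / 2))) h1)
  have h2 : g * Real.arctan (u + g) ≤ |g| * (Real.pi / 2) := by
    calc g * Real.arctan (u + g) ≤ |g * Real.arctan (u + g)| := le_abs_self _
      _ = |g| * |Real.arctan (u + g)| := abs_mul _ _
      _ ≤ _ := by
        gcongr
        exact abs_le.2 ⟨(Real.neg_pi_div_two_lt_arctan _).le, (Real.arctan_lt_pi_div_two _).le⟩
  unfold focusPrim
  linarith

/-- The extension of `focusPrim g` from `[0, ∞)` to the line with slope one on the left. -/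
noncomputable def focusPrimExt (g v : ℝ) : ℝ := focusPrim g (max v 0) + min v 0

lemma continuous_focusPrimExt (g : ℝ) : Continuous (focusPrimExt g) :=
  ((continuous_focusPrim g).comp (continuous_id.max continuous_const)).add
    (continuous_id.min continuous_const)

/-- The linear piece on the left only serves to make the primitive a bijection of the line, so that
its inverse is defined and continuous everywhere. -/
lemma strictMono_focusPrimExt (g : ℝ) : StrictMono (focusPrimExt g) := by
  intro a b hab
  unfold focusPrimExt
  have hmono := strictMonoOn_focusPrim g
  rcases le_or_gt 0 a with ha | ha
  · have hb : 0 ≤ b := ha.trans hab.le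
    rw [max_eq_left ha, max_eq_left hb, min_eq_right ha, min_eq_right hb]
    have := hmono ha hb hab
    linarith
  · have h1 : focusPrim g (max a 0) ≤ focusPrim g (max b 0) :=
      hmono.monotoneOn (le_max_right a 0) (le_max_right b 0) (max_le_max hab.le le_rfl)
    have h2 : min a 0 < min b 0 := by
      rw [min_eq_left ha.le]; exact lt_min hab ha
    linarith

lemma surjective_focusPrimExt (g : ℝ) : Function.Surjective (focusPrimExt g) := by
  refine (continuous_focusPrimExt g).surjective ?_ ?_
  · refine (tendsto_focusPrim g).congr' ?_
    filter_upwards [eventually_ge_atTop 0] with v hv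
    simp [focusPrimExt, hv]
  · have : Tendsto (fun v : ℝ => focusPrim g 0 + v) atBot atBot :=
      tendsto_atBot_add_const_left _ _ tendsto_id
    refine this.congr' ?_
    filter_upwards [eventually_le_atBot 0] with v hv
    simp [focusPrimExt, hv]

/-- The extended primitive as a homeomorphism of the line. -/
noncomputable def focusPrimHomeo (g : ℝ) : ℝ ≃ₜ ℝ :=
  ((strictMono_focusPrimExt g).orderIsoOfSurjective _ (surjective_focusPrimExt g)).toHomeomorph

lemma focusPrimHomeo_apply (g v : ℝ) : focusPrimHomeo g v = focusPrimExt g v := rfl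

/-- The half return map of the normalized unstable focus `X'' = 2 g X' - (1 + g²) (X - 1)` on
`X > 0`: an orbit that leaves `X = 0` with speed `u` comes back with speed `focusMap g u`. It is
extended to the left of `0` by a constant. -/
noncomputable def focusMap (g u : ℝ) : ℝ :=
  (focusPrimHomeo (-g)).symm (focusPrim g (max u 0) + 2 * Real.pi * g)

lemma continuous_focusMap (g : ℝ) : Continuous (focusMap g) :=
  (focusPrimHomeo (-g)).symm.continuous.comp
    (((continuous_focusPrim g).comp (continuous_id.max continuous_const)).add continuous_const)

lemma focusPrimExt_focusMap (g u : ℝ) :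
    focusPrimExt (-g) (focusMap g u) = focusPrim g (max u 0) + 2 * Real.pi * g := by
  rw [← focusPrimHomeo_apply, focusMap, Homeomorph.apply_symm_apply]

/-- Half of `2πg` pays for the logarithms, as scaling by `k` multiplies the squared radius by at
most `k²`. The other half pays for the two arctangents, each of which is below `π/2`. -/
lemma focusPrim_lt {g u : ℝ} (hg : 0 < g) (hu : 0 ≤ u) :
    focusPrim (-g) (Real.exp (Real.pi * g) * u) < focusPrim g u + 2 * Real.pi * g := by
  set k := Real.exp (Real.pi * g) with hk
  have hk1 : 1 ≤ k := Real.one_le_exp (by positivity)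
  have h1 : 1 + (k * u + -g) ^ 2 ≤ k ^ 2 * (1 + (u + g) ^ 2) := by
    have h2 : (k * u + -g) ^ 2 ≤ (k * (u + g)) ^ 2 := by
      apply sq_le_sq'
      · nlinarith [mul_nonneg (by linarith : (0:ℝ) ≤ k) hu]
      · nlinarith [mul_nonneg (by linarith : (0:ℝ) ≤ k) hg.le]
    nlinarith
  have h2 : Real.log (1 + (k * u + -g) ^ 2) ≤ 2 * (Real.pi * g) + Real.log (1 + (u + g) ^ 2) := by
    calc _ ≤ Real.log (k ^ 2 * (1 + (u + g) ^ 2)) := Real.log_le_log (by positivity) h1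
      _ = _ := by
        rw [Real.log_mul (by positivity) (by positivity), Real.log_pow, hk, Real.log_exp]
        norm_num
  have h3 := Real.arctan_lt_pi_div_two (k * u + -g)
  have h4 := Real.arctan_lt_pi_div_two (u + g)
  unfold focusPrim
  nlinarith [mul_lt_mul_of_pos_left h3 hg, mul_lt_mul_of_pos_left h4 hg]

lemma exp_mul_lt_focusMap {g u : ℝ} (hg : 0 < g) (hu : 0 ≤ u) :
    Real.exp (Real.pi * g) * u < focusMap g u := by
  rw [← (strictMono_focusPrimExt (-g)).lt_iff_lt, focusPrimExt_focusMap, max_eq_left hu]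
  have : 0 ≤ Real.exp (Real.pi * g) * u := by positivity
  simpa [focusPrimExt, this] using focusPrim_lt hg hu

lemma monotone_focusMap (g : ℝ) : Monotone (focusMap g) := by
  intro a b hab
  rw [← (strictMono_focusPrimExt (-g)).le_iff_le, focusPrimExt_focusMap, focusPrimExt_focusMap]
  have := (strictMonoOn_focusPrim g).monotoneOn (le_max_right a 0) (le_max_right b 0)
    (max_le_max hab le_rfl)
  linarith

lemma strictMonoOn_focusMap (g : ℝ) : StrictMonoOn (focusMap g) (Ici 0) := by
  intro a ha b hb hab
  rw [← (strictMono_focusPrimExt (-g)).lt_iff_lt, focusPrimExt_focusMap, focusPrimExt_focusMap,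
    max_eq_left ha, max_eq_left hb]
  have := strictMonoOn_focusPrim g ha hb hab
  linarith

/-- This includes `u = 0`: the orbit that leaves tangentially comes back transversally. -/
lemma focusMap_pos {g : ℝ} (hg : 0 < g) (u : ℝ) : 0 < focusMap g u := by
  have h0 := exp_mul_lt_focusMap hg (le_refl 0)
  rcases le_or_gt 0 u with hu | hu
  · exact lt_of_le_of_lt (by positivity) (exp_mul_lt_focusMap hg hu)
  · have : focusMap g u = focusMap g 0 := by simp [focusMap, hu.le]
    rw [this]; simpa using h0

lemma lt_focusMap {g u : ℝ} (hg : 0 < g) (hu : 0 ≤ u) : u < focusMap g u := by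
  refine lt_of_le_of_lt ?_ (exp_mul_lt_focusMap hg hu)
  have : 1 ≤ Real.exp (Real.pi * g) := Real.one_le_exp (by positivity)
  nlinarith

lemma focusPrim_focusMap {g u : ℝ} (hg : 0 < g) (hu : 0 ≤ u) :
    focusPrim (-g) (focusMap g u) = focusPrim g u + 2 * Real.pi * g := by
  have h := focusPrimExt_focusMap g u
  have hp := (focusMap_pos hg u).le
  simpa [focusPrimExt, hp, hu] using h

/-- The implicit equation has a single nonnegative solution, so a return speed is identified as soon
as it satisfies the equation. -/
lemma eq_focusMap {g u v : ℝ} (hu : 0 ≤ u) (hv : 0 ≤ v)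
    (h : focusPrim (-g) v = focusPrim g u + 2 * Real.pi * g) : v = focusMap g u := by
  apply (strictMono_focusPrimExt (-g)).injective
  rw [focusPrimExt_focusMap, max_eq_left hu]
  simpa [focusPrimExt, hv] using h

/-- Differentiating the implicit equation gives `v dv / (1 + (v - g)²) = u du / (1 + (u + g)²)`. -/
lemma hasDerivAt_focusMap {g u : ℝ} (hg : 0 < g) (hu : 0 < u) :
    HasDerivAt (focusMap g)
      (u * (1 + (focusMap g u + -g) ^ 2) / (focusMap g u * (1 + (u + g) ^ 2))) u := by
  have hf := focusMap_pos hg u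
  have hsymm : HasDerivAt (focusPrimHomeo (-g)).symm
      (focusMap g u / (1 + (focusMap g u + -g) ^ 2))⁻¹ (focusPrim g u + 2 * Real.pi * g) := by
    have hval : (focusPrimHomeo (-g)).symm (focusPrim g u + 2 * Real.pi * g) = focusMap g u := by
      simp [focusMap, hu.le]
    refine HasDerivAt.of_local_left_inverse (f := focusPrimHomeo (-g))
      (focusPrimHomeo (-g)).symm.continuous.continuousAt ?_ (by positivity)
      (Eventually.of_forall fun y => (focusPrimHomeo (-g)).apply_symm_apply y)
    rw [hval]
    refine (hasDerivAt_focusPrim (-g) _).congr_of_eventuallyEq ?_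
    filter_upwards [lt_mem_nhds hf] with v hv
    simp [focusPrimHomeo_apply, focusPrimExt, hv.le]
  have h := hsymm.comp u ((hasDerivAt_focusPrim g u).add_const (2 * Real.pi * g))
  refine (h.congr_of_eventuallyEq ?_).congr_deriv ?_
  · filter_upwards [lt_mem_nhds hu] with w hw
    simp [focusMap, hw.le]
  · field_simp

/-- The second derivative has the sign of `v² - u²`, where `v` is the return speed, and an unstable
focus returns faster than it started. The constant extension to the left keeps convexity and
monotonicity, so half return maps can later be composed without domain conditions. -/
lemma convexOn_focusMap {g : ℝ} (hg : 0 < g) : ConvexOn ℝ univ (focusMap g) := by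
  have key : ConvexOn ℝ (Ici 0) (focusMap g) := by
    refine MonotoneOn.convexOn_of_deriv (convex_Ici 0) (continuous_focusMap g).continuousOn ?_ ?_
    · intro u hu
      rw [interior_Ici] at hu
      exact (hasDerivAt_focusMap hg hu).differentiableAt.differentiableWithinAt
    · rw [interior_Ici]
      set F : ℝ → ℝ := fun u =>
        u * (1 + (focusMap g u + -g) ^ 2) / (focusMap g u * (1 + (u + g) ^ 2)) with hF
      -- Here `F` is the first derivative; inserting the formula for the derivative of `focusMap`
      -- again, all terms but `v² - u²` combine into positive factors.
      have hder : ∀ u, 0 < u → HasDerivAt F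
          ((1 + g ^ 2) * (focusMap g u ^ 2 - u ^ 2) * (1 + (focusMap g u + -g) ^ 2) /
            (focusMap g u ^ 3 * (1 + (u + g) ^ 2) ^ 2)) u := by
        intro u hu
        have hf := focusMap_pos hg u
        have hd := hasDerivAt_focusMap hg hu
        have hid := hasDerivAt_id u
        have h1 := hid.mul (((hd.add_const (-g)).pow 2).const_add 1)
        have h2 := hd.mul (((hid.add_const g).pow 2).const_add 1)
        have h3 := h1.div h2 (by simp only [Pi.mul_apply, Pi.pow_apply, id]; positivity)
        refine h3.congr_deriv ?_
        simp
        field_simp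
        ring
      have hmono : MonotoneOn F (Ioi 0) := by
        refine monotoneOn_of_deriv_nonneg (convex_Ioi 0)
          (fun u hu => (hder u hu).continuousAt.continuousWithinAt) ?_ ?_
        · intro u hu
          rw [interior_Ioi] at hu
          exact (hder u hu).differentiableAt.differentiableWithinAt
        · intro u hu
          rw [interior_Ioi] at hu
          have hu0 : (0 : ℝ) < u := hu
          rw [(hder u hu).deriv]
          have hf := focusMap_pos hg u
          have h1 : 0 ≤ focusMap g u ^ 2 - u ^ 2 := by
            have := lt_focusMap hg hu0.le
            nlinarith
          positivity
      intro a ha b hb hab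
      rw [(hasDerivAt_focusMap hg ha).deriv, (hasDerivAt_focusMap hg hb).deriv]
      exact hmono ha hb hab
  have hmax : ConvexOn ℝ univ (fun u : ℝ => max u 0) :=
    (convexOn_id convex_univ).sup (convexOn_const 0 convex_univ)
  have himg : (fun u : ℝ => max u 0) '' univ ⊆ Ici 0 := by
    rintro _ ⟨u, -, rfl⟩; exact le_max_right u 0
  have hcv : Convex ℝ ((fun u : ℝ => max u 0) '' univ) := by
    have : (fun u : ℝ => max u 0) '' univ = Ici 0 := by
      refine himg.antisymm fun v hv => ⟨v, trivial, max_eq_left hv⟩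
    rw [this]; exact convex_Ici 0
  have h := (key.subset himg hcv).comp hmax ((monotone_focusMap g).monotoneOn _)
  have he : focusMap g ∘ (fun u : ℝ => max u 0) = focusMap g := by
    funext u; simp [focusMap]
  rwa [he] at h


/-! ### Explicit orbits of the normalized focus and their first return -/

/-- The solution of `X'' = 2 g X' - (1 + g²) (X - 1)` with `X(0) = 0` and `X'(0) = ξ`. -/
noncomputable def focusOrbit (g ξ θ : ℝ) : ℝ :=
  1 + Real.exp (g * θ) * (-Real.cos θ + (ξ + g) * Real.sin θ)

/-- The derivative of `focusOrbit g ξ`. -/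
noncomputable def focusSpeed (g ξ θ : ℝ) : ℝ :=
  Real.exp (g * θ) * (ξ * Real.cos θ + (1 + g ^ 2 + g * ξ) * Real.sin θ)

lemma hasDerivAt_exp_mul (g θ : ℝ) :
    HasDerivAt (fun θ : ℝ => Real.exp (g * θ)) (g * Real.exp (g * θ)) θ := by
  have h := ((hasDerivAt_id θ).const_mul g).exp
  refine h.congr_deriv ?_
  simp only [id]
  ring

lemma hasDerivAt_focusOrbit (g ξ θ : ℝ) :
    HasDerivAt (focusOrbit g ξ) (focusSpeed g ξ θ) θ := by
  have h := ((hasDerivAt_exp_mul g θ).mul (((Real.hasDerivAt_cos θ).neg).add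
    ((Real.hasDerivAt_sin θ).const_mul (ξ + g)))).const_add 1
  refine h.congr_deriv ?_
  simp only [focusSpeed, Pi.add_apply, Pi.neg_apply]
  ring

lemma hasDerivAt_focusSpeed (g ξ θ : ℝ) :
    HasDerivAt (focusSpeed g ξ)
      (2 * g * focusSpeed g ξ θ - (1 + g ^ 2) * (focusOrbit g ξ θ - 1)) θ := by
  have h := (hasDerivAt_exp_mul g θ).mul (((Real.hasDerivAt_cos θ).const_mul ξ).add
    ((Real.hasDerivAt_sin θ).const_mul (1 + g ^ 2 + g * ξ)))
  refine h.congr_deriv ?_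
  simp only [focusSpeed, focusOrbit, Pi.add_apply]
  ring

lemma focusOrbit_zero (g ξ : ℝ) : focusOrbit g ξ 0 = 0 := by simp [focusOrbit]

lemma focusSpeed_zero (g ξ : ℝ) : focusSpeed g ξ 0 = ξ := by simp [focusSpeed]

lemma continuous_focusOrbit (g ξ : ℝ) : Continuous (focusOrbit g ξ) :=
  continuous_iff_continuousAt.2 fun θ => (hasDerivAt_focusOrbit g ξ θ).continuousAt

/-- For `ξ = 0` the speed is a positive multiple of `sin θ`, so the orbit rises during the first
half turn; a larger initial speed adds a nonnegative multiple of `sin θ` to the position. -/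
lemma focusOrbit_pos_of_le_pi (g : ℝ) {ξ θ : ℝ} (hξ : 0 ≤ ξ) (h0 : 0 < θ) (hπ : θ ≤ Real.pi) :
    0 < focusOrbit g ξ θ := by
  have hmono : StrictMonoOn (focusOrbit g 0) (Icc 0 Real.pi) := by
    refine strictMonoOn_of_deriv_pos (convex_Icc _ _) (continuous_focusOrbit g 0).continuousOn ?_
    intro t ht
    rw [interior_Icc] at ht
    rw [(hasDerivAt_focusOrbit g 0 t).deriv]
    have := Real.sin_pos_of_pos_of_lt_pi ht.1 ht.2
    simp only [focusSpeed, zero_mul, zero_add, mul_zero, add_zero]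
    positivity
  have h1 := hmono (left_mem_Icc.2 Real.pi_pos.le) ⟨h0.le, hπ⟩ h0
  rw [focusOrbit_zero] at h1
  have h2 : focusOrbit g ξ θ = focusOrbit g 0 θ + ξ * (Real.exp (g * θ) * Real.sin θ) := by
    simp only [focusOrbit]; ring
  have h3 := Real.sin_nonneg_of_nonneg_of_le_pi h0.le hπ
  rw [h2]
  have : 0 ≤ ξ * (Real.exp (g * θ) * Real.sin θ) := by positivity
  linarith

lemma sin_neg_of_pi_lt {θ : ℝ} (h1 : Real.pi < θ) (h2 : θ < 2 * Real.pi) : Real.sin θ < 0 := by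
  have := Real.sin_pos_of_pos_of_lt_pi (x := θ - Real.pi) (by linarith) (by linarith)
  rw [Real.sin_sub_pi] at this
  linarith

/-- In Jordan coordinates about the equilibrium the orbit is a logarithmic spiral. Over the angle
`θ` its log-radius grows by `gθ`, and the angle is a full turn minus the arctangents of the initial
and final slopes `ξ + g` and `f - g`. Eliminating `θ` between these two relations is exactly the
implicit equation of `focusMap`. -/
lemma focusSpeed_of_focusOrbit_eq_zero {g ξ θ : ℝ} (hg : 0 < g) (hξ : 0 ≤ ξ)
    (h1 : Real.pi < θ) (h2 : θ < 2 * Real.pi) (h0 : focusOrbit g ξ θ = 0) :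
    focusSpeed g ξ θ = -focusMap g ξ := by
  have hs := sin_neg_of_pi_lt h1 h2
  have hθ : 0 < θ := Real.pi_pos.trans h1
  have hE1 : 1 < Real.exp (g * θ) := Real.one_lt_exp_iff.2 (by positivity)
  have hE0 := Real.exp_pos (g * θ)
  have hc := Real.cos_le_one θ
  have hsc := Real.sin_sq_add_cos_sq θ
  set s := Real.sin θ with hs'
  set c := Real.cos θ with hc'
  set E := Real.exp (g * θ) with hE
  have hs0 : s ≠ 0 := hs.ne
  -- The return condition is linear in `ξ`; since `s < 0` it can be solved for `ξ + g`, and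
  -- everything becomes rational in `E`, `s`, `c`.
  have hX : E * ((ξ + g) * s) = E * c - 1 := by
    have : 1 + E * (-c + (ξ + g) * s) = 0 := h0
    linarith
  have hξg : ξ + g = (E * c - 1) / (E * s) := by
    field_simp
    linarith
  set f := -focusSpeed g ξ θ with hf
  have hfs : f * s = c + g * s - E := by
    have hF : f = -(E * (ξ * c + (1 + g ^ 2 + g * ξ) * s)) := rfl
    have e1 : f * s = -(E * s ^ 2 + g * s * (E * ((ξ + g) * s)) + c * (E * ((ξ + g) * s))
        - g * (E * c * s)) := by rw [hF]; ring
    rw [e1, hX]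
    linear_combination (-E) * hsc
  have hfg : f + -g = (c - E) / s := by
    rw [eq_div_iff hs.ne]; linarith
  have hfpos : 0 < f := by
    have : 0 < (c - E) / s := div_pos_of_neg_of_neg (by linarith) hs
    linarith
  suffices f = focusMap g ξ by linarith
  refine eq_focusMap hξ hfpos.le ?_
  have hlog : Real.log (1 + (f + -g) ^ 2) = 2 * (g * θ) + Real.log (1 + (ξ + g) ^ 2) := by
    have : 1 + (f + -g) ^ 2 = E ^ 2 * (1 + (ξ + g) ^ 2) := by
      rw [hfg, hξg]
      field_simp
      nlinarith [hsc]
    rw [this, Real.log_mul (by positivity) (by positivity), Real.log_pow, hE, Real.log_exp]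
    norm_num
  have harc : Real.arctan (f + -g) = 2 * Real.pi - θ - Real.arctan (ξ + g) := by
    set α := Real.arctan (ξ + g) with hα
    have hα1 := Real.neg_pi_div_two_lt_arctan (ξ + g)
    have hα2 := Real.arctan_lt_pi_div_two (ξ + g)
    have hcα : 0 < Real.cos α := Real.cos_arctan_pos _
    have hsα : Real.sin α = (ξ + g) * Real.cos α := by
      have := Real.tan_arctan (ξ + g)
      rw [Real.tan_eq_sin_div_cos, div_eq_iff hcα.ne'] at this
      exact this
    have hcos : Real.cos (2 * Real.pi - θ - α) = Real.cos α / E := by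
      rw [show 2 * Real.pi - θ - α = 2 * Real.pi - (θ + α) by ring, Real.cos_two_pi_sub,
        Real.cos_add, hsα, ← hs', ← hc', hξg]
      field_simp
      ring
    have hsin : Real.sin (2 * Real.pi - θ - α) = (f + -g) * (Real.cos α / E) := by
      rw [show 2 * Real.pi - θ - α = 2 * Real.pi - (θ + α) by ring, Real.sin_two_pi_sub,
        Real.sin_add, hsα, ← hs', ← hc', hξg, hfg]
      field_simp
      ring_nf
      nlinarith [hsc]
    have hcpos : 0 < Real.cos (2 * Real.pi - θ - α) := by rw [hcos]; positivity
    -- The angle lies in `(-π/2, 3π/2)` by the ranges of `θ` and `α`; its positive cosine puts it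
    -- into the range of the arctangent.
    have hub : 2 * Real.pi - θ - α < Real.pi / 2 := by
      by_contra hcon
      push Not at hcon
      have := Real.cos_nonpos_of_pi_div_two_le_of_le hcon (by linarith)
      linarith
    refine Real.arctan_eq_of_tan_eq ?_ ⟨by linarith, hub⟩
    rw [Real.tan_eq_sin_div_cos, hsin, hcos]
    field_simp
  unfold focusPrim
  rw [hlog, harc]
  ring

/-- At `π` the orbit is still positive and at `2π` it is at `1 - exp (2πg) < 0`, so the first return
happens strictly between; the least zero in `[π, 2π]` is that return. -/
lemma exists_focus_return {g ξ : ℝ} (hg : 0 < g) (hξ : 0 ≤ ξ) :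
    ∃ θ, Real.pi < θ ∧ focusOrbit g ξ θ = 0 ∧ (∀ t ∈ Ioo 0 θ, 0 < focusOrbit g ξ t) ∧
      focusSpeed g ξ θ = -focusMap g ξ := by
  have hπ : 0 < focusOrbit g ξ Real.pi :=
    focusOrbit_pos_of_le_pi g hξ Real.pi_pos le_rfl
  have h2π : focusOrbit g ξ (2 * Real.pi) < 0 := by
    have : 1 < Real.exp (g * (2 * Real.pi)) := Real.one_lt_exp_iff.2 (by positivity)
    simp only [focusOrbit, Real.cos_two_pi, Real.sin_two_pi]
    linarith
  have hcont := continuous_focusOrbit g ξ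
  obtain ⟨t, ht, ht0⟩ := intermediate_value_Icc' (f := focusOrbit g ξ)
    (by linarith [Real.pi_pos]) hcont.continuousOn ⟨h2π.le, hπ.le⟩
  have hcomp : IsCompact (Icc Real.pi (2 * Real.pi) ∩ {t | focusOrbit g ξ t = 0}) :=
    isCompact_Icc.inter_right (isClosed_eq hcont continuous_const)
  obtain ⟨θ, ⟨hθI, hθ0⟩, hmin⟩ := hcomp.exists_isLeast ⟨t, ht, ht0⟩
  have hθ1 : Real.pi < θ := by
    rcases hθI.1.lt_or_eq with h | h
    · exact h
    · rw [mem_ofPred_eq, ← h] at hθ0; linarith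
  have hθ2 : θ < 2 * Real.pi := by
    rcases hθI.2.lt_or_eq with h | h
    · exact h
    · rw [mem_ofPred_eq, h] at hθ0; linarith
  refine ⟨θ, hθ1, hθ0, ?_, focusSpeed_of_focusOrbit_eq_zero hg hξ hθ1 hθ2 hθ0⟩
  intro t ht
  rcases le_or_gt t Real.pi with h | h
  · exact focusOrbit_pos_of_le_pi g hξ ht.1 h
  · by_contra hneg
    push Not at hneg
    obtain ⟨w, hw, hw0⟩ := intermediate_value_Icc' (f := focusOrbit g ξ) h.le hcont.continuousOn
      ⟨hneg, hπ.le⟩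
    have := hmin ⟨⟨hw.1, hw.2.trans (ht.2.le.trans hθI.2)⟩, hw0⟩
    linarith [hw.2, ht.2]


/-! ### Sides, normal velocities, arcs and flows -/

/-- The sign of the first coordinate on a side. -/
def Side.sgn : Side → ℝ
  | .right => 1
  | .left => -1

@[simp] lemma Side.sgn_mul_self (s : Side) : s.sgn * s.sgn = 1 := by cases s <;> norm_num [Side.sgn]

@[simp] lemma Side.sgn_opp (s : Side) : s.opp.sgn = -s.sgn := by cases s <;> norm_num [Side.sgn, Side.opp]

@[simp] lemma Side.opp_opp (s : Side) : s.opp.opp = s := by cases s <;> rfl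

lemma Side.sgn_ne_zero (s : Side) : s.sgn ≠ 0 := by cases s <;> norm_num [Side.sgn]

lemma Side.eq_or_eq_opp (s s' : Side) : s' = s ∨ s' = s.opp := by
  cases s <;> cases s' <;> simp [Side.opp]

lemma Side.mem_region {s : Side} {z : Fin 2 → ℝ} : z ∈ s.region ↔ 0 < s.sgn * z 0 := by
  cases s <;> simp [Side.region, Side.sgn]

lemma isClosed_switchingLine : IsClosed switchingLine :=
  isClosed_eq (continuous_apply 0) continuous_const

lemma mem_switchingLine {z : Fin 2 → ℝ} : z ∈ switchingLine ↔ z 0 = 0 := Iff.rfl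

lemma Side.notMem_switchingLine {s : Side} {z : Fin 2 → ℝ} (h : z ∈ s.region) :
    z ∉ switchingLine := by
  intro h'
  rw [Side.mem_region, mem_switchingLine.1 h', mul_zero] at h
  exact lt_irrefl _ h

lemma Side.eq_of_mem_region {s s' : Side} {z : Fin 2 → ℝ} (h : z ∈ s.region)
    (h' : z ∈ s'.region) : s' = s := by
  rcases s.eq_or_eq_opp s' with e | e
  · exact e
  · subst e
    rw [Side.mem_region] at h h'
    rw [Side.sgn_opp] at h'
    linarith

lemma exists_mem_region {z : Fin 2 → ℝ} (h : z ∉ switchingLine) : ∃ s : Side, z ∈ s.region := by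
  rcases lt_or_gt_of_ne (fun e => h e : z 0 ≠ 0) with h0 | h0
  · exact ⟨.left, h0⟩
  · exact ⟨.right, h0⟩

/-- A curve that avoids the switching line on an interval stays on one side. -/
lemma exists_side_of_forall_notMem {γ : ℝ → Fin 2 → ℝ} {a b : ℝ} (hab : a < b)
    (hc : ContinuousOn γ (Ioo a b)) (h : ∀ t ∈ Ioo a b, γ t ∉ switchingLine) :
    ∃ s : Side, ∀ t ∈ Ioo a b, γ t ∈ s.region := by
  have hm : (a + b) / 2 ∈ Ioo a b := ⟨by linarith, by linarith⟩
  obtain ⟨s, hs⟩ := exists_mem_region (h _ hm)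
  refine ⟨s, fun t ht => ?_⟩
  obtain ⟨s', hs'⟩ := exists_mem_region (h t ht)
  rcases s.eq_or_eq_opp s' with e | e
  · rwa [← e]
  · exfalso
    subst e
    rw [Side.mem_region] at hs hs'
    rw [Side.sgn_opp] at hs'
    have hcx : ContinuousOn (fun t => s.sgn * γ t 0) (Ioo a b) :=
      continuousOn_const.mul ((continuous_apply 0).comp_continuousOn hc)
    obtain ⟨w, hw, hw0⟩ := isPreconnected_Ioo.intermediate_value ht hm hcx
      (show (0 : ℝ) ∈ Icc _ _ from ⟨by linarith, hs.le⟩)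
    refine h w hw ?_
    have := s.sgn_ne_zero
    simpa [this, mem_switchingLine] using hw0

namespace PWLSystem

variable {S : PWLSystem} {s : Side}

/-- The component of the field of side `s` along the inner normal of `s`. -/
def vel (S : PWLSystem) (s : Side) (z : Fin 2 → ℝ) : ℝ := s.sgn * S.field s z 0

lemma continuous_field (S : PWLSystem) (s : Side) : Continuous (S.field s) :=
  (Continuous.matrix_mulVec continuous_const continuous_id).add continuous_const

lemma continuous_vel (S : PWLSystem) (s : Side) : Continuous (S.vel s) :=
  continuous_const.mul ((continuous_apply 0).comp (S.continuous_field s))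

lemma field_zero (S : PWLSystem) (s : Side) (z : Fin 2 → ℝ) :
    S.field s z 0 = S.A s 0 0 * z 0 + S.A s 0 1 * z 1 + S.b s 0 := by
  simp [field]

lemma field_one (S : PWLSystem) (s : Side) (z : Fin 2 → ℝ) :
    S.field s z 1 = S.A s 1 0 * z 0 + S.A s 1 1 * z 1 + S.b s 1 := by
  simp [field]

lemma reverse_field (S : PWLSystem) (s : Side) (z : Fin 2 → ℝ) :
    S.reverse.field s z = -S.field s z := by
  simp only [field, reverse, Matrix.neg_mulVec]
  abel

@[simp] lemma reverse_reverse (S : PWLSystem) : S.reverse.reverse = S := by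
  simp [reverse]

lemma reverse_vel (S : PWLSystem) (s : Side) (z : Fin 2 → ℝ) :
    S.reverse.vel s z = -S.vel s z := by
  simp [vel, reverse_field]

lemma mem_attractiveRegion (s : Side) {z : Fin 2 → ℝ} :
    z ∈ S.attractiveRegion ↔ z ∈ switchingLine ∧ S.vel s z < 0 ∧ S.vel s.opp z < 0 := by
  cases s <;> simp [attractiveRegion, vel, Side.sgn, Side.opp, and_comm]

lemma mem_slidingRegion (s : Side) {z : Fin 2 → ℝ} :
    z ∈ S.slidingRegion ↔ z ∈ switchingLine ∧ 0 ≤ S.vel s z * S.vel s.opp z := by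
  cases s <;> simp [slidingRegion, vel, Side.sgn, Side.opp, mul_comm]

lemma mem_crossingRegion (s : Side) {z : Fin 2 → ℝ} :
    z ∈ S.crossingRegion ↔ z ∈ switchingLine ∧ S.vel s z * S.vel s.opp z < 0 := by
  cases s <;> simp [crossingRegion, vel, Side.sgn, Side.opp, mul_comm]

lemma isClosed_slidingRegion (S : PWLSystem) : IsClosed S.slidingRegion := by
  have : S.slidingRegion =
      switchingLine ∩ {z | 0 ≤ S.vel .right z * S.vel Side.right.opp z} := by
    ext z; exact mem_slidingRegion .right
  rw [this]
  exact isClosed_switchingLine.inter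
    (isClosed_le continuous_const ((S.continuous_vel _).mul (S.continuous_vel _)))

lemma mem_slidingInterior_of_neg {z : Fin 2 → ℝ} (hz : z ∈ switchingLine)
    (h1 : S.vel s z < 0) (h2 : S.vel s.opp z < 0) : z ∈ S.slidingInterior := by
  refine ⟨hz, ?_⟩
  have e1 : ∀ᶠ w in 𝓝 z, S.vel s w < 0 := (S.continuous_vel s).continuousAt.eventually_lt_const h1
  have e2 : ∀ᶠ w in 𝓝 z, S.vel s.opp w < 0 :=
    (S.continuous_vel s.opp).continuousAt.eventually_lt_const h2
  filter_upwards [self_mem_nhdsWithin, e1.filter_mono nhdsWithin_le_nhds,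
    e2.filter_mono nhdsWithin_le_nhds] with w hw h1 h2
  exact (mem_slidingRegion s).2 ⟨hw, (mul_pos_of_neg_of_neg h1 h2).le⟩

/-- At the time `t` the curve `γ` follows one of the two affine fields in its half plane, or the
sliding field in the sliding region. -/
def Regular (S : PWLSystem) (γ : ℝ → Fin 2 → ℝ) (t : ℝ) : Prop :=
  (∃ s : Side, γ t ∈ s.region ∧ HasDerivAt γ (S.field s (γ t)) t) ∨
    ((∀ᶠ u in 𝓝 t, γ u ∈ S.slidingRegion) ∧ HasDerivAt γ (S.slidingField (γ t)) t)

lemma Regular.congr {γ δ : ℝ → Fin 2 → ℝ} {t : ℝ} (h : S.Regular γ t) (he : γ =ᶠ[𝓝 t] δ) :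
    S.Regular δ t := by
  have ht := he.eq_of_nhds
  rcases h with ⟨s, h1, h2⟩ | ⟨h1, h2⟩
  · exact Or.inl ⟨s, ht ▸ h1, ht ▸ h2.congr_of_eventuallyEq he.symm⟩
  · refine Or.inr ⟨?_, ht ▸ h2.congr_of_eventuallyEq he.symm⟩
    filter_upwards [h1, he] with u h1 h2
    exact h2 ▸ h1

lemma Regular.comp_sub {γ : ℝ → Fin 2 → ℝ} {t c : ℝ} (h : S.Regular γ (t - c)) :
    S.Regular (fun u => γ (u - c)) t := by
  rcases h with ⟨s, h1, h2⟩ | ⟨h1, h2⟩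
  · exact Or.inl ⟨s, h1, h2.comp_sub_const t c⟩
  · refine Or.inr ⟨?_, h2.comp_sub_const t c⟩
    have : Tendsto (fun u : ℝ => u - c) (𝓝 t) (𝓝 (t - c)) :=
      (continuous_id.sub continuous_const).continuousAt
    exact this.eventually h1

lemma isSolutionOn_iff {γ : ℝ → Fin 2 → ℝ} {I : Set ℝ} :
    S.IsSolutionOn γ I ↔ ContinuousOn γ I ∧
      (∃ D : Set ℝ, (∀ a b, (D ∩ Icc a b).Finite) ∧ ∀ t ∈ interior I, t ∉ D → S.Regular γ t) ∧
      ∀ t ∈ I, γ t ∈ S.slidingInterior → ∀ᶠ u in 𝓝[>] t, γ u ∈ switchingLine := Iff.rfl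

/-- The curve `c` follows the field of side `s` through the half plane `s` on the open interval
`(a, b)`. -/
def IsArc (S : PWLSystem) (s : Side) (c : ℝ → Fin 2 → ℝ) (a b : ℝ) : Prop :=
  a < b ∧ ContinuousOn c (Icc a b) ∧
    ∀ t ∈ Ioo a b, c t ∈ s.region ∧ HasDerivAt c (S.field s (c t)) t

lemma IsArc.reverse {c : ℝ → Fin 2 → ℝ} {a b : ℝ} (h : S.IsArc s c a b) :
    S.reverse.IsArc s (fun t => c (-t)) (-b) (-a) := by
  refine ⟨by linarith [h.1], ?_, ?_⟩
  · refine h.2.1.comp continuous_neg.continuousOn ?_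
    intro t ht
    exact ⟨by linarith [ht.2], by linarith [ht.1]⟩
  · intro t ht
    have ht' : -t ∈ Ioo a b := ⟨by linarith [ht.2], by linarith [ht.1]⟩
    obtain ⟨h1, h2⟩ := h.2.2 (-t) ht'
    refine ⟨h1, ?_⟩
    rw [reverse_field]
    have := HasDerivAt.scomp t h2 (hasDerivAt_neg t)
    rw [neg_smul, one_smul] at this
    exact this

/-- The equation holds only inside the half plane, but the derivative has a limit at the endpoint,
so the one-sided derivative exists there as well. This is what makes uniqueness for the flow
applicable from a point of the switching line. -/
lemma IsArc.hasDerivWithinAt_Ici {c : ℝ → Fin 2 → ℝ} {a b : ℝ} (h : S.IsArc s c a b) :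
    HasDerivWithinAt c (S.field s (c a)) (Ici a) a := by
  refine hasDerivWithinAt_Ici_of_tendsto_deriv (s := Ioo a b) ?_ ?_ (Ioo_mem_nhdsGT h.1) ?_
  · exact fun t ht => (h.2.2 t ht).2.differentiableAt.differentiableWithinAt
  · exact (h.2.1 a (left_mem_Icc.2 h.1.le)).mono Ioo_subset_Icc_self
  · have h1 : Tendsto (fun t => S.field s (c t)) (𝓝[>] a) (𝓝 (S.field s (c a))) := by
      rw [← nhdsWithin_Ioo_eq_nhdsGT h.1]
      exact ((S.continuous_field s).continuousAt.comp_continuousWithinAt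
        ((h.2.1 a (left_mem_Icc.2 h.1.le)).mono Ioo_subset_Icc_self)).tendsto
    refine h1.congr' ?_
    filter_upwards [Ioo_mem_nhdsGT h.1] with t ht
    exact (h.2.2 t ht).2.deriv.symm

lemma IsArc.vel_start_nonneg {c : ℝ → Fin 2 → ℝ} {a b : ℝ} (h : S.IsArc s c a b)
    (ha : c a ∈ switchingLine) : 0 ≤ S.vel s (c a) := by
  have h1 := (hasDerivWithinAt_pi.1 h.hasDerivWithinAt_Ici 0).const_mul s.sgn
  have h2 := h1.mono Ioi_subset_Ici_self
  rw [hasDerivWithinAt_iff_tendsto_slope' (by simp)] at h2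
  refine ge_of_tendsto h2 ?_
  filter_upwards [Ioo_mem_nhdsGT h.1] with t ht
  have h3 := Side.mem_region.1 (h.2.2 t ht).1
  rw [slope_def_field, mem_switchingLine.1 ha]
  have : 0 < t - a := by linarith [ht.1]
  simp only [mul_zero, sub_zero]
  positivity

lemma IsArc.vel_end_nonpos {c : ℝ → Fin 2 → ℝ} {a b : ℝ} (h : S.IsArc s c a b)
    (hb : c b ∈ switchingLine) : S.vel s (c b) ≤ 0 := by
  have := h.reverse.vel_start_nonneg (by simpa using hb)
  simp [reverse_vel] at this
  exact this

/-- A global integral curve of the field of side `s`. -/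
def IsFlow (S : PWLSystem) (s : Side) (φ : ℝ → Fin 2 → ℝ) : Prop :=
  ∀ t, HasDerivAt φ (S.field s (φ t)) t

lemma exists_lipschitz_field (S : PWLSystem) (s : Side) : ∃ K, LipschitzWith K (S.field s) := by
  let L : (Fin 2 → ℝ) →L[ℝ] (Fin 2 → ℝ) := LinearMap.toContinuousLinearMap (Matrix.mulVecLin (S.A s))
  refine ⟨‖L‖₊, LipschitzWith.of_dist_le_mul fun x y => ?_⟩
  have := L.lipschitz.dist_le_mul x y
  simp only [field, dist_add_right]
  exact this

/-- An affine field is globally Lipschitz on the plane, so an arc is a piece of the integral curve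
of that field, which itself goes on across the line. -/
lemma IsArc.eq_flow {c φ : ℝ → Fin 2 → ℝ} {a b : ℝ} (h : S.IsArc s c a b) (hφ : S.IsFlow s φ)
    (h0 : c a = φ 0) : ∀ t ∈ Icc a b, c t = φ (t - a) := by
  obtain ⟨K, hK⟩ := S.exists_lipschitz_field s
  have hφd : ∀ t, HasDerivAt (fun t => φ (t - a)) (S.field s (φ (t - a))) t :=
    fun t => (hφ (t - a)).comp_sub_const t a
  refine ODE_solution_unique (v := fun _ => S.field s) (fun _ => hK) h.2.1 ?_ ?_ ?_ (by simpa using h0)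
  · intro t ht
    rcases ht.1.eq_or_lt with e | e
    · subst e; exact h.hasDerivWithinAt_Ici
    · exact (h.2.2 t ⟨e, ht.2⟩).2.hasDerivWithinAt
  · exact fun t _ => (hφd t).continuousAt.continuousWithinAt
  · exact fun t _ => (hφd t).hasDerivWithinAt

lemma IsFlow.unique {φ ψ : ℝ → Fin 2 → ℝ} (hφ : S.IsFlow s φ) (hψ : S.IsFlow s ψ) {t₀ t₁ : ℝ}
    (h : φ t₀ = ψ t₁) (t : ℝ) : φ (t₀ + t) = ψ (t₁ + t) := by
  obtain ⟨K, hK⟩ := S.exists_lipschitz_field s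
  have key := ODE_solution_unique_univ (v := fun _ => S.field s) (s := fun _ => univ) (K := K)
    (f := fun t => φ (t₀ + t)) (g := fun t => ψ (t₁ + t)) (t₀ := 0)
    (fun _ => hK.lipschitzOnWith)
    (fun t => ⟨(hφ (t₀ + t)).comp_const_add t₀ t, trivial⟩)
    (fun t => ⟨(hψ (t₁ + t)).comp_const_add t₁ t, trivial⟩) (by simpa using h)
  exact congrFun key t

end PWLSystem


/-! ### The scalar second-order equation and visible unstable foci -/

namespace PWLSystem

variable {S : PWLSystem} {s : Side}

/-- The trace of the matrix of side `s`. -/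
def tr (S : PWLSystem) (s : Side) : ℝ := S.A s 0 0 + S.A s 1 1

/-- The determinant of the matrix of side `s`. -/
def dt (S : PWLSystem) (s : Side) : ℝ := S.A s 0 0 * S.A s 1 1 - S.A s 0 1 * S.A s 1 0

/-- The constant term of the second-order equation of the distance to the switching line. -/
def kap (S : PWLSystem) (s : Side) : ℝ := s.sgn * (S.A s 0 1 * S.b s 1 - S.A s 1 1 * S.b s 0)

lemma vel_field_comp (S : PWLSystem) (s : Side) (z : Fin 2 → ℝ) :
    s.sgn * (S.A s 0 0 * S.field s z 0 + S.A s 0 1 * S.field s z 1) =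
      S.tr s * S.vel s z - S.dt s * (s.sgn * z 0) + S.kap s := by
  simp only [vel, field_zero, field_one, tr, dt, kap]
  ring

lemma vel_eq (S : PWLSystem) (s : Side) (z : Fin 2 → ℝ) :
    S.vel s z = s.sgn * (S.A s 0 0 * z 0 + S.A s 0 1 * z 1 + S.b s 0) := by
  rw [vel, field_zero]

lemma hasDerivAt_nrm {c : ℝ → Fin 2 → ℝ} {t : ℝ} (h : HasDerivAt c (S.field s (c t)) t) :
    HasDerivAt (fun t => s.sgn * c t 0) (S.vel s (c t)) t :=
  (hasDerivAt_pi.1 h 0).const_mul s.sgn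

/-- This is the Cayley–Hamilton identity for the matrix of the side, read off in the first
coordinate; only trace, determinant and one constant survive. -/
lemma hasDerivAt_vel {c : ℝ → Fin 2 → ℝ} {t : ℝ} (h : HasDerivAt c (S.field s (c t)) t) :
    HasDerivAt (fun t => S.vel s (c t))
      (S.tr s * S.vel s (c t) - S.dt s * (s.sgn * c t 0) + S.kap s) t := by
  simp only [vel_eq S s (c _)]
  have h0 := (hasDerivAt_pi.1 h 0).const_mul (S.A s 0 0)
  have h1 := (hasDerivAt_pi.1 h 1).const_mul (S.A s 0 1)
  refine (((h0.add h1).add_const (S.b s 0)).const_mul s.sgn).congr_deriv ?_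
  rw [vel_field_comp, vel_eq]

/-- If `A 0 1 ≠ 0`, distance and normal velocity are affine coordinates of the plane, so orbits may
be compared through the scalar equation. -/
lemma eq_of_vel_eq (hA : S.A s 0 1 ≠ 0) {z w : Fin 2 → ℝ} (h0 : z 0 = w 0)
    (h1 : S.vel s z = S.vel s w) : z = w := by
  rw [vel_eq, vel_eq, h0] at h1
  have h2 := mul_left_cancel₀ s.sgn_ne_zero h1
  have h3 : S.A s 0 1 * z 1 = S.A s 0 1 * w 1 := by linarith
  have h4 := mul_left_cancel₀ hA h3
  funext i
  fin_cases i
  · exact h0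
  · exact h4

/-- The curve in the plane with distance `n` to the switching line and normal velocity `N`. -/
noncomputable def lift (S : PWLSystem) (s : Side) (n N : ℝ → ℝ) (t : ℝ) : Fin 2 → ℝ :=
  ![s.sgn * n t, (s.sgn * N t - S.A s 0 0 * (s.sgn * n t) - S.b s 0) / S.A s 0 1]

lemma sgn_mul_lift (n N : ℝ → ℝ) (t : ℝ) : s.sgn * S.lift s n N t 0 = n t := by
  simp [lift, ← mul_assoc]

lemma vel_lift (hA : S.A s 0 1 ≠ 0) (n N : ℝ → ℝ) (t : ℝ) : S.vel s (S.lift s n N t) = N t := by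
  rw [vel_eq]
  simp only [lift, Matrix.cons_val_zero, Matrix.cons_val_one]
  rw [mul_div_cancel₀ _ hA]
  have := s.sgn_mul_self
  linear_combination (N t) * this

lemma isFlow_lift (hA : S.A s 0 1 ≠ 0) {n N : ℝ → ℝ} (hn : ∀ t, HasDerivAt n (N t) t)
    (hN : ∀ t, HasDerivAt N (S.tr s * N t - S.dt s * n t + S.kap s) t) :
    S.IsFlow s (S.lift s n N) := by
  intro t
  have hs := s.sgn_mul_self
  rw [hasDerivAt_pi]
  intro i
  have h0 := (hn t).const_mul s.sgn
  fin_cases i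
  · have hv : S.field s (S.lift s n N t) 0 = s.sgn * N t := by
      have := S.vel_lift (s := s) hA n N t
      rw [vel] at this
      linear_combination s.sgn * this - S.field s (S.lift s n N t) 0 * hs
    change HasDerivAt (fun t => s.sgn * n t) (S.field s (S.lift s n N t) 0) t
    rw [hv]
    exact h0
  · have h1 := ((((hN t).const_mul s.sgn).sub (h0.const_mul (S.A s 0 0))).sub_const
      (S.b s 0)).div_const (S.A s 0 1)
    refine h1.congr_deriv ?_
    change _ = S.field s (S.lift s n N t) 1
    rw [field_one]
    simp only [lift, Matrix.cons_val_zero, Matrix.cons_val_one, tr, dt, kap]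
    field_simp
    linear_combination (S.A s 0 1 * S.b s 1 - S.A s 1 1 * S.b s 0) * hs

/-- The side `s` has an unstable focus in its open half plane. -/
def VisibleUnstable (S : PWLSystem) (s : Side) : Prop :=
  0 < S.tr s ∧ S.tr s ^ 2 < 4 * S.dt s ∧ 0 < S.kap s

/-- A triangular matrix has real eigenvalues. -/
lemma A_ne_zero_of_disc (h : S.tr s ^ 2 < 4 * S.dt s) : S.A s 0 1 ≠ 0 := by
  intro h0
  simp only [tr, dt, h0] at h
  nlinarith [sq_nonneg (S.A s 0 0 - S.A s 1 1)]

/-- The angular frequency of the focus. -/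
noncomputable def om (S : PWLSystem) (s : Side) : ℝ := √(S.dt s - (S.tr s / 2) ^ 2)

/-- The ratio of the real and imaginary parts of the eigenvalues. -/
noncomputable def gam (S : PWLSystem) (s : Side) : ℝ := S.tr s / 2 / S.om s

/-- The distance of the equilibrium to the switching line. -/
noncomputable def nst (S : PWLSystem) (s : Side) : ℝ := S.kap s / S.dt s

lemma om_pos (h : S.tr s ^ 2 < 4 * S.dt s) : 0 < S.om s := Real.sqrt_pos.2 (by nlinarith)

lemma om_sq (h : S.tr s ^ 2 < 4 * S.dt s) : S.om s ^ 2 = S.dt s - (S.tr s / 2) ^ 2 :=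
  Real.sq_sqrt (by nlinarith)

lemma dt_pos (h : S.tr s ^ 2 < 4 * S.dt s) : 0 < S.dt s := by nlinarith [sq_nonneg (S.tr s)]

/-- The orbit of a focus that starts on the switching line with normalized speed `ξ`. -/
noncomputable def focusFlow (S : PWLSystem) (s : Side) (ξ : ℝ) : ℝ → Fin 2 → ℝ :=
  S.lift s (fun t => S.nst s * focusOrbit (S.gam s) ξ (S.om s * t))
    (fun t => S.nst s * S.om s * focusSpeed (S.gam s) ξ (S.om s * t))

lemma isFlow_focusFlow (h : S.tr s ^ 2 < 4 * S.dt s) (ξ : ℝ) : S.IsFlow s (S.focusFlow s ξ) := by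
  have ho := om_pos h
  have hsq := om_sq h
  have hd := dt_pos h
  have hid : ∀ t, HasDerivAt (fun t => S.om s * t) (S.om s) t := fun t => by
    simpa using (hasDerivAt_id t).const_mul (S.om s)
  refine isFlow_lift (A_ne_zero_of_disc h) (fun t => ?_) fun t => ?_
  · refine (((hasDerivAt_focusOrbit (S.gam s) ξ _).comp t (hid t)).const_mul
      (S.nst s)).congr_deriv ?_
    ring
  · refine (((hasDerivAt_focusSpeed (S.gam s) ξ _).comp t (hid t)).const_mul
      (S.nst s * S.om s)).congr_deriv ?_
    have hg : S.gam s * S.om s = S.tr s / 2 := by rw [gam, div_mul_cancel₀ _ ho.ne']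
    have hn : S.nst s * S.dt s = S.kap s := by rw [nst, div_mul_cancel₀ _ hd.ne']
    set F := focusSpeed (S.gam s) ξ (S.om s * t)
    set X := focusOrbit (S.gam s) ξ (S.om s * t)
    have e : S.dt s = S.om s ^ 2 + (S.gam s * S.om s) ^ 2 := by rw [hg, hsq]; ring
    have e2 : S.tr s = 2 * (S.gam s * S.om s) := by rw [hg]; ring
    rw [← hn, e, e2]
    ring

lemma focusFlow_zero (ξ : ℝ) : S.focusFlow s ξ 0 0 = 0 := by
  simp [focusFlow, lift, focusOrbit_zero]

lemma vel_focusFlow_zero (h : S.tr s ^ 2 < 4 * S.dt s) (ξ : ℝ) :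
    S.vel s (S.focusFlow s ξ 0) = S.nst s * S.om s * ξ := by
  rw [focusFlow, vel_lift (A_ne_zero_of_disc h)]
  simp [focusSpeed_zero]

/-- For real eigenvalues `l`, `μ` the equation factors: `w = n' - l n` satisfies `w' = μ w + kap`,
with `w = 0` at the tangency. The sign of `kap` therefore makes `exp (-μt) w`, and then `exp (-lt)
n`, monotone from zero. Either `n` cannot come back to zero or it never becomes positive. -/
lemma lt_of_real_eigenvalues {c : ℝ → Fin 2 → ℝ} {a b : ℝ} (hc : S.IsArc s c a b)
    (ha : c a ∈ switchingLine) (hva : S.vel s (c a) = 0) (hb : c b ∈ switchingLine) :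
    S.tr s ^ 2 < 4 * S.dt s := by
  by_contra hcon
  push Not at hcon
  set q := √(S.tr s ^ 2 - 4 * S.dt s) with hq
  have hq2 : q ^ 2 = S.tr s ^ 2 - 4 * S.dt s := Real.sq_sqrt (by linarith)
  set l := (S.tr s + q) / 2 with hl
  set μ := (S.tr s - q) / 2 with hμ
  have h1 : S.tr s = l + μ := by rw [hl, hμ]; ring
  have h2 : S.dt s = l * μ := by rw [hl, hμ]; nlinarith
  set n : ℝ → ℝ := fun t => s.sgn * c t 0 with hn
  set w : ℝ → ℝ := fun t => S.vel s (c t) - l * n t with hw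
  have hnc : ContinuousOn n (Icc a b) :=
    continuousOn_const.mul ((continuous_apply 0).comp_continuousOn hc.2.1)
  have hwc : ContinuousOn w (Icc a b) :=
    ((S.continuous_vel s).comp_continuousOn hc.2.1).sub (continuousOn_const.mul hnc)
  have hexp : ∀ r : ℝ, Continuous (fun t : ℝ => Real.exp (-r * t)) := fun r => by fun_prop
  have hG : ∀ t ∈ Ioo a b, HasDerivAt (fun t => Real.exp (-μ * t) * w t)
      (Real.exp (-μ * t) * S.kap s) t := by
    intro t ht
    have hd := (hc.2.2 t ht).2
    refine ((hasDerivAt_exp_mul (-μ) t).mul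
      ((hasDerivAt_vel hd).sub ((hasDerivAt_nrm hd).const_mul l))).congr_deriv ?_
    simp only [h1, h2, Pi.sub_apply]
    ring
  have hH : ∀ t ∈ Ioo a b, HasDerivAt (fun t => Real.exp (-l * t) * n t)
      (Real.exp (-l * t) * w t) t := by
    intro t ht
    have hd := (hc.2.2 t ht).2
    refine ((hasDerivAt_exp_mul (-l) t).mul (hasDerivAt_nrm hd)).congr_deriv ?_
    simp only [hw, hn]
    ring
  have hna : n a = 0 := by simp [hn, mem_switchingLine.1 ha]
  have hnb : n b = 0 := by simp [hn, mem_switchingLine.1 hb]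
  have hwa : w a = 0 := by simp [hw, hna, hva]
  have hab := hc.1
  have hGc : ContinuousOn (fun t => Real.exp (-μ * t) * w t) (Icc a b) :=
    (hexp μ).continuousOn.mul hwc
  have hHc : ContinuousOn (fun t => Real.exp (-l * t) * n t) (Icc a b) :=
    (hexp l).continuousOn.mul hnc
  have hmem : a ∈ Icc a b := left_mem_Icc.2 hab.le
  rcases lt_or_ge 0 (S.kap s) with hk | hk
  · have m1 : StrictMonoOn (fun t => Real.exp (-μ * t) * w t) (Icc a b) := by
      refine strictMonoOn_of_deriv_pos (convex_Icc _ _) hGc ?_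
      intro t ht
      rw [interior_Icc] at ht
      rw [(hG t ht).deriv]
      positivity
    have hwpos : ∀ t ∈ Ioo a b, 0 < w t := by
      intro t ht
      have := m1 hmem (Ioo_subset_Icc_self ht) ht.1
      simp only [hwa, mul_zero] at this
      exact (mul_pos_iff_of_pos_left (Real.exp_pos _)).1 this
    have m2 : StrictMonoOn (fun t => Real.exp (-l * t) * n t) (Icc a b) := by
      refine strictMonoOn_of_deriv_pos (convex_Icc _ _) hHc ?_
      intro t ht
      rw [interior_Icc] at ht
      rw [(hH t ht).deriv]
      have := hwpos t ht
      positivity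
    have := m2 hmem (right_mem_Icc.2 hab.le) hab
    simp [hna, hnb] at this
  · have m1 : AntitoneOn (fun t => Real.exp (-μ * t) * w t) (Icc a b) := by
      refine antitoneOn_of_deriv_nonpos (convex_Icc _ _) hGc ?_ ?_
      · intro t ht
        rw [interior_Icc] at ht
        exact (hG t ht).differentiableAt.differentiableWithinAt
      · intro t ht
        rw [interior_Icc] at ht
        rw [(hG t ht).deriv]
        exact mul_nonpos_of_nonneg_of_nonpos (Real.exp_pos _).le hk
    have hwneg : ∀ t ∈ Ioo a b, w t ≤ 0 := by
      intro t ht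
      have := m1 hmem (Ioo_subset_Icc_self ht) ht.1.le
      simp only [hwa, mul_zero] at this
      by_contra hc'
      push Not at hc'
      have : 0 < Real.exp (-μ * t) * w t := by positivity
      linarith
    have m2 : AntitoneOn (fun t => Real.exp (-l * t) * n t) (Icc a b) := by
      refine antitoneOn_of_deriv_nonpos (convex_Icc _ _) hHc ?_ ?_
      · intro t ht
        rw [interior_Icc] at ht
        exact (hH t ht).differentiableAt.differentiableWithinAt
      · intro t ht
        rw [interior_Icc] at ht
        rw [(hH t ht).deriv]
        exact mul_nonpos_of_nonneg_of_nonpos (Real.exp_pos _).le (hwneg t ht)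
    have hm : (a + b) / 2 ∈ Ioo a b := ⟨by linarith, by linarith⟩
    have h3 := m2 hmem (Ioo_subset_Icc_self hm) hm.1.le
    have h4 := Side.mem_region.1 (hc.2.2 _ hm).1
    simp only [hna, mul_zero] at h3
    have : 0 < Real.exp (-l * ((a + b) / 2)) * n ((a + b) / 2) := by positivity
    linarith

/-- An orbit that leaves the switching line at a tangency and comes back transversally turns
around an unstable focus. -/
lemma IsArc.visibleUnstable {c : ℝ → Fin 2 → ℝ} {a b : ℝ} (hc : S.IsArc s c a b)
    (ha : c a ∈ switchingLine) (hva : S.vel s (c a) = 0) (hb : c b ∈ switchingLine)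
    (hvb : S.vel s (c b) < 0) : S.VisibleUnstable s := by
  have hdisc := lt_of_real_eigenvalues hc ha hva hb
  have hA := A_ne_zero_of_disc hdisc
  have ho := om_pos hdisc
  have hd := dt_pos hdisc
  have h0 : c a = S.focusFlow s 0 0 := by
    refine eq_of_vel_eq hA ?_ ?_
    · rw [focusFlow_zero]; exact ha
    · rw [hva, vel_focusFlow_zero hdisc, mul_zero]
  have hflow := hc.eq_flow (isFlow_focusFlow hdisc 0) h0
  have hab := hc.1
  have hnst : 0 < S.nst s := by
    -- A time inside the arc and within the first half turn, where the normalized orbit is known to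
    -- be positive; the sign of `nst` is then that of the distance.
    set δ := min ((b - a) / 2) (Real.pi / S.om s) with hδ
    have hδ0 : 0 < δ := lt_min (by linarith) (by positivity)
    have hδ1 : δ ≤ (b - a) / 2 := min_le_left _ _
    have hδ2 : S.om s * δ ≤ Real.pi := by
      have : δ ≤ Real.pi / S.om s := min_le_right _ _
      rwa [le_div_iff₀' ho] at this
    have ht : a + δ ∈ Ioo a b := ⟨by linarith, by linarith⟩
    have h1 := Side.mem_region.1 (hc.2.2 _ ht).1
    rw [hflow _ (Ioo_subset_Icc_self ht), focusFlow, sgn_mul_lift] at h1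
    have h2 := focusOrbit_pos_of_le_pi (S.gam s) (le_refl 0) (by positivity) hδ2
    simp only [add_sub_cancel_left] at h1
    exact (mul_pos_iff_of_pos_right h2).1 h1
  have hkap : 0 < S.kap s := by
    rw [nst] at hnst
    exact (div_pos_iff_of_pos_right hd).1 hnst
  refine ⟨?_, hdisc, hkap⟩
  have hbI : b ∈ Icc a b := right_mem_Icc.2 hab.le
  set θ := S.om s * (b - a) with hθ
  have hθ0 : 0 < θ := mul_pos ho (by linarith)
  have hX : focusOrbit (S.gam s) 0 θ = 0 := by
    have h1 : s.sgn * c b 0 = 0 := by simp [mem_switchingLine.1 hb]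
    rw [hflow b hbI, focusFlow, sgn_mul_lift] at h1
    exact (mul_eq_zero.1 h1).resolve_left hnst.ne'
  have hF : focusSpeed (S.gam s) 0 θ < 0 := by
    rw [hflow b hbI, focusFlow, vel_lift hA] at hvb
    exact lt_of_not_ge fun h => absurd hvb (not_lt.2 (mul_nonneg (by positivity) h))
  -- Nonpositive trace means that the exponential factor is at most one. At a transversal return
  -- `sin θ < 0`, so the return equation `E (cos θ - g sin θ) = 1` has both factors too small.
  by_contra htr
  push Not at htr
  have hg : S.gam s ≤ 0 := by
    rw [gam]; exact div_nonpos_of_nonpos_of_nonneg (by linarith) ho.le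
  simp only [focusSpeed, focusOrbit, zero_mul, zero_add, mul_zero, add_zero] at hF hX
  have hE : 0 < Real.exp (S.gam s * θ) := Real.exp_pos _
  have hE1 : Real.exp (S.gam s * θ) ≤ 1 :=
    Real.exp_le_one_iff.2 (mul_nonpos_of_nonpos_of_nonneg hg hθ0.le)
  have hsin : Real.sin θ < 0 := by
    refine lt_of_not_ge fun h => absurd hF (not_lt.2 ?_)
    positivity
  have hcos : Real.cos θ < 1 := by
    rcases (Real.cos_le_one θ).lt_or_eq with h | h
    · exact h
    · have := Real.sin_sq_add_cos_sq θ
      rw [h] at this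
      nlinarith
  have hlt : Real.cos θ - S.gam s * Real.sin θ < 1 := by nlinarith
  have heq : Real.exp (S.gam s * θ) * (Real.cos θ - S.gam s * Real.sin θ) = 1 := by linarith
  nlinarith

end PWLSystem


/-! ### Coordinates on the switching line and half return maps -/

/-- The point of the switching line with coordinate `u` as seen from side `s`. -/
def Side.pt (s : Side) (ε u : ℝ) : Fin 2 → ℝ := ![0, s.sgn * ε * u]

/-- The coordinate of a point of the switching line as seen from side `s`; the two sides see
opposite coordinates. -/
def Side.crd (s : Side) (ε : ℝ) (z : Fin 2 → ℝ) : ℝ := s.sgn * ε * z 1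

lemma Side.pt_mem (s : Side) (ε u : ℝ) : s.pt ε u ∈ switchingLine := by
  simp [Side.pt, mem_switchingLine]

lemma Side.crd_opp (s : Side) (ε : ℝ) (z : Fin 2 → ℝ) : s.opp.crd ε z = -s.crd ε z := by
  simp [Side.crd]

lemma Side.pt_opp (s : Side) (ε u : ℝ) : s.opp.pt ε u = s.pt ε (-u) := by
  simp [Side.pt]

lemma Side.crd_pt (s : Side) {ε : ℝ} (hε : ε * ε = 1) (u : ℝ) : s.crd ε (s.pt ε u) = u := by
  have := s.sgn_mul_self
  simp only [Side.crd, Side.pt, Matrix.cons_val_one, Matrix.cons_val_zero]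
  linear_combination (ε * ε * u) * this + u * hε

lemma Side.pt_crd (s : Side) {ε : ℝ} (hε : ε * ε = 1) {z : Fin 2 → ℝ} (hz : z ∈ switchingLine) :
    s.pt ε (s.crd ε z) = z := by
  have := s.sgn_mul_self
  funext i
  fin_cases i
  · simpa [Side.pt] using (mem_switchingLine.1 hz).symm
  · simp only [Side.crd, Side.pt, Fin.mk_one, Matrix.cons_val_one, Matrix.cons_val_zero]
    linear_combination (ε * ε * z 1) * this + z 1 * hε

namespace PWLSystem

variable {S : PWLSystem} {s : Side} {ε : ℝ}

/-- The half return map `h` of side `s`: the orbit that enters `s` at the coordinate `u` (beyond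
the tangency `p`) stays in `s` for the time `τ u` and comes back at the point whose coordinate as
seen from the opposite side is `h u`. -/
structure HalfReturn (S : PWLSystem) (s : Side) (ε : ℝ) where
  p : ℝ
  m : ℝ
  m_pos : 0 < m
  vel_eq : ∀ z ∈ switchingLine, S.vel s z = m * (s.crd ε z - p)
  h : ℝ → ℝ
  flow : ℝ → ℝ → Fin 2 → ℝ
  τ : ℝ → ℝ
  dom : Set ℝ
  isFlow : ∀ u, S.IsFlow s (flow u)
  flow_zero : ∀ u, flow u 0 = s.pt ε u
  mem_dom : ∀ u, p < u → u ∈ dom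
  le_of_mem : ∀ u ∈ dom, p ≤ u
  notMem : p ∉ dom → ∀ t, flow p t ∉ s.region
  τ_pos : ∀ u ∈ dom, 0 < τ u
  region : ∀ u ∈ dom, ∀ t ∈ Ioo 0 (τ u), flow u t ∈ s.region
  flow_τ : ∀ u ∈ dom, flow u (τ u) = s.opp.pt ε (h u)
  neg_lt : ∀ u ∈ dom, -p < h u
  mono : StrictMonoOn h (Ici p)

namespace HalfReturn

variable (H : HalfReturn S s ε)

lemma isArc_flow {u : ℝ} (hu : u ∈ H.dom) : S.IsArc s (H.flow u) 0 (H.τ u) :=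
  ⟨H.τ_pos u hu, fun t _ => (H.isFlow u t).continuousAt.continuousWithinAt,
    fun t ht => ⟨H.region u hu t ht, H.isFlow u t⟩⟩

/-- The domain is a closed or an open ray from the tangency. In the open case the tangency is
invisible: its orbit never enters the half plane, so no arc starts there. -/
lemma crd_start_mem (hε : ε * ε = 1) {c : ℝ → Fin 2 → ℝ} {a b : ℝ} (hc : S.IsArc s c a b)
    (ha : c a ∈ switchingLine) : s.crd ε (c a) ∈ H.dom := by
  have h1 := hc.vel_start_nonneg ha
  rw [H.vel_eq _ ha] at h1
  have h2 : H.p ≤ s.crd ε (c a) := by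
    have := nonneg_of_mul_nonneg_right h1 H.m_pos
    linarith
  rcases h2.lt_or_eq with h | h
  · exact H.mem_dom _ h
  · by_contra hcon
    rw [← h] at hcon
    have hm : (a + b) / 2 ∈ Ioo a b := ⟨by linarith [hc.1], by linarith [hc.1]⟩
    refine H.notMem hcon ((a + b) / 2 - a) ?_
    rw [← hc.eq_flow (H.isFlow H.p) ?_ _ (Ioo_subset_Icc_self hm)]
    · exact (hc.2.2 _ hm).1
    · rw [H.flow_zero, h, s.pt_crd hε ha]

lemma arc_eq (hε : ε * ε = 1) {c : ℝ → Fin 2 → ℝ} {a b : ℝ} (hc : S.IsArc s c a b)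
    (ha : c a ∈ switchingLine) :
    ∀ t ∈ Icc a b, c t = H.flow (s.crd ε (c a)) (t - a) :=
  hc.eq_flow (H.isFlow _) (by rw [H.flow_zero, s.pt_crd hε ha])

lemma arc_le (hε : ε * ε = 1) {c : ℝ → Fin 2 → ℝ} {a b : ℝ} (hc : S.IsArc s c a b)
    (ha : c a ∈ switchingLine) : b - a ≤ H.τ (s.crd ε (c a)) := by
  have hmem := H.crd_start_mem hε hc ha
  have hτ := H.τ_pos _ hmem
  by_contra hcon
  push Not at hcon
  have ht : a + H.τ (s.crd ε (c a)) ∈ Ioo a b := ⟨by linarith, by linarith⟩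
  have h1 := (hc.2.2 _ ht).1
  rw [H.arc_eq hε hc ha _ (Ioo_subset_Icc_self ht), add_sub_cancel_left, H.flow_τ _ hmem] at h1
  exact Side.notMem_switchingLine h1 (Side.pt_mem _ _ _)

/-- The flow is inside the half plane before `τ` and on the line at `τ`, so an arc between two
points of the line can be neither longer nor shorter. -/
lemma arc_time (hε : ε * ε = 1) {c : ℝ → Fin 2 → ℝ} {a b : ℝ} (hc : S.IsArc s c a b)
    (ha : c a ∈ switchingLine) (hb : c b ∈ switchingLine) : b - a = H.τ (s.crd ε (c a)) := by
  refine (H.arc_le hε hc ha).antisymm ?_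
  have hmem := H.crd_start_mem hε hc ha
  by_contra hcon
  push Not at hcon
  have h1 := H.region _ hmem (b - a) ⟨by linarith [hc.1], hcon⟩
  rw [← H.arc_eq hε hc ha b (right_mem_Icc.2 hc.1.le)] at h1
  exact Side.notMem_switchingLine h1 hb

lemma arc_end (hε : ε * ε = 1) {c : ℝ → Fin 2 → ℝ} {a b : ℝ} (hc : S.IsArc s c a b)
    (ha : c a ∈ switchingLine) (hb : c b ∈ switchingLine) :
    c b = s.opp.pt ε (H.h (s.crd ε (c a))) := by
  have hmem := H.crd_start_mem hε hc ha
  rw [H.arc_eq hε hc ha b (right_mem_Icc.2 hc.1.le), H.arc_time hε hc ha hb, H.flow_τ _ hmem]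

lemma arc_end_crd (hε : ε * ε = 1) {c : ℝ → Fin 2 → ℝ} {a b : ℝ} (hc : S.IsArc s c a b)
    (ha : c a ∈ switchingLine) (hb : c b ∈ switchingLine) :
    s.opp.crd ε (c b) = H.h (s.crd ε (c a)) := by
  rw [H.arc_end hε hc ha hb, Side.crd_pt _ hε]

lemma arc_image (hε : ε * ε = 1) {c : ℝ → Fin 2 → ℝ} {a b : ℝ} (hc : S.IsArc s c a b)
    (ha : c a ∈ switchingLine) (hb : c b ∈ switchingLine) :
    c '' Icc a b = H.flow (s.crd ε (c a)) '' Icc 0 (H.τ (s.crd ε (c a))) := by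
  have ht := H.arc_time hε hc ha hb
  ext z
  constructor
  · rintro ⟨t, hts, rfl⟩
    exact ⟨t - a, ⟨by linarith [hts.1], by linarith [hts.2]⟩, (H.arc_eq hε hc ha t hts).symm⟩
  · rintro ⟨t, hts, rfl⟩
    have hm : a + t ∈ Icc a b := ⟨by linarith [hts.1], by linarith [hts.2]⟩
    refine ⟨a + t, hm, ?_⟩
    rw [H.arc_eq hε hc ha _ hm, add_sub_cancel_left]

end HalfReturn

lemma gam_pos (h : S.VisibleUnstable s) : 0 < S.gam s := by
  have := om_pos h.2.1
  have := h.1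
  unfold gam
  positivity

lemma nst_pos (h : S.VisibleUnstable s) : 0 < S.nst s := div_pos h.2.2 (dt_pos h.2.1)

/-- The half return map of an unstable focus in the open half plane. -/
noncomputable def focusHalf (h : S.VisibleUnstable s) (hε : ε * ε = 1) (hA : 0 < ε * S.A s 0 1) :
    HalfReturn S s ε :=
  let m := ε * S.A s 0 1
  -- The scale is fixed by comparing the two expressions for the initial normal velocity, `m (u -
  -- p)` and `nst * om * ξ`; hence `ξ = (u - p) / ρ`.
  let ρ := S.nst s * S.om s / m
  let p := -(s.sgn * S.b s 0) / m
  have hρ : 0 < ρ := by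
    have := om_pos h.2.1
    have := nst_pos h
    positivity
  have hvel : ∀ z ∈ switchingLine, S.vel s z = m * (s.crd ε z - p) := by
    intro z hz
    rw [PWLSystem.vel_eq, mem_switchingLine.1 hz, mul_sub, mul_div_cancel₀ _ hA.ne']
    simp only [Side.crd, m]
    linear_combination (-(S.A s 0 1 * s.sgn * z 1)) * hε
  have hret : ∀ u, p ≤ u → ∃ θ, Real.pi < θ ∧ focusOrbit (S.gam s) ((u - p) / ρ) θ = 0 ∧
      (∀ t ∈ Ioo 0 θ, 0 < focusOrbit (S.gam s) ((u - p) / ρ) t) ∧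
      focusSpeed (S.gam s) ((u - p) / ρ) θ = -focusMap (S.gam s) ((u - p) / ρ) := fun u hu =>
    exists_focus_return (gam_pos h) (div_nonneg (by linarith) hρ.le)
  -- The value outside the domain is arbitrary.
  open Classical in
  let θ : ℝ → ℝ := fun u => if hu : p ≤ u then (hret u hu).choose else 1
  have hθ : ∀ u, p ≤ u → Real.pi < θ u ∧ focusOrbit (S.gam s) ((u - p) / ρ) (θ u) = 0 ∧
      (∀ t ∈ Ioo 0 (θ u), 0 < focusOrbit (S.gam s) ((u - p) / ρ) t) ∧
      focusSpeed (S.gam s) ((u - p) / ρ) (θ u) = -focusMap (S.gam s) ((u - p) / ρ) := by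
    intro u hu
    have h1 := (hret u hu).choose_spec
    simp only [θ, dif_pos hu]
    exact h1
  { p := p
    m := m
    m_pos := hA
    vel_eq := hvel
    h := fun u => -p + ρ * focusMap (S.gam s) ((u - p) / ρ)
    flow := fun u => S.focusFlow s ((u - p) / ρ)
    τ := fun u => θ u / S.om s
    dom := Ici p
    isFlow := fun u => isFlow_focusFlow h.2.1 _
    flow_zero := by
      intro u
      refine eq_of_vel_eq (A_ne_zero_of_disc h.2.1) ?_ ?_
      · rw [focusFlow_zero]; exact (mem_switchingLine.1 (s.pt_mem ε u)).symm
      · rw [vel_focusFlow_zero h.2.1, hvel _ (s.pt_mem ε u), s.crd_pt hε]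
        have : ρ * m = S.nst s * S.om s := div_mul_cancel₀ _ hA.ne'
        rw [← this]
        field_simp
    mem_dom := fun u hu => le_of_lt hu
    le_of_mem := fun u hu => hu
    notMem := fun hp => absurd self_mem_Ici hp
    τ_pos := fun u hu => div_pos (Real.pi_pos.trans (hθ u hu).1) (om_pos h.2.1)
    region := by
      intro u hu t ht
      have ho := om_pos h.2.1
      have hn := nst_pos h
      rw [Side.mem_region, focusFlow, sgn_mul_lift]
      refine mul_pos hn ((hθ u hu).2.2.1 _ ⟨mul_pos ho ht.1, ?_⟩)
      have := ht.2
      rwa [lt_div_iff₀' ho] at this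
    flow_τ := by
      intro u hu
      have ho := om_pos h.2.1
      have e : S.om s * (θ u / S.om s) = θ u := by field_simp
      refine eq_of_vel_eq (A_ne_zero_of_disc h.2.1) ?_ ?_
      · rw [mem_switchingLine.1 (s.opp.pt_mem ε _)]
        simp [focusFlow, lift, e, (hθ u hu).2.1]
      · rw [hvel _ (s.opp.pt_mem ε _), focusFlow, vel_lift (A_ne_zero_of_disc h.2.1), e,
          (hθ u hu).2.2.2, Side.pt_opp, s.crd_pt hε]
        have : ρ * m = S.nst s * S.om s := div_mul_cancel₀ _ hA.ne'
        rw [← this]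
        ring
    neg_lt := by
      intro u hu
      have := mul_pos hρ (focusMap_pos (gam_pos h) ((u - p) / ρ))
      linarith
    mono := by
      intro u hu v hv huv
      have h1 : (u - p) / ρ < (v - p) / ρ := by
        apply div_lt_div_of_pos_right _ hρ
        linarith
      have h2 := strictMonoOn_focusMap (S.gam s) (a := (u - p) / ρ) (b := (v - p) / ρ)
        (div_nonneg (by linarith [mem_Ici.1 hu]) hρ.le) (div_nonneg (by linarith [mem_Ici.1 hv]) hρ.le) h1
      have := mul_lt_mul_of_pos_left h2 hρ
      change -p + _ < -p + _
      linarith }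

end PWLSystem


/-! ### Locally finite break points and successive times on the switching line -/

lemma exists_punctured_notMem {D : Set ℝ} (hD : ∀ a b, (D ∩ Icc a b).Finite) (a : ℝ) :
    ∃ δ > 0, ∀ t, t ≠ a → |t - a| < δ → t ∉ D := by
  have hfin : ((D ∩ Icc (a - 1) (a + 1)) \ {a}).Finite := (hD _ _).subset sdiff_subset
  have hmem : ((D ∩ Icc (a - 1) (a + 1)) \ {a})ᶜ ∈ 𝓝 a :=
    hfin.isClosed.isOpen_compl.mem_nhds (by simp)
  obtain ⟨δ, hδ, h⟩ := Metric.mem_nhds_iff.1 hmem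
  refine ⟨min δ 1, lt_min hδ one_pos, fun t hta ht htD => ?_⟩
  have h1 := h (show t ∈ Metric.ball a δ from by
    rw [Metric.mem_ball, Real.dist_eq]; exact ht.trans_le (min_le_left _ _))
  have h2 := abs_lt.1 (ht.trans_le (min_le_right _ _))
  exact h1 ⟨⟨htD, by linarith, by linarith⟩, hta⟩

lemma exists_Ioo_notMem {D : Set ℝ} (hD : ∀ a b, (D ∩ Icc a b).Finite) (a : ℝ) :
    ∃ δ > 0, ∀ t ∈ Ioo a (a + δ), t ∉ D := by
  obtain ⟨δ, hδ, h⟩ := exists_punctured_notMem hD a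
  refine ⟨δ, hδ, fun t ht => h t ht.1.ne' ?_⟩
  rw [abs_lt]
  exact ⟨by linarith [ht.1], by linarith [ht.2]⟩

/-- Induction along the times of a closed set whose good points are isolated. -/
lemma time_induction {K D : Set ℝ} {good : ℝ → Prop} {t₀ : ℝ} (hK : IsClosed (K ∩ Ici t₀))
    (hD : ∀ a b, (D ∩ Icc a b).Finite) (h0 : t₀ ∈ K) (hg0 : good t₀)
    (hiso : ∀ t ∈ K, t₀ ≤ t → good t → ∀ᶠ u in 𝓝 t, u ∈ K → u ∈ D)
    (hstep : ∀ t ∈ K, ∀ t' ∈ K, t₀ ≤ t → t < t' → good t → (∀ u ∈ Ioo t t', u ∉ K) → good t') :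
    ∀ t ∈ K, t₀ ≤ t → good t := by
  by_contra hcon
  push Not at hcon
  obtain ⟨b, hbK, hb0, hbad⟩ := hcon
  set B := {t | t ∈ K ∧ t₀ ≤ t ∧ ¬ good t} with hB
  have hBne : B.Nonempty := ⟨b, hbK, hb0, hbad⟩
  have hBbd : BddBelow B := ⟨t₀, fun t ht => ht.2.1⟩
  set t' := sInf B with ht'
  have hcl : t' ∈ closure B := csInf_mem_closure hBne hBbd
  have hsub : B ⊆ K ∩ Ici t₀ := fun t ht => ⟨ht.1, ht.2.1⟩
  have ht'K : t' ∈ K ∩ Ici t₀ := closure_minimal hsub hK hcl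
  -- The infimum of the bad times is bad itself: near a good time, times in `K` belong to the
  -- locally finite `D`, so bad times cannot accumulate at it from the right.
  have hbad' : ¬ good t' := by
    intro hgood
    have hev := hiso t' ht'K.1 ht'K.2 hgood
    obtain ⟨δ, hδ, hfree⟩ := exists_Ioo_notMem hD t'
    have hev2 : ∀ᶠ u in 𝓝 t', u < t' + δ := gt_mem_nhds (by linarith)
    obtain ⟨u, ⟨hu1, hu2⟩, huB⟩ := (mem_closure_iff_nhds.1 hcl _ (hev.and hev2)).imp fun _ h => h
    have hle : t' ≤ u := csInf_le hBbd huB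
    have hne : u ≠ t' := fun e => huB.2.2 (e ▸ hgood)
    exact hfree u ⟨lt_of_le_of_ne hle hne.symm, hu2⟩ (hu1 huB.1)
  have hlt : t₀ < t' := lt_of_le_of_ne ht'K.2 fun e => hbad' (e ▸ hg0)
  have hgood : ∀ t ∈ K, t₀ ≤ t → t < t' → good t := by
    intro t htK ht0 htt
    by_contra hb
    exact absurd (csInf_le hBbd (show t ∈ B from ⟨htK, ht0, hb⟩)) (not_le.2 htt)
  -- All earlier times are good, hence in `D`, and so there are finitely many; the last of them is
  -- followed directly by `t'`, and the step makes `t'` good.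
  have hfin : (K ∩ Ico t₀ t').Finite := by
    refine (hD t₀ t').subset fun t ht => ⟨?_, ht.2.1, ht.2.2.le⟩
    exact (hiso t ht.1 ht.2.1 (hgood t ht.1 ht.2.1 ht.2.2)).self_of_nhds ht.1
  obtain ⟨m, ⟨hmK, hm⟩, hmax⟩ := hfin.exists_maximal ⟨t₀, h0, le_rfl, hlt⟩
  refine hbad' (hstep m hmK t' ht'K.1 hm.1 hm.2 (hgood m hmK hm.1 hm.2) fun u hu huK => ?_)
  have := hmax (y := u) ⟨huK, hm.1.trans hu.1.le, hu.2⟩ hu.1.le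
  exact absurd hu.1 (not_lt.2 this)

lemma isClosed_times {γ : ℝ → Fin 2 → ℝ} {a : ℝ} (hc : ContinuousOn γ (Ici a)) :
    IsClosed ({t | γ t ∈ switchingLine} ∩ Ici a) := by
  rw [inter_comm]
  exact hc.preimage_isClosed_of_isClosed isClosed_Ici isClosed_switchingLine

/-- Without a free interval after `a` the times on the line could accumulate at `a`, and there would
be no next one. -/
lemma exists_next_time {γ : ℝ → Fin 2 → ℝ} {a b δ : ℝ} (hc : ContinuousOn γ (Ici a)) (hδ : 0 < δ)
    (hfree : ∀ t ∈ Ioo a (a + δ), γ t ∉ switchingLine) (hab : a < b) (hb : γ b ∈ switchingLine) :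
    ∃ c, a < c ∧ c ≤ b ∧ γ c ∈ switchingLine ∧ ∀ t ∈ Ioo a c, γ t ∉ switchingLine := by
  have hδb : a + δ ≤ b := by
    by_contra hcon
    exact hfree b ⟨hab, not_le.1 hcon⟩ hb
  have hcl : IsCompact (({t | γ t ∈ switchingLine} ∩ Ici a) ∩ Icc (a + δ) b) :=
    isCompact_Icc.inter_left (isClosed_times hc)
  obtain ⟨c, ⟨⟨hc1, -⟩, hc2⟩, hmin⟩ := hcl.exists_isLeast ⟨b, ⟨hb, hab.le⟩, hδb, le_rfl⟩
  refine ⟨c, by linarith [hc2.1], hc2.2, hc1, fun t ht hts => ?_⟩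
  rcases lt_or_ge t (a + δ) with h | h
  · exact hfree t ⟨ht.1, h⟩ hts
  · exact absurd (hmin ⟨⟨hts, ht.1.le⟩, h, ht.2.le.trans hc2.2⟩) (not_le.2 ht.2)

namespace PWLSystem

variable {S : PWLSystem} {s : Side} {γ : ℝ → Fin 2 → ℝ} {I : Set ℝ}

lemma IsArc.mono {c : ℝ → Fin 2 → ℝ} {a b a' b' : ℝ} (h : S.IsArc s c a b) (ha : a ≤ a')
    (hb : b' ≤ b) (hab : a' < b') : S.IsArc s c a' b' :=
  ⟨hab, h.2.1.mono (Icc_subset_Icc ha hb), fun t ht =>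
    h.2.2 t ⟨ha.trans_lt ht.1, ht.2.trans_le hb⟩⟩

lemma IsArc.hasDerivWithinAt_Iic {c : ℝ → Fin 2 → ℝ} {a b : ℝ} (h : S.IsArc s c a b) :
    HasDerivWithinAt c (S.field s (c b)) (Iic b) b := by
  refine hasDerivWithinAt_Iic_of_tendsto_deriv (s := Ioo a b) ?_ ?_ (Ioo_mem_nhdsLT h.1) ?_
  · exact fun t ht => (h.2.2 t ht).2.differentiableAt.differentiableWithinAt
  · exact (h.2.1 b (right_mem_Icc.2 h.1.le)).mono Ioo_subset_Icc_self
  · have h1 : Tendsto (fun t => S.field s (c t)) (𝓝[<] b) (𝓝 (S.field s (c b))) := by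
      rw [← nhdsWithin_Ioo_eq_nhdsLT h.1]
      exact ((S.continuous_field s).continuousAt.comp_continuousWithinAt
        ((h.2.1 b (right_mem_Icc.2 h.1.le)).mono Ioo_subset_Icc_self)).tendsto
    refine h1.congr' ?_
    filter_upwards [Ioo_mem_nhdsLT h.1] with t ht
    exact (h.2.2 t ht).2.deriv.symm

lemma Regular.hasDerivAt_of_mem_region {t : ℝ} (h : S.Regular γ t) (hr : γ t ∈ s.region) :
    HasDerivAt γ (S.field s (γ t)) t := by
  rcases h with ⟨s', h1, h2⟩ | ⟨h1, -⟩
  · rwa [Side.eq_of_mem_region hr h1] at h2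
  · exact absurd h1.self_of_nhds.1 (Side.notMem_switchingLine hr)

/-- A break point inside a half plane is not a real one: the curve is continuous and follows the
same field on both sides, so the one-sided derivatives there agree. -/
lemma IsSolutionOn.isArc (h : S.IsSolutionOn γ I) {a b : ℝ} (hab : a < b) (hI : Icc a b ⊆ I)
    (hr : ∀ t ∈ Ioo a b, γ t ∈ s.region) : S.IsArc s γ a b := by
  obtain ⟨hc, ⟨D, hD, hreg⟩, -⟩ := isSolutionOn_iff.1 h
  have hint : Ioo a b ⊆ interior I := interior_maximal (Ioo_subset_Icc_self.trans hI) isOpen_Ioo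
  have hcI := hc.mono hI
  refine ⟨hab, hcI, fun t ht => ⟨hr t ht, ?_⟩⟩
  obtain ⟨δ, hδ, hfree⟩ := exists_punctured_notMem hD t
  have key : ∀ u ∈ Ioo a b, u ≠ t → |u - t| < δ → HasDerivAt γ (S.field s (γ u)) u :=
    fun u hu hut hud => (hreg u (hint hu) (hfree u hut hud)).hasDerivAt_of_mem_region (hr u hu)
  have hr1 : S.IsArc s γ t (min b (t + δ)) := by
    refine ⟨lt_min ht.2 (by linarith), hcI.mono (Icc_subset_Icc ht.1.le (min_le_left _ _)), ?_⟩
    intro u hu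
    have h1 : u < b := hu.2.trans_le (min_le_left _ _)
    have h2 : u < t + δ := hu.2.trans_le (min_le_right _ _)
    have hm : u ∈ Ioo a b := ⟨ht.1.trans hu.1, h1⟩
    exact ⟨hr u hm, key u hm hu.1.ne' (by rw [abs_lt]; exact ⟨by linarith [hu.1], by linarith⟩)⟩
  have hl1 : S.IsArc s γ (max a (t - δ)) t := by
    refine ⟨max_lt ht.1 (by linarith), hcI.mono (Icc_subset_Icc (le_max_left _ _) ht.2.le), ?_⟩
    intro u hu
    have h1 : a < u := (le_max_left _ _).trans_lt hu.1
    have h2 : t - δ < u := (le_max_right _ _).trans_lt hu.1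
    have hm : u ∈ Ioo a b := ⟨h1, hu.2.trans ht.2⟩
    exact ⟨hr u hm, key u hm hu.2.ne (by rw [abs_lt]; exact ⟨by linarith, by linarith [hu.2]⟩)⟩
  have hu := hl1.hasDerivWithinAt_Iic.union hr1.hasDerivWithinAt_Ici
  rwa [Iic_union_Ici, hasDerivWithinAt_univ] at hu

lemma IsSolutionOn.exists_isArc (h : S.IsSolutionOn γ I) {a b : ℝ} (hab : a < b)
    (hI : Icc a b ⊆ I) (hr : ∀ t ∈ Ioo a b, γ t ∉ switchingLine) : ∃ s, S.IsArc s γ a b := by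
  obtain ⟨s, hs⟩ := exists_side_of_forall_notMem hab (h.1.mono (Ioo_subset_Icc_self.trans hI)) hr
  exact ⟨s, h.isArc hab hI hs⟩

/-- On an interval without break points a solution stays in one half plane or it slides. -/
lemma IsSolutionOn.exists_isArc_or_slides (h : S.IsSolutionOn γ I) {a b : ℝ} (hab : a < b)
    (hI : Icc a b ⊆ I) (hreg : ∀ t ∈ Ioo a b, S.Regular γ t) :
    (∃ s, S.IsArc s γ a b) ∨
      ∀ t ∈ Ioo a b, γ t ∈ S.slidingRegion ∧ HasDerivAt γ (S.slidingField (γ t)) t := by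
  have hc : ContinuousOn γ (Ioo a b) := h.1.mono (Ioo_subset_Icc_self.trans hI)
  have hU : IsOpen {t | ∀ᶠ u in 𝓝 t, γ u ∈ S.slidingRegion} :=
    isOpen_iff_eventually.2 fun t ht => eventually_eventually_nhds.2 ht
  have hV : IsOpen (Ioo a b ∩ γ ⁻¹' switchingLineᶜ) :=
    hc.isOpen_inter_preimage isOpen_Ioo isClosed_switchingLine.isOpen_compl
  have hdisj : Disjoint {t | ∀ᶠ u in 𝓝 t, γ u ∈ S.slidingRegion}
      (Ioo a b ∩ γ ⁻¹' switchingLineᶜ) := by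
    rw [Set.disjoint_left]
    intro t ht ht'
    exact ht'.2 (Eventually.self_of_nhds ht).1
  have hcov : Ioo a b ⊆ {t | ∀ᶠ u in 𝓝 t, γ u ∈ S.slidingRegion} ∪
      (Ioo a b ∩ γ ⁻¹' switchingLineᶜ) := by
    intro t ht
    rcases hreg t ht with ⟨s, h1, -⟩ | ⟨h1, -⟩
    · exact Or.inr ⟨ht, Side.notMem_switchingLine h1⟩
    · exact Or.inl h1
  rcases isPreconnected_Ioo.subset_or_subset hU hV hdisj hcov with h1 | h1
  · right
    intro t ht
    have ht0 : ∀ᶠ u in 𝓝 t, γ u ∈ S.slidingRegion := h1 ht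
    have ht1 : γ t ∈ S.slidingRegion := ht0.self_of_nhds
    refine ⟨ht1, ?_⟩
    rcases hreg t ht with ⟨s, h2, -⟩ | ⟨-, h2⟩
    · exact absurd ht1.1 (Side.notMem_switchingLine h2)
    · exact h2
  · exact Or.inl (h.exists_isArc hab hI fun t ht => (h1 ht).2)

/-- A solution is regular only off the line or inside the sliding region, so a visit to the line
anywhere else is a break point, and such visits are locally finite. -/
lemma IsSolutionOn.exists_break (h : S.IsSolutionOn γ I) :
    ∃ D : Set ℝ, (∀ a b, (D ∩ Icc a b).Finite) ∧ (∀ t ∈ interior I, t ∉ D → S.Regular γ t) ∧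
      ∀ t ∈ interior I, γ t ∈ switchingLine → γ t ∉ S.slidingRegion → t ∈ D := by
  obtain ⟨-, ⟨D, hD, hreg⟩, -⟩ := isSolutionOn_iff.1 h
  refine ⟨D, hD, hreg, fun t ht h1 h2 => ?_⟩
  by_contra hcon
  rcases hreg t ht hcon with ⟨s, h3, -⟩ | ⟨h3, -⟩
  · exact Side.notMem_switchingLine h3 h1
  · exact h2 h3.self_of_nhds

/-- A solution at a point of the switching line outside the sliding region leaves the line. -/
lemma IsSolutionOn.exists_free (h : S.IsSolutionOn γ I) {a : ℝ} (hI : Ici a ⊆ I)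
    (h2 : γ a ∉ S.slidingRegion) :
    ∃ δ > 0, ∀ t ∈ Ioo a (a + δ), γ t ∉ switchingLine := by
  obtain ⟨D, hD, -, hbr⟩ := h.exists_break
  obtain ⟨δ, hδ, hfree⟩ := exists_Ioo_notMem hD a
  have hcont : ContinuousWithinAt γ (Ici a) a := (h.1.mono hI) a self_mem_Ici
  have hev : ∀ᶠ t in 𝓝[≥] a, γ t ∉ S.slidingRegion :=
    hcont.eventually_mem (S.isClosed_slidingRegion.isOpen_compl.mem_nhds h2)
  obtain ⟨b, hb, hb'⟩ := mem_nhdsGE_iff_exists_Ico_subset.1 hev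
  refine ⟨min δ (b - a), lt_min hδ (sub_pos.2 hb), fun t ht hts => ?_⟩
  have h3 : t < a + δ := ht.2.trans_le (by gcongr; exact min_le_left _ _)
  have h4 : t < b := by
    have : t < a + (b - a) := ht.2.trans_le (by gcongr; exact min_le_right _ _)
    linarith
  have hint : t ∈ interior I := interior_mono hI (by rw [interior_Ici]; exact ht.1)
  exact hfree t ⟨ht.1, h3⟩ (hbr t hint hts (hb' ⟨ht.1.le, h4⟩))

/-- Induction along the times on the switching line, as long as the points reached are outside
the sliding region. -/
lemma IsSolutionOn.sigma_induction (h : S.IsSolutionOn γ I) {t₀ : ℝ} (hI : Ici t₀ ⊆ interior I)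
    {good : (Fin 2 → ℝ) → Prop} (hgs : ∀ z, good z → z ∉ S.slidingRegion)
    (h0 : γ t₀ ∈ switchingLine) (hg0 : good (γ t₀))
    (hstep : ∀ s a b, t₀ ≤ a → S.IsArc s γ a b → γ a ∈ switchingLine → γ b ∈ switchingLine →
      good (γ a) → good (γ b)) :
    ∀ t, t₀ ≤ t → γ t ∈ switchingLine → good (γ t) := by
  obtain ⟨D, hD, -, hbr⟩ := h.exists_break
  have hII : Ici t₀ ⊆ I := hI.trans interior_subset
  have key := time_induction (K := {t | γ t ∈ switchingLine}) (good := fun t => good (γ t))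
    (isClosed_times (h.1.mono hII)) hD h0 hg0 ?_ ?_
  · exact fun t ht hts => key t hts ht
  · intro t hts ht hgt
    have hcont : ContinuousAt γ t :=
      h.1.continuousAt (mem_interior_iff_mem_nhds.1 (hI ht))
    have hev : ∀ᶠ u in 𝓝 t, γ u ∉ S.slidingRegion :=
      hcont.eventually_mem (S.isClosed_slidingRegion.isOpen_compl.mem_nhds (hgs _ hgt))
    filter_upwards [hev, isOpen_interior.mem_nhds (hI ht)] with u hu hui hus
    exact hbr u hui hus hu
  · intro t hts t' hts' ht htt hgt hfree
    obtain ⟨s, hs⟩ := h.exists_isArc htt (fun u hu => hII (ht.trans hu.1)) hfree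
    exact hstep s t t' ht hs hts hts' hgt

end PWLSystem


/-! ### The return map and crossing periodic orbits as its fixed points -/

namespace PWLSystem

variable {S : PWLSystem} {s : Side} {γ : ℝ → Fin 2 → ℝ} {I : Set ℝ}

/-- The half return maps of both sides, in a system whose sliding region is the bounded attractive
segment between the two tangencies. -/
structure ReturnMap (S : PWLSystem) where
  ε : ℝ
  hε : ε * ε = 1
  H : ∀ s, HalfReturn S s ε
  gap : ∀ s, 0 < (H s).p + (H s.opp).p

namespace ReturnMap

variable (R : ReturnMap S)

/-- The coordinate on the switching line as seen from side `s`. -/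
def crd (s : Side) (z : Fin 2 → ℝ) : ℝ := s.crd R.ε z

/-- The point on the switching line with coordinate `u` as seen from side `s`. -/
def pt (s : Side) (u : ℝ) : Fin 2 → ℝ := s.pt R.ε u

/-- The tangency of side `s`. -/
def p (s : Side) : ℝ := (R.H s).p

/-- The half return map of side `s`. -/
def h (s : Side) : ℝ → ℝ := (R.H s).h

lemma pt_mem (s : Side) (u : ℝ) : R.pt s u ∈ switchingLine := Side.pt_mem _ _ _

lemma crd_opp (s : Side) (z : Fin 2 → ℝ) : R.crd s.opp z = -R.crd s z := Side.crd_opp _ _ _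

lemma pt_opp (s : Side) (u : ℝ) : R.pt s.opp u = R.pt s (-u) := Side.pt_opp _ _ _

lemma crd_pt (s : Side) (u : ℝ) : R.crd s (R.pt s u) = u := Side.crd_pt _ R.hε _

lemma pt_crd (s : Side) {z : Fin 2 → ℝ} (hz : z ∈ switchingLine) : R.pt s (R.crd s z) = z :=
  Side.pt_crd _ R.hε hz

lemma gap' (s : Side) : 0 < R.p s + R.p s.opp := R.gap s

lemma vel_eq (s : Side) {z : Fin 2 → ℝ} (hz : z ∈ switchingLine) :
    S.vel s z = (R.H s).m * (R.crd s z - R.p s) := (R.H s).vel_eq z hz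

lemma mem_slidingRegion (s : Side) {z : Fin 2 → ℝ} (hz : z ∈ switchingLine) :
    z ∈ S.slidingRegion ↔ R.crd s z ≤ R.p s ∧ R.crd s.opp z ≤ R.p s.opp := by
  rw [PWLSystem.mem_slidingRegion s, R.vel_eq s hz, R.vel_eq s.opp hz]
  have h1 := (R.H s).m_pos
  have h2 := (R.H s.opp).m_pos
  have h3 := R.gap' s
  have h4 := R.crd_opp s z
  have e : (R.H s).m * (R.crd s z - R.p s) * ((R.H s.opp).m * (R.crd s.opp z - R.p s.opp)) =
      ((R.H s).m * (R.H s.opp).m) * ((R.crd s z - R.p s) * (R.crd s.opp z - R.p s.opp)) := by ring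
  rw [e, mul_nonneg_iff_of_pos_left (mul_pos h1 h2), mul_nonneg_iff]
  constructor
  -- Two nonnegative normal velocities would be repulsive sliding, which the gap between the
  -- tangencies excludes.
  · rintro ⟨-, ⟨h5, h6⟩ | ⟨h5, h6⟩⟩
    · exfalso; linarith
    · exact ⟨by linarith, by linarith⟩
  · rintro ⟨h5, h6⟩
    exact ⟨hz, Or.inr ⟨by linarith, by linarith⟩⟩

lemma notMem_slidingRegion {z : Fin 2 → ℝ} (h : R.p s < R.crd s z) : z ∉ S.slidingRegion :=
  fun hz => absurd ((R.mem_slidingRegion s hz.1).1 hz).1 (not_le.2 h)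

lemma mem_slidingInterior (s : Side) {z : Fin 2 → ℝ} (hz : z ∈ switchingLine)
    (h1 : R.crd s z < R.p s) (h2 : R.crd s.opp z < R.p s.opp) : z ∈ S.slidingInterior := by
  refine mem_slidingInterior_of_neg (s := s) hz ?_ ?_
  · rw [R.vel_eq s hz]
    exact mul_neg_of_pos_of_neg (R.H s).m_pos (by linarith)
  · rw [R.vel_eq s.opp hz]
    exact mul_neg_of_pos_of_neg (R.H s.opp).m_pos (by linarith)

lemma notMem_slidingInterior {z : Fin 2 → ℝ} (h : R.p s < R.crd s z) : z ∉ S.slidingInterior :=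
  fun hz => R.notMem_slidingRegion h (hz.2.self_of_nhdsWithin hz.1)

lemma mem_attractiveRegion (s : Side) {z : Fin 2 → ℝ} :
    z ∈ S.attractiveRegion ↔ z ∈ switchingLine ∧ R.crd s z < R.p s ∧ R.crd s.opp z < R.p s.opp := by
  rw [PWLSystem.mem_attractiveRegion s]
  refine and_congr_right fun hz => ?_
  rw [R.vel_eq s hz, R.vel_eq s.opp hz]
  have h1 := (R.H s).m_pos
  have h2 := (R.H s.opp).m_pos
  constructor
  · rintro ⟨h3, h4⟩
    exact ⟨by nlinarith, by nlinarith⟩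
  · rintro ⟨h3, h4⟩
    exact ⟨by nlinarith, by nlinarith⟩

/-- The side of an arc is determined by its starting point. -/
lemma side_eq {s s' : Side} {c : ℝ → Fin 2 → ℝ} {a b : ℝ} (hc : S.IsArc s' c a b)
    (ha : c a ∈ switchingLine) (hp : R.p s ≤ R.crd s (c a)) : s' = s := by
  rcases s.eq_or_eq_opp s' with e | e
  · exact e
  · exfalso
    subst e
    have h1 := (R.H s.opp).le_of_mem _ ((R.H s.opp).crd_start_mem R.hε hc ha)
    have h2 : R.p s.opp ≤ R.crd s.opp (c a) := h1
    rw [crd_opp] at h2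
    linarith [R.gap' s]

lemma crd_start_mem {c : ℝ → Fin 2 → ℝ} {a b : ℝ} (hc : S.IsArc s c a b)
    (ha : c a ∈ switchingLine) : R.crd s (c a) ∈ (R.H s).dom :=
  (R.H s).crd_start_mem R.hε hc ha

lemma le_crd_start {c : ℝ → Fin 2 → ℝ} {a b : ℝ} (hc : S.IsArc s c a b)
    (ha : c a ∈ switchingLine) : R.p s ≤ R.crd s (c a) :=
  (R.H s).le_of_mem _ (R.crd_start_mem hc ha)

lemma crd_end {c : ℝ → Fin 2 → ℝ} {a b : ℝ} (hc : S.IsArc s c a b)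
    (ha : c a ∈ switchingLine) (hb : c b ∈ switchingLine) :
    R.crd s.opp (c b) = R.h s (R.crd s (c a)) :=
  (R.H s).arc_end_crd R.hε hc ha hb

/-- The two sides see opposite coordinates, so `-p < h u` says that an arc always comes back
strictly on the near side of its own tangency. -/
lemma crd_end_lt {c : ℝ → Fin 2 → ℝ} {a b : ℝ} (hc : S.IsArc s c a b)
    (ha : c a ∈ switchingLine) (hb : c b ∈ switchingLine) : R.crd s (c b) < R.p s := by
  have h1 : -R.p s < R.h s (R.crd s (c a)) := (R.H s).neg_lt _ (R.crd_start_mem hc ha)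
  have h2 := R.crd_end hc ha hb
  rw [crd_opp] at h2
  linarith

lemma mono (s : Side) : StrictMonoOn (R.h s) (Ici (R.p s)) := (R.H s).mono

/-- The arc of side `s` that starts at the coordinate `u`. -/
def arc (s : Side) (u : ℝ) : Set (Fin 2 → ℝ) := (R.H s).flow u '' Icc 0 ((R.H s).τ u)

/-- The arc of side `s` that starts at the coordinate `u`, and the following arc of the opposite
side. -/
def orb (s : Side) (u : ℝ) : Set (Fin 2 → ℝ) := R.arc s u ∪ R.arc s.opp (R.h s u)

lemma arc_image {c : ℝ → Fin 2 → ℝ} {a b : ℝ} (hc : S.IsArc s c a b)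
    (ha : c a ∈ switchingLine) (hb : c b ∈ switchingLine) :
    c '' Icc a b = R.arc s (R.crd s (c a)) :=
  (R.H s).arc_image R.hε hc ha hb

end ReturnMap

lemma finite_times_of_periodic {T : ℝ} (hT : 0 < T) (hper : Function.Periodic γ T)
    (hfin : {t ∈ Ico 0 T | γ t ∈ switchingLine}.Finite) (a b : ℝ) :
    ({t | γ t ∈ switchingLine} ∩ Icc a b).Finite := by
  refine ((((Finset.Icc ⌊a / T⌋ ⌊b / T⌋).finite_toSet).prod hfin).image
    (fun q : ℤ × ℝ => q.2 + q.1 * T)).subset ?_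
  rintro t ⟨hts, hta, htb⟩
  refine ⟨(⌊t / T⌋, t - ⌊t / T⌋ * T), ⟨?_, ?_, ?_⟩, by simp⟩
  · simp only [Finset.coe_Icc, mem_Icc]
    exact ⟨Int.floor_mono (by gcongr), Int.floor_mono (by gcongr)⟩
  · have h1 := Int.floor_le (t / T)
    have h2 := Int.lt_floor_add_one (t / T)
    rw [le_div_iff₀ hT] at h1
    rw [div_lt_iff₀ hT] at h2
    exact ⟨by simp only; linarith, by simp only; linarith⟩
  · change γ (t - ⌊t / T⌋ * T) ∈ switchingLine
    rw [hper.sub_int_mul_eq]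
    exact hts

/-- In the interior of the sliding region a solution has to stay on the line for a while, which
isolated visits do not allow. -/
lemma IsSolutionOn.notMem_slidingInterior (h : S.IsSolutionOn γ univ)
    (hK : ∀ a b, ({t | γ t ∈ switchingLine} ∩ Icc a b).Finite) (t : ℝ) :
    γ t ∉ S.slidingInterior := by
  intro hi
  obtain ⟨δ, hδ, hfree⟩ := exists_Ioo_notMem hK t
  have h1 := h.2.2 t trivial hi
  have h2 : ∀ᶠ u in 𝓝[>] t, u ∈ Ioo t (t + δ) := Ioo_mem_nhdsGT (by linarith)
  obtain ⟨u, hu1, hu2⟩ := (h1.and h2).exists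
  exact hfree u hu2 hu1

lemma exists_next_time_of_finite (hc : Continuous γ)
    (hK : ∀ a b, ({t | γ t ∈ switchingLine} ∩ Icc a b).Finite) {a b : ℝ} (hab : a < b)
    (hb : γ b ∈ switchingLine) :
    ∃ c, a < c ∧ c ≤ b ∧ γ c ∈ switchingLine ∧ ∀ t ∈ Ioo a c, γ t ∉ switchingLine := by
  obtain ⟨δ, hδ, hfree⟩ := exists_Ioo_notMem hK a
  exact exists_next_time hc.continuousOn hδ hfree hab hb

lemma exists_nat_add_mul_gt {T : ℝ} (hT : 0 < T) (t a : ℝ) : ∃ N : ℕ, a < t + N * T := by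
  obtain ⟨N, hN⟩ := exists_nat_gt ((a - t) / T)
  rw [div_lt_iff₀ hT] at hN
  exact ⟨N, by linarith⟩

namespace ReturnMap

/-- A crossing periodic orbit comes from a fixed point of the return map. -/
theorem exists_fixed_of_crossing (R : ReturnMap S) (s : Side) {Γ : Set (Fin 2 → ℝ)}
    (hΓ : S.IsCrossingPeriodicOrbit Γ) :
    ∃ u, R.p s ≤ u ∧ R.p s.opp ≤ R.h s u ∧ R.h s.opp (R.h s u) = u ∧ Γ = R.orb s u := by
  obtain ⟨γ, T, ⟨hT, hsol, hper, -⟩, rfl, ⟨t', ht'⟩, hfin⟩ := hΓ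
  have hK := finite_times_of_periodic hT hper hfin
  have hcont : Continuous γ := continuousOn_univ.1 hsol.1
  have hNI := hsol.notMem_slidingInterior hK
  -- An arc ends below the tangency of its own side; if it also ended below the other tangency it
  -- would be in the sliding interior. So it ends where the opposite side can be entered.
  have harc : ∀ s' a b, S.IsArc s' γ a b → γ a ∈ switchingLine → γ b ∈ switchingLine →
      R.p s'.opp ≤ R.crd s'.opp (γ b) := by
    intro s' a b hc ha hb
    by_contra hcon
    exact hNI b (R.mem_slidingInterior s' hb (R.crd_end_lt hc ha hb) (not_le.1 hcon))
  have hnext : ∀ a b, a < b → γ b ∈ switchingLine → γ a ∈ switchingLine →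
      ∃ s' c, c ≤ b ∧ S.IsArc s' γ a c ∧ γ c ∈ switchingLine := by
    intro a b hab hb ha
    obtain ⟨c, h1, h2, h3, h4⟩ := exists_next_time_of_finite hcont hK hab hb
    obtain ⟨s', hs'⟩ := hsol.exists_isArc h1 (subset_univ _) h4
    exact ⟨s', c, h2, hs', h3⟩
  have hshift : ∀ t, γ (t + T) = γ t := hper
  -- Arcs alternate between the sides, so some visit to the line starts an arc of side `s`.
  obtain ⟨t₀, h0, hp0⟩ : ∃ t₀, γ t₀ ∈ switchingLine ∧ R.p s ≤ R.crd s (γ t₀) := by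
    obtain ⟨s', c, -, hc, hcs⟩ := hnext t' (t' + T) (by linarith) (by rw [hshift]; exact ht'.2) ht'.2
    rcases s.eq_or_eq_opp s' with e | e
    · subst e
      exact ⟨t', ht'.2, R.le_crd_start hc ht'.2⟩
    · subst e
      refine ⟨c, hcs, ?_⟩
      simpa using harc _ _ _ hc ht'.2 hcs
  set u₀ := R.crd s (γ t₀) with hu₀
  obtain ⟨s₁, t₁, ht₁, hc₁, h1⟩ := hnext t₀ (t₀ + T) (by linarith) (by rw [hshift]; exact h0) h0
  obtain rfl := R.side_eq hc₁ h0 hp0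
  have hp1 := harc _ _ _ hc₁ h0 h1
  have e1 : R.crd s₁.opp (γ t₁) = R.h s₁ u₀ := R.crd_end hc₁ h0 h1
  have ht₁' : t₁ < t₀ + T := by
    refine lt_of_le_of_ne ht₁ fun e => ?_
    have := R.crd_end_lt hc₁ h0 h1
    rw [e, hshift] at this
    linarith
  obtain ⟨s₂, t₂, ht₂, hc₂, h2⟩ := hnext t₁ (t₀ + T) ht₁' (by rw [hshift]; exact h0) h1
  obtain rfl := R.side_eq hc₂ h1 hp1
  have hp2 : R.p s₁ ≤ R.crd s₁ (γ t₂) := by simpa using harc _ _ _ hc₂ h1 h2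
  have e2 : R.crd s₁ (γ t₂) = R.h s₁.opp (R.h s₁ u₀) := by
    have := R.crd_end hc₂ h1 h2
    rwa [e1, Side.opp_opp] at this
  set u₁ := R.crd s₁ (γ t₂) with hu₁
  -- Any pair of conditions on the coordinates that the two half return maps exchange is passed
  -- along all later visits. It is used with inequalities to prove that `u₀` is fixed, and with
  -- equalities to identify the orbit.
  have ind : ∀ (P Q : ℝ → Prop) (ta : ℝ), γ ta ∈ switchingLine → R.p s₁ ≤ R.crd s₁ (γ ta) →
      P (R.crd s₁ (γ ta)) → (∀ u, R.p s₁ ≤ u → P u → Q (R.h s₁ u)) →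
      (∀ v, R.p s₁.opp ≤ v → Q v → P (R.h s₁.opp v)) → ∀ t, γ t ∈ switchingLine → ta ≤ t →
      (R.p s₁ ≤ R.crd s₁ (γ t) ∧ P (R.crd s₁ (γ t))) ∨
        (R.p s₁.opp ≤ R.crd s₁.opp (γ t) ∧ Q (R.crd s₁.opp (γ t))) := by
    intro P Q ta hta hpa hPa hPQ hQP
    refine time_induction (K := {t | γ t ∈ switchingLine})
      (good := fun t => (R.p s₁ ≤ R.crd s₁ (γ t) ∧ P (R.crd s₁ (γ t))) ∨
        (R.p s₁.opp ≤ R.crd s₁.opp (γ t) ∧ Q (R.crd s₁.opp (γ t))))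
      (isClosed_times hcont.continuousOn) hK hta (Or.inl ⟨hpa, hPa⟩)
      (fun t _ _ _ => Eventually.of_forall fun u hu => hu) ?_
    intro a ha b hb _ hab hgood hfree
    obtain ⟨s', hs'⟩ := hsol.exists_isArc hab (subset_univ _) hfree
    have hpb := harc _ _ _ hs' ha hb
    have heb := R.crd_end hs' ha hb
    rcases hgood with ⟨hg1, hg2⟩ | ⟨hg1, hg2⟩
    · obtain rfl := R.side_eq hs' ha hg1
      exact Or.inr ⟨hpb, heb ▸ hPQ _ hg1 hg2⟩
    · obtain rfl := R.side_eq hs' ha hg1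
      rw [Side.opp_opp] at hpb heb
      exact Or.inl ⟨hpb, heb ▸ hQP _ hg1 hg2⟩
  have hT0 : γ (t₀ + T) ∈ switchingLine := by rw [hshift]; exact h0
  have hnot : ¬ R.p s₁.opp ≤ R.crd s₁.opp (γ (t₀ + T)) := by
    rw [hshift, crd_opp, ← hu₀]
    intro hcon
    linarith [R.gap' s₁]
  have hm1 := (R.mono s₁).monotoneOn
  have hm2 := (R.mono s₁.opp).monotoneOn
  -- A monotone map has no periodic points but fixed ones: if the first return moves `u₀` to one
  -- side, all later returns remain beyond `u₁`, while periodicity brings the orbit back to `u₀` at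
  -- time `t₀ + T`.
  have hfix : u₁ = u₀ := by
    rcases lt_trichotomy u₁ u₀ with hlt | heq | hgt
    · exfalso
      have hp1' : R.p s₁.opp ≤ R.h s₁ u₀ := e1 ▸ hp1
      have := ind (fun u => u ≤ u₁) (fun v => v ≤ R.h s₁ u₁) t₂ h2 hp2 le_rfl
        (fun u hu hle => hm1 hu hp2 hle) (fun v hv hle => by
          have h3 : v ≤ R.h s₁ u₀ := hle.trans (hm1 hp2 hp0 hlt.le)
          have h4 := hm2 hv hp1' h3
          rwa [← e2] at h4)
        (t₀ + T) hT0 ht₂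
      rcases this with ⟨-, h3⟩ | ⟨h3, -⟩
      · rw [hshift, ← hu₀] at h3; linarith
      · exact hnot h3
    · exact heq
    · exfalso
      have hp1' : R.p s₁.opp ≤ R.h s₁ u₀ := e1 ▸ hp1
      have := ind (fun u => u₁ ≤ u) (fun v => R.h s₁ u₁ ≤ v) t₂ h2 hp2 le_rfl
        (fun u hu hle => hm1 hp2 hu hle) (fun v hv hle => by
          have h3 : R.h s₁ u₀ ≤ v := (hm1 hp0 hp2 hgt.le).trans hle
          have h4 := hm2 hp1' hv h3
          rwa [← e2] at h4)
        (t₀ + T) hT0 ht₂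
      rcases this with ⟨-, h3⟩ | ⟨h3, -⟩
      · rw [hshift, ← hu₀] at h3; linarith
      · exact hnot h3
  refine ⟨u₀, hp0, e1 ▸ hp1, by rw [← e2, hfix], ?_⟩
  have hall := ind (fun u => u = u₀) (fun v => v = R.h s₁ u₀) t₀ h0 hp0 rfl
    (fun u _ e => by rw [e]) (fun v _ e => by rw [e, ← e2, hfix])
  apply Subset.antisymm
  · rintro _ ⟨t, rfl⟩
    obtain ⟨N, hN⟩ := exists_nat_add_mul_gt hT t t₀
    have ht : γ t = γ (t + N * T) := (hper.nat_mul N t).symm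
    obtain ⟨N', hN'⟩ := exists_nat_add_mul_gt hT t₀ (t + N * T)
    have hb' : γ (t₀ + N' * T) ∈ switchingLine := by
      rw [hper.nat_mul N' t₀]; exact h0
    rw [ht]
    set w := t + N * T with hw
    obtain ⟨a, ⟨ha1, ha2⟩, hamax⟩ := (hK t₀ w).exists_maximal ⟨t₀, h0, le_rfl, hN.le⟩
    obtain ⟨s', c, -, hc, hcs⟩ := hnext a (t₀ + N' * T) (ha2.2.trans_lt hN') hb' ha1
    have hwc : w ≤ c := by
      by_contra hcon
      have := hamax (y := c) ⟨hcs, ha2.1.trans hc.1.le, (not_le.1 hcon).le⟩ hc.1.le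
      exact absurd hc.1 (not_lt.2 this)
    have hmem : γ w ∈ R.arc s' (R.crd s' (γ a)) := by
      rw [← R.arc_image hc ha1 hcs]
      exact ⟨w, ⟨ha2.2, hwc⟩, rfl⟩
    rcases hall a ha1 ha2.1 with ⟨h3, h4⟩ | ⟨h3, h4⟩
    · obtain rfl := R.side_eq hc ha1 h3
      rw [h4] at hmem
      exact Or.inl hmem
    · obtain rfl := R.side_eq hc ha1 h3
      rw [h4] at hmem
      exact Or.inr hmem
  · refine union_subset ?_ ?_
    · rw [hu₀, ← R.arc_image hc₁ h0 h1]
      exact image_subset_range _ _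
    · rw [← e1, ← R.arc_image hc₂ h1 h2]
      exact image_subset_range _ _

end ReturnMap

end PWLSystem


/-! ### Gluing pieces of solutions and periodic continuation -/

/-- The curve `γ₁` up to the time `τ`, followed by the curve `γ₂`. -/
noncomputable def concatCurve (γ₁ : ℝ → Fin 2 → ℝ) (τ : ℝ) (γ₂ : ℝ → Fin 2 → ℝ) (t : ℝ) :
    Fin 2 → ℝ :=
  if t ≤ τ then γ₁ t else γ₂ (t - τ)

lemma concatCurve_of_le {γ₁ γ₂ : ℝ → Fin 2 → ℝ} {τ t : ℝ} (h : t ≤ τ) :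
    concatCurve γ₁ τ γ₂ t = γ₁ t := if_pos h

lemma concatCurve_of_ge {γ₁ γ₂ : ℝ → Fin 2 → ℝ} {τ t : ℝ} (he : γ₁ τ = γ₂ 0) (h : τ ≤ t) :
    concatCurve γ₁ τ γ₂ t = γ₂ (t - τ) := by
  rcases h.eq_or_lt with rfl | h
  · rw [concatCurve_of_le le_rfl, sub_self, he]
  · exact if_neg (not_le.2 h)

/-- The `T`-periodic continuation of a curve on `[0, T)`. -/
noncomputable def periodicCurve (γ : ℝ → Fin 2 → ℝ) (T : ℝ) (t : ℝ) : Fin 2 → ℝ :=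
  γ (Int.fract (t / T) * T)

lemma periodic_periodicCurve (γ : ℝ → Fin 2 → ℝ) {T : ℝ} (hT : 0 < T) :
    Function.Periodic (periodicCurve γ T) T := by
  intro t
  simp only [periodicCurve]
  rw [add_div, div_self hT.ne', Int.fract_add_one]

lemma periodicCurve_of_mem (γ : ℝ → Fin 2 → ℝ) {T t : ℝ} (hT : 0 < T) (k : ℤ)
    (ht : t - k * T ∈ Ico 0 T) : periodicCurve γ T t = γ (t - k * T) := by
  have h : ⌊t / T⌋ = k := by
    rw [Int.floor_eq_iff, le_div_iff₀ hT, div_lt_iff₀ hT]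
    exact ⟨by linarith [ht.1], by linarith [ht.2]⟩
  rw [periodicCurve, Int.fract, h, sub_mul, div_mul_cancel₀ _ hT.ne']

lemma periodicCurve_eq (γ : ℝ → Fin 2 → ℝ) {T t : ℝ} (hT : 0 < T) (ht : t ∈ Ico 0 T) :
    periodicCurve γ T t = γ t := by
  have := periodicCurve_of_mem γ (t := t) hT 0 (by simpa using ht)
  simpa using this

lemma exists_int_sub_mem (t : ℝ) {T : ℝ} (hT : 0 < T) : ∃ k : ℤ, t - k * T ∈ Ico 0 T := by
  refine ⟨⌊t / T⌋, ?_⟩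
  have h1 := Int.floor_le (t / T)
  have h2 := Int.lt_floor_add_one (t / T)
  rw [le_div_iff₀ hT] at h1
  rw [div_lt_iff₀ hT] at h2
  exact ⟨by linarith, by linarith⟩

lemma continuous_periodicCurve {γ : ℝ → Fin 2 → ℝ} {T : ℝ} (hT : 0 < T)
    (hc : ContinuousOn γ (Icc 0 T)) (he : γ T = γ 0) : Continuous (periodicCurve γ T) := by
  have := ContinuousOn.comp_fract (s := fun t : ℝ => t / T) (f := fun _ r => γ (r * T)) ?_
    (by fun_prop) (by simp [he])
  · exact this
  · refine hc.comp (f := fun q : ℝ × ℝ => q.2 * T) (by fun_prop) ?_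
    rintro ⟨a, b⟩ ⟨-, hb⟩
    exact ⟨mul_nonneg hb.1 hT.le, by simpa using mul_le_mul_of_nonneg_right hb.2 hT.le⟩

lemma range_periodicCurve {γ : ℝ → Fin 2 → ℝ} {T : ℝ} (hT : 0 < T) (he : γ T = γ 0) :
    range (periodicCurve γ T) = γ '' Icc 0 T := by
  ext z
  constructor
  · rintro ⟨t, rfl⟩
    obtain ⟨k, hk⟩ := exists_int_sub_mem t hT
    rw [periodicCurve_of_mem γ hT k hk]
    exact ⟨_, Ico_subset_Icc_self hk, rfl⟩
  · rintro ⟨t, ht, rfl⟩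
    rcases ht.2.lt_or_eq with h | h
    · exact ⟨t, periodicCurve_eq γ hT ⟨ht.1, h⟩⟩
    · exact ⟨0, by rw [periodicCurve_eq γ hT ⟨le_rfl, hT⟩, h, he]⟩

namespace PWLSystem

variable {S : PWLSystem} {s : Side} {γ γ₁ γ₂ : ℝ → Fin 2 → ℝ} {τ τ₁ τ₂ : ℝ}

/-- A piece of a solution, on the time interval `[0, τ]`. -/
def IsPiece (S : PWLSystem) (γ : ℝ → Fin 2 → ℝ) (τ : ℝ) : Prop :=
  0 < τ ∧ ContinuousOn γ (Icc 0 τ) ∧ {t ∈ Ioo 0 τ | ¬ S.Regular γ t}.Finite ∧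
    ∀ t ∈ Ico 0 τ, γ t ∈ S.slidingInterior → ∀ᶠ u in 𝓝[>] t, γ u ∈ switchingLine

/-- The junction is admitted as one more break point; the sliding rule there is supplied by the
second piece, because the rule of the first one is only required on a half-open interval. -/
lemma IsPiece.concat (h₁ : S.IsPiece γ₁ τ₁) (h₂ : S.IsPiece γ₂ τ₂) (he : γ₁ τ₁ = γ₂ 0) :
    S.IsPiece (concatCurve γ₁ τ₁ γ₂) (τ₁ + τ₂) := by
  obtain ⟨p1, c1, f1, s1⟩ := h₁
  obtain ⟨p2, c2, f2, s2⟩ := h₂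
  refine ⟨by linarith, ?_, ?_, ?_⟩
  · have e : Icc 0 (τ₁ + τ₂) = Icc 0 τ₁ ∪ Icc τ₁ (τ₁ + τ₂) :=
      (Icc_union_Icc_eq_Icc p1.le (by linarith)).symm
    rw [e]
    refine ContinuousOn.union_of_isClosed ?_ ?_ isClosed_Icc isClosed_Icc
    · exact c1.congr fun t ht => concatCurve_of_le ht.2
    · have : ContinuousOn (fun t => γ₂ (t - τ₁)) (Icc τ₁ (τ₁ + τ₂)) := by
        refine c2.comp (by fun_prop) fun t ht => ⟨by linarith [ht.1], by linarith [ht.2]⟩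
      exact this.congr fun t ht => concatCurve_of_ge he ht.1
  · refine ((f1.union (f2.image (fun t => t + τ₁))).union (finite_singleton τ₁)).subset ?_
    rintro t ⟨ht, hr⟩
    rcases lt_trichotomy t τ₁ with h | h | h
    · refine Or.inl (Or.inl ⟨⟨ht.1, h⟩, fun hreg => hr (hreg.congr ?_)⟩)
      filter_upwards [gt_mem_nhds h] with u hu
      exact (concatCurve_of_le (le_of_lt hu)).symm
    · exact Or.inr h
    · refine Or.inl (Or.inr ⟨t - τ₁, ⟨⟨by linarith, by linarith [ht.2]⟩, fun hreg => hr ?_⟩, by simp⟩)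
      refine hreg.comp_sub.congr ?_
      filter_upwards [lt_mem_nhds h] with u hu
      exact (concatCurve_of_ge he (le_of_lt hu)).symm
  · intro t ht hi
    rcases lt_or_ge t τ₁ with h | h
    · rw [concatCurve_of_le h.le] at hi
      have h1 : ∀ᶠ u in 𝓝[>] t, u < τ₁ := (gt_mem_nhds h).filter_mono nhdsWithin_le_nhds
      filter_upwards [s1 t ⟨ht.1, h⟩ hi, h1] with u hu hu1
      rwa [concatCurve_of_le hu1.le]
    · rw [concatCurve_of_ge he h] at hi
      have h1 := s2 (t - τ₁) ⟨by linarith, by linarith [ht.2]⟩ hi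
      have h2 : Tendsto (fun u => u - τ₁) (𝓝[>] t) (𝓝[>] (t - τ₁)) := by
        refine tendsto_nhdsWithin_iff.2 ⟨?_, ?_⟩
        · exact (continuous_id.sub continuous_const).continuousAt.tendsto.mono_left
            nhdsWithin_le_nhds
        · filter_upwards [self_mem_nhdsWithin] with u hu
          exact sub_lt_sub_right (mem_Ioi.1 hu) _
      filter_upwards [h2.eventually h1, self_mem_nhdsWithin] with u hu hu1
      rwa [concatCurve_of_ge he (h.trans (le_of_lt hu1))]

lemma IsPiece.isSolutionOn_periodicCurve {T : ℝ} (h : S.IsPiece γ T) (he : γ T = γ 0) :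
    S.IsSolutionOn (periodicCurve γ T) univ := by
  obtain ⟨hT, hc, hf, hs⟩ := h
  rw [isSolutionOn_iff]
  refine ⟨(continuous_periodicCurve hT hc he).continuousOn,
    ⟨{t | ¬ S.Regular (periodicCurve γ T) t}, fun a b => ?_, fun t _ ht => not_not.1 ht⟩, ?_⟩
  · refine ((((Finset.Icc ⌊a / T⌋ ⌊b / T⌋).finite_toSet).prod (hf.union (finite_singleton 0))).image
      (fun q : ℤ × ℝ => q.2 + q.1 * T)).subset ?_
    rintro t ⟨hr, hta, htb⟩
    have h1 := Int.floor_le (t / T)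
    have h2 := Int.lt_floor_add_one (t / T)
    rw [le_div_iff₀ hT] at h1
    rw [div_lt_iff₀ hT] at h2
    refine ⟨(⌊t / T⌋, t - ⌊t / T⌋ * T), ⟨?_, ?_⟩, by simp⟩
    · simp only [Finset.coe_Icc, mem_Icc]
      exact ⟨Int.floor_mono (by gcongr), Int.floor_mono (by gcongr)⟩
    · rcases (sub_nonneg.2 h1).eq_or_lt with h3 | h3
      · exact Or.inr h3.symm
      · refine Or.inl ⟨⟨h3, by simp only; linarith⟩, fun hreg => hr (hreg.comp_sub.congr ?_)⟩
        have hop : IsOpen ((fun u : ℝ => u - ⌊t / T⌋ * T) ⁻¹' Ioo 0 T) :=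
          isOpen_Ioo.preimage (by fun_prop)
        filter_upwards [hop.mem_nhds (show t ∈ _ from ⟨h3, by linarith⟩)] with u hu
        exact (periodicCurve_of_mem γ hT _ (Ioo_subset_Ico_self hu)).symm
  · intro t _ hi
    obtain ⟨k, hk⟩ := exists_int_sub_mem t hT
    rw [periodicCurve_of_mem γ hT k hk] at hi
    have h1 := hs _ hk hi
    have h2 : Tendsto (fun u => u - k * T) (𝓝[>] t) (𝓝[>] (t - k * T)) := by
      refine tendsto_nhdsWithin_iff.2 ⟨?_, ?_⟩
      · exact (continuous_id.sub continuous_const).continuousAt.tendsto.mono_left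
          nhdsWithin_le_nhds
      · filter_upwards [self_mem_nhdsWithin] with u hu
        exact sub_lt_sub_right (mem_Ioi.1 hu) _
    have h3 : ∀ᶠ u in 𝓝[>] t, u < t + (T - (t - k * T)) :=
      (gt_mem_nhds (by linarith [hk.2])).filter_mono nhdsWithin_le_nhds
    filter_upwards [h2.eventually h1, h3, self_mem_nhdsWithin] with u hu hu1 hu2
    have hu2' : t < u := hu2
    rwa [periodicCurve_of_mem γ hT k ⟨by linarith [hk.1], by linarith⟩]

lemma IsPiece.isPeriodicSolution {T : ℝ} (h : S.IsPiece γ T) (he : γ T = γ 0)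
    (hne : ∃ t ∈ Ico 0 T, γ t ≠ γ 0) : S.IsPeriodicSolution (periodicCurve γ T) T := by
  refine ⟨h.1, h.isSolutionOn_periodicCurve he, periodic_periodicCurve γ h.1, ?_⟩
  obtain ⟨t, ht, hne⟩ := hne
  exact ⟨t, by rwa [periodicCurve_eq γ h.1 ht, periodicCurve_eq γ h.1 ⟨le_rfl, h.1⟩]⟩

lemma IsArc.isPiece (h : S.IsArc s γ 0 τ) (h0 : γ 0 ∉ S.slidingInterior) : S.IsPiece γ τ := by
  refine ⟨h.1, h.2.1, ?_, ?_⟩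
  · convert finite_empty
    rw [eq_empty_iff_forall_notMem]
    rintro t ⟨ht, hr⟩
    exact hr (Or.inl ⟨s, h.2.2 t ht⟩)
  · intro t ht hi
    exfalso
    rcases ht.1.eq_or_lt with e | e
    · exact h0 (e ▸ hi)
    · exact Side.notMem_switchingLine (h.2.2 t ⟨e, ht.2⟩).1 hi.1

namespace ReturnMap

variable (R : ReturnMap S)

/-- The curve that runs through `orb s u` in one turn. -/
noncomputable def turn (s : Side) (u : ℝ) : ℝ → Fin 2 → ℝ :=
  concatCurve ((R.H s).flow u) ((R.H s).τ u) ((R.H s.opp).flow (R.h s u))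

/-- The time of one turn. -/
def turnTime (s : Side) (u : ℝ) : ℝ := (R.H s).τ u + (R.H s.opp).τ (R.h s u)

variable {R} {u : ℝ}

lemma flow_τ_eq (hu : u ∈ (R.H s).dom) :
    (R.H s).flow u ((R.H s).τ u) = (R.H s.opp).flow (R.h s u) 0 := by
  rw [(R.H s).flow_τ u hu, (R.H s.opp).flow_zero]
  rfl

/-- Strict inequalities keep both points of the line out of the sliding interior, where the solution
would have to slide. -/
lemma isPiece_turn (hu : R.p s < u) (hv : R.p s.opp < R.h s u) :
    S.IsPiece (R.turn s u) (R.turnTime s u) := by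
  have hu' := (R.H s).mem_dom _ hu
  have hv' := (R.H s.opp).mem_dom _ hv
  refine IsPiece.concat (((R.H s).isArc_flow hu').isPiece ?_)
    (((R.H s.opp).isArc_flow hv').isPiece ?_) (flow_τ_eq hu')
  · rw [(R.H s).flow_zero]
    refine R.notMem_slidingInterior (s := s) ?_
    change R.p s < R.crd s (R.pt s u)
    rwa [crd_pt]
  · rw [(R.H s.opp).flow_zero]
    refine R.notMem_slidingInterior (s := s.opp) ?_
    change R.p s.opp < R.crd s.opp (R.pt s.opp _)
    rwa [crd_pt]

lemma turn_zero (hu : R.p s < u) : R.turn s u 0 = R.pt s u := by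
  rw [turn, concatCurve_of_le ((R.H s).τ_pos _ ((R.H s).mem_dom _ hu)).le, (R.H s).flow_zero]
  rfl

lemma turn_turnTime (hu : R.p s < u) (hv : R.p s.opp < R.h s u) :
    R.turn s u (R.turnTime s u) = R.pt s (R.h s.opp (R.h s u)) := by
  have hu' := (R.H s).mem_dom _ hu
  have hv' := (R.H s.opp).mem_dom _ hv
  have h1 := (R.H s.opp).τ_pos _ hv'
  rw [turn, concatCurve_of_ge (flow_τ_eq hu') (by rw [turnTime]; linarith), turnTime,
    add_sub_cancel_left, (R.H s.opp).flow_τ _ hv', Side.opp_opp]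
  rfl

lemma turn_image (hu : R.p s < u) (hv : R.p s.opp < R.h s u) :
    R.turn s u '' Icc 0 (R.turnTime s u) = R.orb s u := by
  have hu' := (R.H s).mem_dom _ hu
  have h1 := (R.H s).τ_pos _ hu'
  have h2 := (R.H s.opp).τ_pos _ ((R.H s.opp).mem_dom _ hv)
  have he := flow_τ_eq hu'
  ext z
  constructor
  · rintro ⟨t, ht, rfl⟩
    rcases le_total t ((R.H s).τ u) with h | h
    · exact Or.inl ⟨t, ⟨ht.1, h⟩, (concatCurve_of_le h).symm⟩
    · refine Or.inr ⟨t - (R.H s).τ u, ⟨by linarith, ?_⟩, (concatCurve_of_ge he h).symm⟩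
      have := ht.2
      rw [turnTime] at this
      linarith
  · rintro (⟨t, ht, rfl⟩ | ⟨t, ht, rfl⟩)
    · exact ⟨t, ⟨ht.1, by rw [turnTime]; linarith [ht.2]⟩, concatCurve_of_le ht.2⟩
    · refine ⟨t + (R.H s).τ u, ⟨by linarith [ht.1], by rw [turnTime]; linarith [ht.2]⟩, ?_⟩
      rw [turn, concatCurve_of_ge he (by linarith [ht.1]), add_sub_cancel_right]

/-- A fixed point of the return map beyond the tangencies gives a crossing periodic orbit. -/
theorem isCrossingPeriodicOrbit_orb (hu : R.p s < u) (hv : R.p s.opp < R.h s u)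
    (hfix : R.h s.opp (R.h s u) = u) : S.IsCrossingPeriodicOrbit (R.orb s u) := by
  have hp := isPiece_turn hu hv
  have hT := hp.1
  have hu' := (R.H s).mem_dom _ hu
  have hv' := (R.H s.opp).mem_dom _ hv
  have h1 := (R.H s).τ_pos _ hu'
  have h2 : 0 < (R.H s.opp).τ (R.h s u) := (R.H s.opp).τ_pos _ hv'
  have he : R.turn s u (R.turnTime s u) = R.turn s u 0 := by
    rw [turn_turnTime hu hv, turn_zero hu, hfix]
  have hin : ∀ t ∈ Ioo 0 ((R.H s).τ u), R.turn s u t ∈ s.region := fun t ht => by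
    rw [turn, concatCurve_of_le ht.2.le]
    exact (R.H s).region u hu' t ht
  have hin' : ∀ t ∈ Ioo ((R.H s).τ u) (R.turnTime s u), R.turn s u t ∈ s.opp.region := fun t ht => by
    rw [turn, concatCurve_of_ge (flow_τ_eq hu') ht.1.le]
    have := ht.2
    rw [turnTime] at this
    exact (R.H s.opp).region _ hv' _ ⟨by linarith [ht.1], by linarith⟩
  refine ⟨periodicCurve (R.turn s u) (R.turnTime s u), R.turnTime s u,
    hp.isPeriodicSolution he ?_, ?_, ⟨0, ⟨le_rfl, hT⟩, ?_⟩, ?_⟩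
  · refine ⟨(R.H s).τ u / 2, ⟨by linarith, by rw [turnTime]; linarith⟩, fun e => ?_⟩
    have h3 := hin ((R.H s).τ u / 2) ⟨by linarith, by linarith⟩
    rw [e, turn_zero hu] at h3
    exact Side.notMem_switchingLine h3 (R.pt_mem s u)
  · rw [range_periodicCurve hT he, turn_image hu hv]
  · rw [periodicCurve_eq _ hT ⟨le_rfl, hT⟩, turn_zero hu]
    exact R.pt_mem s u
  · refine ((finite_singleton ((R.H s).τ u)).union (finite_singleton 0)).subset ?_
    rintro t ⟨ht, hts⟩
    rw [periodicCurve_eq _ hT ht] at hts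
    rcases lt_trichotomy t ((R.H s).τ u) with h | h | h
    · rcases ht.1.eq_or_lt with e | e
      · exact Or.inr e.symm
      · exact absurd hts (Side.notMem_switchingLine (hin t ⟨e, h⟩))
    · exact Or.inl h
    · exact absurd hts (Side.notMem_switchingLine (hin' t ⟨h, ht.2⟩))

lemma arc_inter_switchingLine (hu : u ∈ (R.H s).dom) :
    R.arc s u ∩ switchingLine ⊆ {R.pt s u, R.pt s.opp (R.h s u)} := by
  rintro _ ⟨⟨t, ht, rfl⟩, hts⟩
  rcases ht.1.eq_or_lt with e | e
  · left
    rw [← e, (R.H s).flow_zero]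
    rfl
  · rcases ht.2.lt_or_eq with e' | e'
    · exact absurd hts (Side.notMem_switchingLine ((R.H s).region u hu t ⟨e, e'⟩))
    · right
      rw [mem_singleton_iff, e', (R.H s).flow_τ u hu]
      rfl

/-- A closed turn meets the line in at most two points, one beyond each tangency; this separates
different orbits and keeps them away from the sliding region. -/
lemma orb_inter_switchingLine (hu : R.p s < u) (hv : R.p s.opp < R.h s u)
    (hfix : R.h s.opp (R.h s u) = u) :
    R.orb s u ∩ switchingLine ⊆ {R.pt s u, R.pt s.opp (R.h s u)} := by
  rintro z ⟨hz | hz, hzs⟩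
  · exact arc_inter_switchingLine ((R.H s).mem_dom _ hu) ⟨hz, hzs⟩
  · have := arc_inter_switchingLine ((R.H s.opp).mem_dom _ hv) ⟨hz, hzs⟩
    change z = R.pt s.opp (R.h s u) ∨ z = R.pt s.opp.opp (R.h s.opp (R.h s u)) at this
    rw [hfix, Side.opp_opp] at this
    exact this.symm

end ReturnMap

end PWLSystem


/-! ### Exits from sliding segments; the case without crossing orbits -/

namespace PWLSystem

variable {S : PWLSystem} {s : Side} {γ : ℝ → Fin 2 → ℝ} {I : Set ℝ}

lemma vel_sub (S : PWLSystem) (s : Side) {z w : Fin 2 → ℝ} (hz : z ∈ switchingLine)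
    (hw : w ∈ switchingLine) : S.vel s w = S.vel s z + s.sgn * S.A s 0 1 * (w 1 - z 1) := by
  rw [vel_eq, vel_eq, mem_switchingLine.1 hz, mem_switchingLine.1 hw]
  ring

lemma exists_sign {a : ℝ} (ha : a ≠ 0) : ∃ ε : ℝ, ε * ε = 1 ∧ 0 < ε * a := by
  rcases lt_or_gt_of_ne ha with h | h
  · exact ⟨-1, by norm_num, by linarith⟩
  · exact ⟨1, by norm_num, by linarith⟩

lemma LoopsOn.isArc (hsol : S.IsSolutionOn γ univ) {a b : ℝ} (h : LoopsOn γ s a b) :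
    S.IsArc s γ a b :=
  hsol.isArc h.1 (subset_univ _) h.2.2.2

/-- A solution that slides and then enters the side `s` does so at a tangency of `s`. -/
lemma SlidesOn.vel_exit (hsol : S.IsSolutionOn γ univ) {a b c : ℝ} (h : S.SlidesOn γ a b)
    (hb : γ b ∈ switchingLine) (harc : S.IsArc s γ b c) :
    S.vel s (γ b) = 0 ∧ S.vel s.opp (γ b) < 0 := by
  have hcont : ContinuousAt γ b := hsol.1.continuousAt univ_mem
  -- The exit point is a limit of attractive points; entering `s` requires the reverse inequality
  -- for the velocity of `s`.
  have hle : ∀ s', S.vel s' (γ b) ≤ 0 := by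
    intro s'
    have h1 : Tendsto (fun t => S.vel s' (γ t)) (𝓝[<] b) (𝓝 (S.vel s' (γ b))) :=
      ((S.continuous_vel s').continuousAt.comp hcont).tendsto.mono_left nhdsWithin_le_nhds
    refine le_of_tendsto h1 ?_
    filter_upwards [Ioo_mem_nhdsLT h.1] with t ht
    exact ((mem_attractiveRegion s').1 (h.2 t ⟨ht.1.le, ht.2⟩)).2.1.le
  have h0 : S.vel s (γ b) = 0 := (hle s).antisymm (harc.vel_start_nonneg hb)
  refine ⟨h0, lt_of_le_of_ne (hle _) fun h1 => ?_⟩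
  have ha := (mem_attractiveRegion s).1 (h.2 a ⟨le_rfl, h.1⟩)
  -- If both velocities vanished at the exit, they would be multiples of the same linear function
  -- along the line, with factors of equal sign because both are negative at `γ a`. The whole line
  -- would be sliding, and the solution could not leave it.
  have hmem : γ b ∈ S.slidingInterior := by
    refine ⟨hb, ?_⟩
    filter_upwards [self_mem_nhdsWithin] with w hw
    refine (mem_slidingRegion s).2 ⟨hw, ?_⟩
    have e1 := S.vel_sub s hb ha.1
    have e2 := S.vel_sub s.opp hb ha.1
    rw [S.vel_sub s hb hw, S.vel_sub s.opp hb hw, h0, h1, zero_add, zero_add]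
    rw [h0, zero_add] at e1
    rw [h1, zero_add] at e2
    set α := s.sgn * S.A s 0 1
    set β := s.opp.sgn * S.A s.opp 0 1
    have h3 : 0 < (α * (γ a 1 - γ b 1)) * (β * (γ a 1 - γ b 1)) :=
      mul_pos_of_neg_of_neg (e1 ▸ ha.2.1) (e2 ▸ ha.2.2)
    have h4 : 0 < α * β := by
      by_contra hcon
      push Not at hcon
      nlinarith [mul_nonneg_of_nonpos_of_nonpos hcon (neg_nonpos.2 (sq_nonneg (γ a 1 - γ b 1)))]
    have : α * (w 1 - γ b 1) * (β * (w 1 - γ b 1)) = α * β * (w 1 - γ b 1) ^ 2 := by ring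
    rw [this]
    positivity
  have h2 := hsol.2.2 b trivial hmem
  obtain ⟨t, ht1, ht2⟩ := (h2.and (Ioo_mem_nhdsGT harc.1)).exists
  exact Side.notMem_switchingLine (harc.2.2 t ht2).1 ht1

/-- An orbit around an unstable focus comes back to the switching line transversally. -/
lemma IsArc.vel_end_neg (hv : S.VisibleUnstable s) {a b : ℝ} (h : S.IsArc s γ a b)
    (ha : γ a ∈ switchingLine) (hb : γ b ∈ switchingLine) : S.vel s (γ b) < 0 := by
  obtain ⟨ε, hε, hA⟩ := exists_sign (A_ne_zero_of_disc hv.2.1)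
  set H := focusHalf hv hε hA
  have h1 := H.arc_end_crd hε h ha hb
  have h2 := H.neg_lt _ (H.crd_start_mem hε h ha)
  rw [Side.crd_opp] at h1
  rw [H.vel_eq _ hb]
  exact mul_neg_of_pos_of_neg H.m_pos (by linarith)

/-- The tangency where a sliding periodic orbit of type A leaves the switching line, and its
arc. -/
lemma IsTypeA.exists_arc {Γ : Set (Fin 2 → ℝ)} (h : S.IsTypeA s Γ) :
    ∃ γ a b, S.IsArc s γ a b ∧ γ a ∈ switchingLine ∧ S.vel s (γ a) = 0 ∧ S.vel s.opp (γ a) < 0 ∧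
      γ b ∈ S.attractiveRegion := by
  obtain ⟨γ, T, ⟨hT, hsol, hper, -⟩, -, t₁, hsl, hloop⟩ := h
  have harc := hloop.isArc hsol
  obtain ⟨h1, h2⟩ := hsl.vel_exit hsol hloop.2.1 harc
  refine ⟨γ, t₁, T, harc, hloop.2.1, h1, h2, ?_⟩
  have : γ T = γ 0 := by simpa using hper 0
  rw [this]
  exact hsl.2 0 ⟨le_rfl, hsl.1⟩

/-- The focus on side `s` is unstable and the one on the opposite side becomes unstable in reversed
time. No arc of a crossing orbit fits in `s`, and two successive arcs in the opposite side disagree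
about the sign of the normal velocity at their common point. -/
theorem not_crossing_of_pairA (h : S.HasPairA) (Γ : Set (Fin 2 → ℝ)) :
    ¬ S.IsCrossingPeriodicOrbit Γ := by
  obtain ⟨s, Γ₁, Γ₂, hA1, hA2⟩ := h
  obtain ⟨c, a, b, hc, hca, hv0, hv1, hcb⟩ := hA1.exists_arc
  obtain ⟨c', a', b', hc', hca', hv0', hv1', hcb'⟩ := hA2.exists_arc
  have hvis : S.VisibleUnstable s :=
    hc.visibleUnstable hca hv0 hcb.1 ((mem_attractiveRegion s).1 hcb).2.1
  have hvis' : S.reverse.VisibleUnstable s.opp :=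
    hc'.visibleUnstable hca' hv0' hcb'.1 ((mem_attractiveRegion s.opp).1 hcb').2.1
  rw [reverse_vel, neg_eq_zero] at hv0'
  rw [reverse_vel, Side.opp_opp, neg_lt_zero] at hv1'
  -- Along the line both velocities are affine. At the tangency of `s` the other velocity is
  -- negative, and at the tangency of the other side the velocity of `s` is positive. So both grow
  -- in the same direction, and before its zero the velocity of `s` has a negative companion.
  have key : ∀ w ∈ switchingLine, S.vel s w < 0 → S.vel s.opp w < 0 := by
    intro w hw hlt
    rw [S.vel_sub s hca hw, hv0, zero_add] at hlt
    rw [S.vel_sub s.opp hca hw]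
    rw [S.vel_sub s hca hca', hv0, zero_add] at hv1'
    rw [S.vel_sub s.opp hca hca'] at hv0'
    set α := s.sgn * S.A s 0 1
    set β := s.opp.sgn * S.A s.opp 0 1
    set d := c' a' 1 - c a 1
    set e := w 1 - c a 1
    have hβ : 0 < β * d := by linarith
    have h1 : (α * e) * (α * d) < 0 := mul_neg_of_neg_of_pos hlt hv1'
    have h2 : e * d < 0 := by
      by_contra hcon
      push Not at hcon
      nlinarith [mul_nonneg hcon (sq_nonneg α)]
    have h3 : β * e < 0 := by
      by_contra hcon
      push Not at hcon
      nlinarith [mul_nonneg hcon hβ.le, mul_self_nonneg β, mul_pos_of_neg_of_neg h2 h2,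
        sq_nonneg (β * e), mul_nonneg (mul_self_nonneg β) (neg_nonneg.2 h2.le),
        mul_pos hβ hβ, sq_nonneg (β)]
    linarith
  rintro ⟨γ, T, ⟨hT, hsol, hper, -⟩, rfl, ⟨t₀, ht₀⟩, hfin⟩
  have hK := finite_times_of_periodic hT hper hfin
  have hcont : Continuous γ := continuousOn_univ.1 hsol.1
  have hNI := hsol.notMem_slidingInterior hK
  have hnext : ∀ t, γ t ∈ switchingLine → ∃ t', S.IsArc s.opp γ t t' ∧ γ t' ∈ switchingLine := by
    intro t ht
    obtain ⟨t', h1, -, h3, h4⟩ := exists_next_time_of_finite hcont hK (a := t) (b := t + T)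
      (by linarith) (by rw [hper]; exact ht)
    obtain ⟨s', hs'⟩ := hsol.exists_isArc h1 (subset_univ _) h4
    rcases s.eq_or_eq_opp s' with e | e
    · exfalso
      subst e
      have h5 := hs'.vel_end_neg hvis ht h3
      exact hNI t' (mem_slidingInterior_of_neg h3 h5 (key _ h3 h5))
    · subst e
      exact ⟨t', hs', h3⟩
  obtain ⟨t₁, harc₁, h1⟩ := hnext t₀ ht₀.2
  obtain ⟨t₂, harc₂, h2⟩ := hnext t₁ h1
  -- At `γ t₁` one arc ends, so the velocity is nonpositive; another starts there, and the stable
  -- focus read backward makes it positive.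
  have h3 := harc₁.vel_end_nonpos h1
  have h4 := harc₂.reverse.vel_end_neg hvis' (by simpa using h2) (by simpa using h1)
  simp only [neg_neg, reverse_vel] at h4
  linarith

end PWLSystem


/-! ### Growth and duration of focus arcs; spirals and equilibria -/

namespace PWLSystem

variable {S : PWLSystem} {s : Side} {ε : ℝ}

section focusHalf

variable (h : S.VisibleUnstable s) (hε : ε * ε = 1) (hA : 0 < ε * S.A s 0 1)

lemma focusHalf_h : ∃ p ρ : ℝ, p = (focusHalf h hε hA).p ∧ 0 < ρ ∧
    (focusHalf h hε hA).h = fun u => -p + ρ * focusMap (S.gam s) ((u - p) / ρ) := by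
  refine ⟨_, S.nst s * S.om s / (ε * S.A s 0 1), rfl, ?_, rfl⟩
  have := om_pos h.2.1
  have := nst_pos h
  positivity

lemma continuous_focusHalf : Continuous (focusHalf h hε hA).h := by
  obtain ⟨p, ρ, -, -, he⟩ := focusHalf_h h hε hA
  rw [he]
  have := continuous_focusMap (S.gam s)
  fun_prop

lemma monotone_focusHalf : Monotone (focusHalf h hε hA).h := by
  obtain ⟨p, ρ, -, hρ, he⟩ := focusHalf_h h hε hA
  rw [he]
  intro a b hab
  have := monotone_focusMap (S.gam s) (show (a - p) / ρ ≤ (b - p) / ρ by gcongr)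
  simp only
  gcongr

lemma convexOn_focusHalf : ConvexOn ℝ univ (focusHalf h hε hA).h := by
  obtain ⟨p, ρ, -, hρ, he⟩ := focusHalf_h h hε hA
  rw [he]
  refine ⟨convex_univ, fun x _ y _ a b ha hb hab => ?_⟩
  have h1 := (convexOn_focusMap (gam_pos h)).2 (mem_univ ((x - p) / ρ)) (mem_univ ((y - p) / ρ))
    ha hb hab
  have e : (a • x + b • y - p) / ρ = a • ((x - p) / ρ) + b • ((y - p) / ρ) := by
    simp only [smul_eq_mul]
    field_simp
    linear_combination p * hab
  simp only
  rw [e]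
  have h2 := mul_le_mul_of_nonneg_left h1 hρ.le
  simp only [smul_eq_mul] at h2 ⊢
  linear_combination h2 + p * hab

/-- The factor is the exponential growth of the normalized map over half a turn, `k = exp (πg)`. -/
lemma le_focusHalf : ∃ k : ℝ, 1 < k ∧ ∀ u, (focusHalf h hε hA).p ≤ u →
    -(focusHalf h hε hA).p + k * (u - (focusHalf h hε hA).p) ≤ (focusHalf h hε hA).h u := by
  obtain ⟨p, ρ, hp, hρ, he⟩ := focusHalf_h h hε hA
  have hg := gam_pos h
  refine ⟨Real.exp (Real.pi * S.gam s), Real.one_lt_exp_iff.2 (by positivity), fun u hu => ?_⟩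
  rw [he, ← hp]
  rw [← hp] at hu
  have h1 := mul_lt_mul_of_pos_left
    (exp_mul_lt_focusMap hg (div_nonneg (sub_nonneg.2 hu) hρ.le)) hρ
  have e : ρ * (Real.exp (Real.pi * S.gam s) * ((u - p) / ρ)) =
      Real.exp (Real.pi * S.gam s) * (u - p) := by field_simp
  rw [e] at h1
  simp only
  linarith

/-- An arc takes at least half a turn, since the normalized orbit is positive up to the angle `π`. A
uniform bound lets infinitely many arcs fill all positive times. -/
lemma le_focusHalf_τ : ∃ δ : ℝ, 0 < δ ∧ ∀ u ∈ (focusHalf h hε hA).dom,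
    δ ≤ (focusHalf h hε hA).τ u := by
  have ho := om_pos h.2.1
  refine ⟨Real.pi / S.om s, by positivity, fun u hu => ?_⟩
  have hF := (focusHalf h hε hA).flow_τ u hu
  have hd : (focusHalf h hε hA).dom = Ici (focusHalf h hε hA).p := rfl
  rw [hd] at hu
  by_contra hcon
  push Not at hcon
  have hτ := (focusHalf h hε hA).τ_pos u hu
  obtain ⟨ξ, hξ, hfl⟩ : ∃ ξ : ℝ, 0 ≤ ξ ∧ (focusHalf h hε hA).flow u = S.focusFlow s ξ := by
    refine ⟨(u - (focusHalf h hε hA).p) / (S.nst s * S.om s / (ε * S.A s 0 1)), ?_, rfl⟩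
    have := nst_pos h
    exact div_nonneg (sub_nonneg.2 hu) (by positivity)
  rw [lt_div_iff₀ ho] at hcon
  have h1 := focusOrbit_pos_of_le_pi (S.gam s) hξ (mul_pos ho hτ) (by linarith)
  have h2 : s.sgn * (focusHalf h hε hA).flow u ((focusHalf h hε hA).τ u) 0 = 0 := by
    rw [hF, mem_switchingLine.1 (Side.pt_mem _ _ _), mul_zero]
  rw [hfl, focusFlow, sgn_mul_lift] at h2
  have := mul_pos (nst_pos h) h1
  linarith

end focusHalf

/-- The orbit of a focus through an arbitrary point. -/
noncomputable def spiral (S : PWLSystem) (s : Side) (z : Fin 2 → ℝ) : ℝ → Fin 2 → ℝ :=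
  let σ := S.tr s / 2
  let w := s.sgn * z 0 - S.nst s
  let k := (S.vel s z - σ * w) / S.om s
  S.lift s
    (fun t => S.nst s + Real.exp (σ * t) * (w * Real.cos (S.om s * t) + k * Real.sin (S.om s * t)))
    (fun t => Real.exp (σ * t) * ((σ * w + k * S.om s) * Real.cos (S.om s * t) +
      (σ * k - w * S.om s) * Real.sin (S.om s * t)))

lemma isFlow_spiral (h : S.tr s ^ 2 < 4 * S.dt s) (z : Fin 2 → ℝ) : S.IsFlow s (S.spiral s z) := by
  have hsq := om_sq h
  have hd := dt_pos h
  have hn : S.nst s * S.dt s = S.kap s := by rw [nst, div_mul_cancel₀ _ hd.ne']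
  have hid : ∀ t, HasDerivAt (fun t => S.om s * t) (S.om s) t := fun t => by
    simpa using (hasDerivAt_id t).const_mul (S.om s)
  have hcos := fun t => (Real.hasDerivAt_cos (S.om s * t)).comp t (hid t)
  have hsin := fun t => (Real.hasDerivAt_sin (S.om s * t)).comp t (hid t)
  refine isFlow_lift (A_ne_zero_of_disc h) (fun t => ?_) fun t => ?_
  · refine (((hasDerivAt_exp_mul _ t).mul (((hcos t).const_mul _).add
      ((hsin t).const_mul _))).const_add _).congr_deriv ?_
    simp only [Pi.add_apply, Function.comp]
    ring
  · refine ((hasDerivAt_exp_mul _ t).mul (((hcos t).const_mul _).add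
      ((hsin t).const_mul _))).congr_deriv ?_
    simp only [Pi.add_apply, Function.comp]
    rw [← hn]
    have e : S.dt s = S.om s ^ 2 + (S.tr s / 2) ^ 2 := by rw [hsq]; ring
    rw [e]
    ring

lemma spiral_zero (h : S.tr s ^ 2 < 4 * S.dt s) (z : Fin 2 → ℝ) : S.spiral s z 0 = z := by
  have ho := om_pos h
  refine eq_of_vel_eq (s := s) (A_ne_zero_of_disc h) ?_ ?_
  · have : s.sgn * S.spiral s z 0 0 = s.sgn * z 0 := by
      rw [spiral, sgn_mul_lift]; simp
    exact mul_left_cancel₀ s.sgn_ne_zero this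
  · rw [spiral, vel_lift (A_ne_zero_of_disc h)]
    simp only [mul_zero, Real.exp_zero, Real.cos_zero, Real.sin_zero]
    field_simp
    ring

/-- The equilibrium of a focus. -/
noncomputable def equil (S : PWLSystem) (s : Side) : Fin 2 → ℝ :=
  S.lift s (fun _ => S.nst s) (fun _ => 0) 0

lemma equil_mem (h : S.VisibleUnstable s) : S.equil s ∈ s.region := by
  rw [Side.mem_region, equil, sgn_mul_lift]
  exact nst_pos h

lemma isFlow_equil (h : S.VisibleUnstable s) : S.IsFlow s (fun _ => S.equil s) := by
  have hd := dt_pos h.2.1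
  have hn : S.nst s * S.dt s = S.kap s := by rw [nst, div_mul_cancel₀ _ hd.ne']
  have := isFlow_lift (S := S) (s := s) (n := fun _ => S.nst s) (N := fun _ => 0)
    (A_ne_zero_of_disc h.2.1) (fun t => hasDerivAt_const _ _)
    (fun t => (hasDerivAt_const _ _).congr_deriv (by rw [← hn]; ring))
  exact this

/-- Every orbit of an unstable focus but the equilibrium leaves the half plane. -/
lemma eq_equil_of_forall_mem_region (h : S.VisibleUnstable s) {φ : ℝ → Fin 2 → ℝ}
    (hφ : S.IsFlow s φ) (hr : ∀ t, 0 ≤ t → φ t ∈ s.region) : φ 0 = S.equil s := by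
  have ho := om_pos h.2.1
  have hn := nst_pos h
  have hA := A_ne_zero_of_disc h.2.1
  set z := φ 0 with hz
  have hsp : ∀ t, φ t = S.spiral s z t := by
    intro t
    have := hφ.unique (isFlow_spiral h.2.1 z) (t₀ := 0) (t₁ := 0) (by rw [spiral_zero h.2.1]) t
    simpa using this
  set σ := S.tr s / 2 with hσ
  have hσ0 : 0 < σ := by have := h.1; positivity
  set w := s.sgn * z 0 - S.nst s with hw
  set k := (S.vel s z - σ * w) / S.om s with hk
  set f : ℝ → ℝ := fun t => Real.exp (σ * t) *
    (w * Real.cos (S.om s * t) + k * Real.sin (S.om s * t)) with hf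
  have hpos : ∀ t, 0 ≤ t → -S.nst s < f t := by
    intro t ht
    have h1 := Side.mem_region.1 (hr t ht)
    rw [hsp t, spiral, sgn_mul_lift] at h1
    simp only [hf]
    linarith
  set K := Real.exp (σ * (Real.pi / S.om s)) with hK
  have hK1 : 1 < K := Real.one_lt_exp_iff.2 (by positivity)
  -- Half a turn reverses the deviation from the equilibrium and enlarges it by `K > 1`.
  have hstep : ∀ t, f (t + Real.pi / S.om s) = -K * f t := by
    intro t
    simp only [hf, hK]
    have e : S.om s * (t + Real.pi / S.om s) = S.om s * t + Real.pi := by field_simp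
    rw [e, Real.cos_add_pi, Real.sin_add_pi, mul_add σ, Real.exp_add]
    ring
  have hpow : ∀ t, ∀ n : ℕ, f (t + n * (Real.pi / S.om s)) = (-K) ^ n * f t := by
    intro t n
    induction n with
    | zero => simp
    | succ n ih =>
      have : t + (n + 1 : ℕ) * (Real.pi / S.om s) =
          (t + n * (Real.pi / S.om s)) + Real.pi / S.om s := by push_cast; ring
      rw [this, hstep, ih]
      ring
  -- After sufficiently many half turns a nonzero deviation exceeds the distance `nst` in size; one
  -- of an even and an odd number of half turns gives it the sign that points across the line.
  have hzero : ∀ t, 0 ≤ t → f t = 0 := by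
    intro t ht
    by_contra hne
    have habs : 0 < |f t| := abs_pos.2 hne
    obtain ⟨n, hn'⟩ := pow_unbounded_of_one_lt (S.nst s / |f t|) hK1
    rw [div_lt_iff₀ habs] at hn'
    have hge : ∀ m : ℕ, n ≤ m → S.nst s < K ^ m * |f t| := fun m hm =>
      hn'.trans_le (by gcongr; exact hK1.le)
    have h1 : ∀ m : ℕ, -S.nst s < (-K) ^ m * f t := fun m => by
      rw [← hpow]; exact hpos _ (by positivity)
    have h2 := h1 (2 * n)
    have h3 := h1 (2 * n + 1)
    have h4 := hge (2 * n) (by omega)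
    have h5 := hge (2 * n + 1) (by omega)
    rw [Even.neg_pow ⟨n, by ring⟩] at h2
    rw [Odd.neg_pow ⟨n, rfl⟩] at h3
    rcases abs_choice (f t) with e | e <;> rw [e] at h4 h5 <;> linarith
  have hw0 : w = 0 := by
    have := hzero 0 le_rfl
    simpa [hf] using this
  -- A quarter turn isolates the sine coefficient.
  have hk0 : k = 0 := by
    have := hzero (Real.pi / 2 / S.om s) (by positivity)
    have e : S.om s * (Real.pi / 2 / S.om s) = Real.pi / 2 := by field_simp
    simp only [hf, e, Real.cos_pi_div_two, Real.sin_pi_div_two] at this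
    have h2 := (Real.exp_pos (σ * (Real.pi / 2 / S.om s))).ne'
    have h3 := (mul_eq_zero.1 this).resolve_left h2
    linarith
  refine eq_of_vel_eq (s := s) hA ?_ ?_
  · have : s.sgn * z 0 = s.sgn * S.equil s 0 := by
      rw [equil, sgn_mul_lift]; linarith
    exact mul_left_cancel₀ s.sgn_ne_zero this
  · rw [equil, vel_lift hA]
    have h1 : k * S.om s = S.vel s z - σ * w := by rw [hk, div_mul_cancel₀ _ ho.ne']
    rw [hk0, hw0] at h1
    linarith

end PWLSystem


/-! ### Repelling fixed points of convex maps; solutions made of infinitely many pieces -/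

/-- A convex self-map of the line that starts below the diagonal and ends above it has exactly one
fixed point in between, and it is repelling. -/
lemma exists_repelling_fixedPoint {φ : ℝ → ℝ} (hconv : ConvexOn ℝ univ φ) (hcont : Continuous φ)
    {u₁ w : ℝ} (h1 : φ u₁ < u₁) (hw : u₁ < w) (hφw : w < φ w) :
    ∃ u c : ℝ, u₁ < u ∧ φ u = u ∧ 1 < c ∧ (∀ x, u ≤ x → c * (x - u) ≤ φ x - u) ∧
      ∀ x, u₁ ≤ x → x ≤ u → c * (u - x) ≤ u - φ x := by
  obtain ⟨u, hu, hfu⟩ := intermediate_value_Icc (f := fun x => φ x - x) hw.le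
    (hcont.sub continuous_id).continuousOn (show (0 : ℝ) ∈ Icc _ _ from ⟨by linarith, by linarith⟩)
  have hfix : φ u = u := by simpa [sub_eq_zero] using hfu
  have hlt : u₁ < u := lt_of_le_of_ne hu.1 fun e => by rw [← e] at hfix; linarith
  -- Secant slopes of a convex function at `u` increase, so all of them from `u₁` on are at least
  -- the slope over `[u₁, u]`. That slope exceeds one because the graph starts below the diagonal.
  have hsec : ∀ x, u₁ ≤ x → x ≠ u → (φ u₁ - u) / (u₁ - u) ≤ (φ x - u) / (x - u) := by
    intro x hx hxu
    have := hconv.secant_mono (mem_univ u) (mem_univ u₁) (mem_univ x) hlt.ne hxu hx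
    rwa [hfix] at this
  refine ⟨u, (φ u₁ - u) / (u₁ - u), hlt, hfix, ?_, ?_, ?_⟩
  · rw [lt_div_iff_of_neg (by linarith)]
    linarith
  · intro x hx
    rcases hx.eq_or_lt with rfl | hx
    · simp [hfix]
    · have := hsec x (hlt.trans hx).le hx.ne'
      rwa [le_div_iff₀ (by linarith)] at this
  · intro x hx1 hx2
    rcases hx2.eq_or_lt with rfl | hx2
    · simp [hfix]
    · have := hsec x hx1 hx2.ne
      rw [le_div_iff_of_neg (by linarith)] at this
      linarith

namespace PWLSystem

variable {S : PWLSystem} {c : ℕ → ℝ → Fin 2 → ℝ} {τ : ℕ → ℝ}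

/-- The concatenation of the first curves of a sequence. -/
noncomputable def concatSeq (c : ℕ → ℝ → Fin 2 → ℝ) (τ : ℕ → ℝ) : ℕ → ℝ → Fin 2 → ℝ
  | 0 => c 0
  | n + 1 => concatCurve (concatSeq c τ n) (∑ i ∈ Finset.range (n + 1), τ i) (c (n + 1))

lemma concatSeq_end (hτ : ∀ n, 0 < τ n) (he : ∀ n, c n (τ n) = c (n + 1) 0) (n : ℕ) :
    concatSeq c τ n (∑ i ∈ Finset.range (n + 1), τ i) = c (n + 1) 0 := by
  induction n with
  | zero => simp [concatSeq, he]
  | succ n ih =>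
    rw [Finset.sum_range_succ, concatSeq, concatCurve_of_ge ih (by linarith [hτ (n + 1)]),
      add_sub_cancel_left, he]

lemma isPiece_concatSeq (hp : ∀ n, S.IsPiece (c n) (τ n)) (he : ∀ n, c n (τ n) = c (n + 1) 0)
    (n : ℕ) : S.IsPiece (concatSeq c τ n) (∑ i ∈ Finset.range (n + 1), τ i) := by
  induction n with
  | zero => simpa [concatSeq] using hp 0
  | succ n ih =>
    rw [Finset.sum_range_succ, concatSeq]
    exact ih.concat (hp (n + 1)) (concatSeq_end (fun n => (hp n).1) he n)

lemma concatSeq_eq_of_le (hτ : ∀ n, 0 < τ n) {n m : ℕ} (hnm : n ≤ m) {t : ℝ}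
    (ht : t ≤ ∑ i ∈ Finset.range (n + 1), τ i) : concatSeq c τ m t = concatSeq c τ n t := by
  induction m, hnm using Nat.le_induction with
  | base => rfl
  | succ m hm ih =>
    rw [concatSeq, concatCurve_of_le, ih]
    refine ht.trans (Finset.sum_le_sum_of_subset_of_nonneg ?_ fun i _ _ => (hτ i).le)
    exact Finset.range_mono (by omega)

/-- Infinitely many pieces of a solution, of durations bounded below, form a solution for all
positive times. -/
lemma exists_solution_of_pieces (hp : ∀ n, S.IsPiece (c n) (τ n))
    (he : ∀ n, c n (τ n) = c (n + 1) 0) {δ : ℝ} (hδ : 0 < δ) (hδτ : ∀ n, δ ≤ τ n) :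
    ∃ γ, S.IsSolutionOn γ (Ici 0) ∧ γ 0 = c 0 0 := by
  have hτ : ∀ n, 0 < τ n := fun n => (hp n).1
  set t : ℕ → ℝ := fun n => ∑ i ∈ Finset.range (n + 1), τ i with ht
  have htn : ∀ n : ℕ, (n + 1) * δ ≤ t n := by
    intro n
    have := Finset.card_nsmul_le_sum (Finset.range (n + 1)) τ δ fun i _ => hδτ i
    simpa using this
  -- Each piece lasts at least `δ`, so the pieces with indices up to `⌈x / δ⌉₊` cover the time `x`;
  -- using more of them does not change the value.
  set γ : ℝ → Fin 2 → ℝ := fun x => concatSeq c τ ⌈x / δ⌉₊ x with hγ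
  have hle : ∀ x : ℝ, x < t ⌈x / δ⌉₊ := by
    intro x
    have h1 := Nat.le_ceil (x / δ)
    rw [div_le_iff₀ hδ] at h1
    have := htn ⌈x / δ⌉₊
    linarith
  have heq : ∀ n x, x ≤ t n → γ x = concatSeq c τ n x := by
    intro n x hx
    rcases le_total n ⌈x / δ⌉₊ with h | h
    · exact concatSeq_eq_of_le hτ h hx
    · exact (concatSeq_eq_of_le hτ h (hle x).le).symm
  have hpn := isPiece_concatSeq hp he
  have hev : ∀ n x, x < t n → γ =ᶠ[𝓝 x] concatSeq c τ n := by
    intro n x hx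
    filter_upwards [gt_mem_nhds hx] with y hy
    exact heq n y (le_of_lt hy)
  refine ⟨γ, isSolutionOn_iff.2 ⟨?_, ⟨{x | 0 < x ∧ ¬ S.Regular γ x}, fun a b => ?_, ?_⟩, ?_⟩, ?_⟩
  · intro x hx
    have h1 := hle x
    set n := ⌈x / δ⌉₊
    have h2 : ContinuousWithinAt (concatSeq c τ n) (Icc 0 (t n)) x := (hpn n).2.1 x ⟨hx, h1.le⟩
    have h3 : ContinuousWithinAt (concatSeq c τ n) (Ici 0) x := by
      refine h2.mono_of_mem_nhdsWithin ?_
      have : Ici (0 : ℝ) ∩ Iio (t n) ∈ 𝓝[Ici 0] x :=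
        inter_mem_nhdsWithin _ (gt_mem_nhds h1)
      exact mem_of_superset this fun y hy => ⟨hy.1, le_of_lt hy.2⟩
    exact h3.congr_of_eventuallyEq ((hev n x h1).filter_mono nhdsWithin_le_nhds)
      (heq n x h1.le)
  · refine (hpn ⌈b / δ⌉₊).2.2.1.subset ?_
    rintro x ⟨⟨hx0, hr⟩, hx⟩
    have hxb : x < t ⌈b / δ⌉₊ := hx.2.trans_lt (hle b)
    exact ⟨⟨hx0, hxb⟩, fun hreg => hr (hreg.congr (hev _ x hxb).symm)⟩
  · intro x hx hxD
    rw [interior_Ici] at hx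
    by_contra hr
    exact hxD ⟨hx, hr⟩
  · intro x hx hi
    have h1 := hle x
    set n := ⌈x / δ⌉₊
    rw [heq n x h1.le] at hi
    filter_upwards [(hpn n).2.2.2 x ⟨hx, h1⟩ hi, (hev n x h1).filter_mono nhdsWithin_le_nhds]
      with y hy hy'
    rwa [hy']
  · rw [heq 0 0 (by simpa [ht] using (hτ 0).le)]
    rfl

end PWLSystem


/-! ### Expanding return maps: one crossing orbit, and it is unstable -/

namespace PWLSystem

variable {S : PWLSystem} {s : Side}

/-- The properties of the return map of two unstable foci. -/
structure ReturnMap.Expanding (R : ReturnMap S) : Prop where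
  visible : ∀ s, S.VisibleUnstable s
  cont : ∀ s, Continuous (R.h s)
  monotone : ∀ s, Monotone (R.h s)
  convex : ∀ s, ConvexOn ℝ univ (R.h s)
  growth : ∀ s, ∃ k : ℝ, 1 < k ∧ ∀ u, R.p s ≤ u → -R.p s + k * (u - R.p s) ≤ R.h s u
  time : ∀ s, ∃ δ : ℝ, 0 < δ ∧ ∀ u ∈ (R.H s).dom, δ ≤ (R.H s).τ u

/-- Backward uniqueness from the common endpoint: an arc that ends where the arc of `u` ends is a
final part of it, possibly starting inside the half plane. This handles solutions whose initial
point is not on the line. -/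
lemma HalfReturn.mem_arc_of_end {ε : ℝ} (H : HalfReturn S s ε) (hv : S.VisibleUnstable s)
    {c : ℝ → Fin 2 → ℝ} {a b u : ℝ} (hc : S.IsArc s c a b)
    (hu : u ∈ H.dom) (he : c b = s.opp.pt ε (H.h u)) : c a ∈ H.flow u '' Icc 0 (H.τ u) := by
  have hsp := isFlow_spiral hv.2.1 (c a)
  have h0 := hc.eq_flow hsp (by rw [spiral_zero hv.2.1])
  have hab := hc.1
  have hun := hsp.unique (H.isFlow u) (t₀ := b - a) (t₁ := H.τ u)
    (by rw [← h0 b (right_mem_Icc.2 hab.le), he, H.flow_τ u hu])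
  have hτ := H.τ_pos u hu
  -- A longer arc would have met the line at the time where the arc of `u` starts.
  have hle : b - a ≤ H.τ u := by
    by_contra hcon
    push Not at hcon
    have h1 := hun (-H.τ u)
    rw [add_neg_cancel, H.flow_zero] at h1
    have hm : b - H.τ u ∈ Ioo a b := ⟨by linarith, by linarith⟩
    have h2 := h0 _ (Ioo_subset_Icc_self hm)
    rw [show b - H.τ u - a = b - a + -H.τ u by ring, h1] at h2
    exact Side.notMem_switchingLine (hc.2.2 _ hm).1 (h2 ▸ Side.pt_mem _ _ _)
  refine ⟨H.τ u - (b - a), ⟨by linarith, by linarith⟩, ?_⟩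
  have h1 := hun (-(b - a))
  rw [add_neg_cancel, spiral_zero hv.2.1] at h1
  rw [h1]
  rfl

namespace ReturnMap

variable {R : ReturnMap S} {u : ℝ}

lemma isCompact_arc (s : Side) (u : ℝ) : IsCompact (R.arc s u) :=
  isCompact_Icc.image_of_continuousOn fun t _ =>
    ((R.H s).isFlow u t).continuousAt.continuousWithinAt

lemma arc_subset (hu : u ∈ (R.H s).dom) : R.arc s u ⊆ switchingLine ∪ s.region := by
  rintro _ ⟨t, ht, rfl⟩
  rcases ht.1.eq_or_lt with e | e
  · left
    rw [← e, (R.H s).flow_zero]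
    exact Side.pt_mem _ _ _
  · rcases ht.2.lt_or_eq with e' | e'
    · exact Or.inr ((R.H s).region u hu t ⟨e, e'⟩)
    · left
      rw [e', (R.H s).flow_τ u hu]
      exact Side.pt_mem _ _ _

/-- The orbit of an equilibrium is constant and never reaches the line, whereas an arc starts there.
-/
lemma equil_notMem_arc (hv : ∀ s, S.VisibleUnstable s) (hu : u ∈ (R.H s).dom) (s' : Side) :
    S.equil s' ∉ R.arc s u := by
  intro hmem
  have hreg := equil_mem (hv s')
  rcases arc_subset hu hmem with h | h
  · exact Side.notMem_switchingLine hreg h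
  · obtain rfl := Side.eq_of_mem_region h hreg
    obtain ⟨t, -, ht⟩ := hmem
    have h1 := ((R.H s').isFlow u).unique (isFlow_equil (hv s')) (t₀ := t) (t₁ := 0) ht (-t)
    rw [add_neg_cancel, (R.H s').flow_zero] at h1
    exact Side.notMem_switchingLine hreg (h1 ▸ Side.pt_mem _ _ _)

/-- A solution that stays away from the sliding region and the equilibria comes back to the
switching line again and again. -/
lemma exists_next_arc (hv : ∀ s, S.VisibleUnstable s) {γ : ℝ → Fin 2 → ℝ}
    (hsol : S.IsSolutionOn γ (Ici 0)) (hns : ∀ t, 0 ≤ t → γ t ∉ S.slidingRegion)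
    (hne : ∀ t, 0 ≤ t → ∀ s, γ t ≠ S.equil s) {a : ℝ} (ha : 0 ≤ a) :
    ∃ s b, S.IsArc s γ a b ∧ γ b ∈ switchingLine := by
  obtain ⟨δ, hδ, hfree⟩ := hsol.exists_free (Ici_subset_Ici.2 ha) (hns a ha)
  by_cases hex : ∃ b, a < b ∧ γ b ∈ switchingLine
  · obtain ⟨b, hab, hb⟩ := hex
    obtain ⟨c, h1, -, h3, h4⟩ := exists_next_time (hsol.1.mono (Ici_subset_Ici.2 ha)) hδ hfree hab hb
    obtain ⟨s, hs⟩ := hsol.exists_isArc h1 (fun t ht => ha.trans ht.1) h4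
    exact ⟨s, c, hs, h3⟩
  · exfalso
    push Not at hex
    obtain ⟨s, hs⟩ := hsol.exists_isArc (show a < a + 2 by linarith) (fun t ht => ha.trans ht.1)
      fun t ht => hex t ht.1
    -- The time is shifted by one because `γ a` may be on the line; from `a + 1` on the solution
    -- stays in one half plane for ever, so it would be at the equilibrium.
    have harc : ∀ b, a + 1 < b → S.IsArc s γ (a + 1) b := by
      intro b hb
      have hb' : a < b + 2 := by linarith
      obtain ⟨s', hs'⟩ := hsol.exists_isArc hb' (fun t ht => ha.trans ht.1) fun t ht => hex t ht.1
      have hm : a + 1 ∈ Ioo a (a + 2) := ⟨by linarith, by linarith⟩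
      obtain rfl := Side.eq_of_mem_region (hs.2.2 _ hm).1
        (hs'.2.2 (a + 1) ⟨by linarith, by linarith⟩).1
      exact hs'.mono (by linarith) (by linarith) hb
    have hfl := isFlow_spiral (hv s).2.1 (γ (a + 1))
    have hz := spiral_zero (hv s).2.1 (γ (a + 1))
    have key := eq_equil_of_forall_mem_region (hv s) hfl ?_
    · rw [hz] at key
      exact hne (a + 1) (by linarith) s key
    · intro t ht
      rcases ht.eq_or_lt with e | e
      · rw [← e, hz]
        exact (hs.2.2 (a + 1) ⟨by linarith, by linarith⟩).1
      · have h1 := harc (a + 1 + t + 1) (by linarith)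
        have h2 := h1.eq_flow hfl hz.symm (a + 1 + t) ⟨by linarith, by linarith⟩
        rw [show a + 1 + t - (a + 1) = t by ring] at h2
        rw [← h2]
        exact (h1.2.2 _ ⟨by linarith, by linarith⟩).1

/-- The hypothesis concerns the farther of two points seen from `s`, the tangency and the landing
point of the opposite tangency: its orbit falls short of the opposite tangency. Points that cross on
the opposite side thus lie strictly beyond it, and there the convex return map has a single fixed
point, reached from below the diagonal. -/
theorem exists_unique_unstable (hR : R.Expanding) (s : Side)
    (hstar : R.h s (max (R.p s) (R.h s.opp (R.p s.opp))) < R.p s.opp) :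
    ∃ Γ, S.IsCrossingPeriodicOrbit Γ ∧ (∀ Γ', S.IsCrossingPeriodicOrbit Γ' → Γ' = Γ) ∧
      S.IsUnstable Γ := by
  have hv := hR.visible
  -- Whenever `h s u` falls short of the opposite tangency, monotonicity bounds the value of the
  -- extended return map by `u₀`; hence it is below the diagonal just to the right of `u₀`.
  set u₀ := max (R.p s) (R.h s.opp (R.p s.opp)) with hu₀
  obtain ⟨u₁, h01, h11⟩ : ∃ u₁, u₀ < u₁ ∧ R.h s u₁ < R.p s.opp := by
    have h1 : ∀ᶠ u in 𝓝[>] u₀, R.h s u < R.p s.opp :=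
      ((hR.cont s).continuousAt.eventually_lt_const hstar).filter_mono nhdsWithin_le_nhds
    obtain ⟨u, h2, h3⟩ := (h1.and self_mem_nhdsWithin).exists
    exact ⟨u, h3, h2⟩
  have hpu₀ : R.p s ≤ u₀ := le_max_left _ _
  have hφ0 : ∀ u, R.h s u ≤ R.p s.opp → R.h s.opp (R.h s u) ≤ u₀ := fun u hu =>
    (hR.monotone s.opp hu).trans (le_max_right _ _)
  set φ : ℝ → ℝ := fun u => R.h s.opp (R.h s u) with hφ
  -- An increasing convex function of a convex function is convex.
  have hφconv : ConvexOn ℝ univ φ :=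
    ⟨convex_univ, fun x _ y _ a b ha hb hab =>
      (hR.monotone s.opp ((hR.convex s).2 trivial trivial ha hb hab)).trans
        ((hR.convex s.opp).2 trivial trivial ha hb hab)⟩
  have hφcont : Continuous φ := (hR.cont s.opp).comp (hR.cont s)
  have hφ1 : φ u₁ < u₁ := (hφ0 u₁ h11.le).trans_lt h01
  obtain ⟨w, hw1, hw2⟩ : ∃ w, u₁ < w ∧ w < φ w := by
    obtain ⟨k, hk, hg⟩ := hR.growth s
    obtain ⟨k', hk', hg'⟩ := hR.growth s.opp
    set P := R.p s
    set P' := R.p s.opp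
    have hkk : 0 < k' * k - 1 := by nlinarith
    set C := P' + k' * (P + P') + k' * k * P with hC
    -- Both linear lower bounds together give `φ w ≥ k' k w - C`, provided that `w` and its image
    -- lie beyond the tangencies; `w` is chosen to meet these conditions and to exceed `C / (k' k -
    -- 1)`.
    set w := max (max u₁ P) (max (|P + P'| + P) (C / (k' * k - 1))) + 1 with hw
    have e1 : u₁ < w := by
      have := (le_max_left u₁ P).trans (le_max_left _ (max (|P + P'| + P) (C / (k' * k - 1))))
      linarith
    have e2 : P ≤ w := by
      have := (le_max_right u₁ P).trans (le_max_left _ (max (|P + P'| + P) (C / (k' * k - 1))))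
      linarith
    have e3 : |P + P'| + P ≤ w := by
      have := (le_max_left (|P + P'| + P) (C / (k' * k - 1))).trans (le_max_right (max u₁ P) _)
      linarith
    have e4 : C / (k' * k - 1) < w := by
      have := (le_max_right (|P + P'| + P) (C / (k' * k - 1))).trans (le_max_right (max u₁ P) _)
      linarith
    rw [div_lt_iff₀ hkk] at e4
    have g1 := hg w e2
    have e5 : P' ≤ R.h s w := by
      have h1 : P + P' ≤ w - P := (le_abs_self _).trans (by linarith)
      have h2 : 0 ≤ w - P := by linarith
      nlinarith
    have g2 := hg' _ e5
    refine ⟨w, e1, ?_⟩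
    have g3 : k' * (-P + k * (w - P) - P') ≤ k' * (R.h s w - P') := by gcongr
    simp only [hφ]
    nlinarith
  obtain ⟨u, c, hu1, hfix, hc1, hexp, hcon⟩ := exists_repelling_fixedPoint hφconv hφcont hφ1 hw1 hw2
  have hpu : R.p s < u := by linarith
  -- Every coordinate that a crossing orbit can use is to the right of `u₁`, where the fixed point
  -- is unique.
  have hlow : ∀ x, R.p s.opp ≤ R.h s x → u₁ < x := by
    intro x hx
    by_contra hle
    have := hR.monotone s (not_lt.1 hle)
    linarith
  have hpv : R.p s.opp < R.h s u := by
    by_contra hle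
    have := hφ0 u (not_lt.1 hle)
    have : φ u ≤ u₀ := this
    linarith
  have huniq : ∀ x, u₁ < x → φ x = x → x = u := by
    intro x hx hx'
    rcases le_total u x with h | h
    · have := hexp x h
      rw [hx'] at this
      nlinarith
    · have := hcon x hx.le h
      rw [hx'] at this
      nlinarith
  set v := R.h s u with hvdef
  have hud := (R.H s).mem_dom _ hpu
  have hvd := (R.H s.opp).mem_dom _ hpv
  have hmapv : R.h s.opp v = u := hfix
  have hptu : R.pt s u ∈ R.orb s u := by
    refine Or.inl ⟨0, ⟨le_rfl, ((R.H s).τ_pos _ hud).le⟩, ?_⟩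
    rw [(R.H s).flow_zero]
    rfl
  have hptv : R.pt s.opp v ∈ R.orb s u := by
    refine Or.inr ⟨0, ⟨le_rfl, ((R.H s.opp).τ_pos _ hvd).le⟩, ?_⟩
    rw [(R.H s.opp).flow_zero]
    rfl
  obtain ⟨B, hB⟩ : ∃ B, ∀ z ∈ R.orb s u, |z 1| < B := by
    have hcomp : IsCompact (R.orb s u) := (isCompact_arc s u).union (isCompact_arc s.opp _)
    obtain ⟨B, hB⟩ := hcomp.exists_bound_of_continuousOn (f := fun z : Fin 2 → ℝ => z 1)
      (continuous_apply 1).continuousOn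
    exact ⟨B + 1, fun z hz => (hB z hz).trans_lt (by linarith)⟩
  -- A strip bounded along the line, without the sliding region and the two equilibria. A solution
  -- that stays in it has to cross again and again at bounded coordinates.
  set U : Set (Fin 2 → ℝ) := {z | |z 1| < B} ∩ S.slidingRegionᶜ ∩ {z | ∀ s', z ≠ S.equil s'} with hU
  have hUo : IsOpen U := by
    refine ((isOpen_lt (continuous_apply 1).abs continuous_const).inter
      S.isClosed_slidingRegion.isOpen_compl).inter ?_
    have : {z : Fin 2 → ℝ | ∀ s', z ≠ S.equil s'} = {S.equil .right}ᶜ ∩ {S.equil .left}ᶜ := by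
      ext z
      constructor
      · exact fun h => ⟨h .right, h .left⟩
      · rintro ⟨h1, h2⟩ (_ | _)
        · exact h1
        · exact h2
    rw [this]
    exact isOpen_compl_singleton.inter isOpen_compl_singleton
  have hΓU : R.orb s u ⊆ U := by
    refine fun z hz => ⟨⟨hB z hz, fun hsl => ?_⟩, fun s' e => ?_⟩
    · rcases orb_inter_switchingLine hpu hpv hmapv ⟨hz, hsl.1⟩ with e | e
      · refine R.notMem_slidingRegion (s := s) ?_ hsl
        rwa [e, crd_pt]
      · refine R.notMem_slidingRegion (s := s.opp) ?_ hsl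
        rwa [e, crd_pt]
    · subst e
      rcases hz with hz | hz
      · exact equil_notMem_arc hv hud s' hz
      · exact equil_notMem_arc hv hvd s' hz
  -- In `U` every crossing coordinate is confined to `(u₁, B]`, while expansion by `c > 1` drives it
  -- away from `u` unless it equals `u`. So all crossings are those of the orbit, and so is the
  -- initial point.
  have hleave : ∀ γ, S.IsSolutionOn γ (Ici 0) → γ 0 ∉ R.orb s u → ∃ t, 0 ≤ t ∧ γ t ∉ U := by
    intro γ hsol h0
    by_contra hstay
    push Not at hstay
    have hns : ∀ t, 0 ≤ t → γ t ∉ S.slidingRegion := fun t ht => (hstay t ht).1.2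
    have hnext := fun a ha => exists_next_arc (a := a) hv hsol hns
      (fun t ht => (hstay t ht).2) ha
    have hside : ∀ t, 0 ≤ t → γ t ∈ switchingLine → ∀ s', R.crd s' (γ t) ≤ R.p s' →
        R.p s'.opp < R.crd s'.opp (γ t) := by
      intro t ht hts s' hle
      by_contra hcon
      exact hns t ht ((R.mem_slidingRegion s' hts).2 ⟨hle, not_lt.1 hcon⟩)
    have hstep : ∀ s' a, 0 ≤ a → γ a ∈ switchingLine → R.p s' < R.crd s' (γ a) →
        ∃ b, 0 ≤ b ∧ γ b ∈ switchingLine ∧ R.p s'.opp < R.crd s'.opp (γ b) ∧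
          R.crd s'.opp (γ b) = R.h s' (R.crd s' (γ a)) := by
      intro s' a ha has hpa
      obtain ⟨s'', b, harc, hb⟩ := hnext a ha
      obtain rfl := R.side_eq harc has hpa.le
      have hb0 : 0 ≤ b := ha.trans harc.1.le
      exact ⟨b, hb0, hb, hside b hb0 hb _ (R.crd_end_lt harc has hb).le, R.crd_end harc has hb⟩
    have hturn : ∀ a, 0 ≤ a → γ a ∈ switchingLine → R.p s < R.crd s (γ a) →
        u₁ < R.crd s (γ a) ∧ R.crd s (γ a) ≤ B ∧
        ∃ b, 0 ≤ b ∧ γ b ∈ switchingLine ∧ R.p s < R.crd s (γ b) ∧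
          R.crd s (γ b) = φ (R.crd s (γ a)) := by
      intro a ha has hpa
      obtain ⟨b, hb0, hb, hpb, heb⟩ := hstep s a ha has hpa
      obtain ⟨b', hb0', hb', hpb', heb'⟩ := hstep s.opp b hb0 hb hpb
      rw [Side.opp_opp] at hpb' heb'
      refine ⟨hlow _ (by rw [← heb]; exact hpb.le), ?_, b', hb0', hb', hpb', by rw [heb', heb]⟩
      have h1 := (hstay a ha).1.1
      have h2 : |R.crd s (γ a)| = |γ a 1| := by
        have e1 : |s.sgn| = 1 := by cases s <;> simp [Side.sgn]
        have e2 : |R.ε| = 1 := by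
          have := abs_mul_abs_self R.ε
          rw [R.hε] at this
          nlinarith [abs_nonneg R.ε]
        rw [crd, Side.crd, abs_mul, abs_mul, e1, e2]
        ring
      have h3 : |γ a 1| < B := h1
      linarith [le_abs_self (R.crd s (γ a))]
    have hall : ∀ a, 0 ≤ a → γ a ∈ switchingLine → R.p s < R.crd s (γ a) →
        R.crd s (γ a) = u := by
      intro a ha has hpa
      set x := R.crd s (γ a) with hx
      have hseq : ∀ n : ℕ, ∃ b, 0 ≤ b ∧ γ b ∈ switchingLine ∧ R.p s < R.crd s (γ b) ∧
          ((u ≤ x → c ^ n * (x - u) ≤ R.crd s (γ b) - u ∧ u ≤ R.crd s (γ b)) ∧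
          (x ≤ u → c ^ n * (u - x) ≤ u - R.crd s (γ b) ∧ R.crd s (γ b) ≤ u)) := by
        intro n
        induction n with
        | zero => exact ⟨a, ha, has, hpa, by simp [← hx], by simp [← hx]⟩
        | succ n ih =>
          obtain ⟨b, hb0, hb, hpb, hl, hr⟩ := ih
          obtain ⟨hlo, -, b', hb0', hb', hpb', he⟩ := hturn b hb0 hb hpb
          refine ⟨b', hb0', hb', hpb', fun hux => ?_, fun hux => ?_⟩
          · obtain ⟨h1, h2⟩ := hl hux
            have h3 := hexp _ h2
            rw [he]
            have h4 : c ^ (n + 1) * (x - u) ≤ c * (R.crd s (γ b) - u) := by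
              rw [pow_succ']
              nlinarith
            refine ⟨by linarith, ?_⟩
            nlinarith
          · obtain ⟨h1, h2⟩ := hr hux
            have h3 := hcon _ hlo.le h2
            rw [he]
            have h4 : c ^ (n + 1) * (u - x) ≤ c * (u - R.crd s (γ b)) := by
              rw [pow_succ']
              nlinarith
            refine ⟨by linarith, ?_⟩
            nlinarith
      rcases lt_trichotomy x u with hlt | heq | hgt
      · exfalso
        obtain ⟨n, hn⟩ := pow_unbounded_of_one_lt ((u - u₁) / (u - x)) hc1
        rw [div_lt_iff₀ (by linarith)] at hn
        obtain ⟨b, hb0, hb, hpb, -, hr⟩ := hseq n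
        have h1 := (hr hlt.le).1
        have h2 := (hturn b hb0 hb hpb).1
        linarith
      · exact heq
      · exfalso
        obtain ⟨n, hn⟩ := pow_unbounded_of_one_lt ((B - u) / (x - u)) hc1
        rw [div_lt_iff₀ (by linarith)] at hn
        obtain ⟨b, hb0, hb, hpb, hl, -⟩ := hseq n
        have h1 := (hl hgt.le).1
        have h2 := (hturn b hb0 hb hpb).2.1
        linarith
    have hall' : ∀ a, 0 ≤ a → γ a ∈ switchingLine → R.p s.opp < R.crd s.opp (γ a) →
        R.crd s.opp (γ a) = v := by
      intro a ha has hpa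
      obtain ⟨b, hb0, hb, hpb, heb⟩ := hstep s.opp a ha has hpa
      rw [Side.opp_opp] at hpb heb
      have h1 := hall b hb0 hb hpb
      exact (R.mono s.opp).injOn hpa.le hpv.le (by rw [← heb, h1, hmapv])
    have hpts : ∀ a, 0 ≤ a → γ a ∈ switchingLine → γ a = R.pt s u ∨ γ a = R.pt s.opp v := by
      intro a ha has
      rcases lt_or_ge (R.p s) (R.crd s (γ a)) with h | h
      · left
        rw [← hall a ha has h, R.pt_crd s has]
      · right
        rw [← hall' a ha has (hside a ha has s h), R.pt_crd s.opp has]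
    obtain ⟨s', b, harc, hb⟩ := hnext 0 le_rfl
    -- The first arc ends at one of the two crossing points; the sign of the velocity tells from
    -- which side, and following that arc backward puts `γ 0` on the orbit.
    have hvb := harc.vel_end_nonpos hb
    rw [R.vel_eq s' hb] at hvb
    have hvb' : R.crd s' (γ b) ≤ R.p s' := by
      have := (R.H s').m_pos
      by_contra hcon
      push Not at hcon
      have := mul_pos this (sub_pos.2 hcon)
      linarith
    rcases hpts b harc.1.le hb with e | e
    · rcases s.eq_or_eq_opp s' with e' | e'
      · subst e'
        rw [e, crd_pt] at hvb'
        linarith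
      · subst e'
        refine h0 (Or.inr ?_)
        refine (R.H s.opp).mem_arc_of_end (hv s.opp) harc hvd ?_
        rw [e, Side.opp_opp]
        change R.pt s u = R.pt s (R.h s.opp v)
        rw [hmapv]
    · rcases s.eq_or_eq_opp s' with e' | e'
      · subst e'
        exact h0 (Or.inl ((R.H s').mem_arc_of_end (hv s') harc hud e))
      · subst e'
        rw [e, crd_pt] at hvb'
        linarith
  have horb := isCrossingPeriodicOrbit_orb hpu hpv hmapv
  refine ⟨R.orb s u, horb, ?_, ?_, U, hUo, hΓU, fun γ hγ _ h0 => hleave γ hγ h0⟩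
  · intro Γ' hΓ'
    obtain ⟨x, hx1, hx2, hx3, rfl⟩ := R.exists_fixed_of_crossing s hΓ'
    rw [huniq x (hlow x hx2) hx3]
  · intro hst
    obtain ⟨V, hVo, hΓV, hV⟩ := hst U hUo hΓU
    have hptc : Continuous (R.pt s) := by
      refine continuous_pi fun i => ?_
      fin_cases i
      · exact continuous_const
      · exact continuous_const.mul continuous_id
    -- Instability needs an actual solution for all positive times. Starting beyond `u` the iterates
    -- stay beyond `u`, so turns can be concatenated without ever meeting the sliding region.
    obtain ⟨x, hxV, hxu⟩ : ∃ x, R.pt s x ∈ V ∧ u < x := by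
      have h1 : ∀ᶠ x in 𝓝[>] u, R.pt s x ∈ V :=
        (hptc.continuousAt.eventually_mem (hVo.mem_nhds (hΓV hptu))).filter_mono nhdsWithin_le_nhds
      exact (h1.and self_mem_nhdsWithin).exists
    have hxn : ∀ n : ℕ, u < φ^[n] x := by
      intro n
      induction n with
      | zero => exact hxu
      | succ n ih =>
        rw [Function.iterate_succ_apply']
        have := hexp _ ih.le
        nlinarith
    have hvn : ∀ n : ℕ, R.p s.opp < R.h s (φ^[n] x) := fun n =>
      hpv.trans_le (hR.monotone s (hxn n).le)
    obtain ⟨δ, hδ, hδτ⟩ := hR.time s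
    obtain ⟨γ, hγ, hγ0⟩ := exists_solution_of_pieces (S := S)
      (c := fun n => R.turn s (φ^[n] x)) (τ := fun n => R.turnTime s (φ^[n] x))
      (fun n => isPiece_turn (hpu.trans (hxn n)) (hvn n)) (fun n => by
        rw [turn_turnTime (hpu.trans (hxn n)) (hvn n), turn_zero (hpu.trans (hxn (n + 1))),
          Function.iterate_succ_apply']) hδ (fun n => by
        have h1 := hδτ _ ((R.H s).mem_dom _ (hpu.trans (hxn n)))
        have h2 := (R.H s.opp).τ_pos _ ((R.H s.opp).mem_dom _ (hvn n))
        change δ ≤ (R.H s).τ _ + (R.H s.opp).τ _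
        exact h1.trans (le_add_of_nonneg_right h2.le))
    have hγ0' : γ 0 = R.pt s x := by
      rw [hγ0]
      exact turn_zero (hpu.trans hxu)
    obtain ⟨t, ht0, ht⟩ := hleave γ hγ (by
      rw [hγ0']
      intro hmem
      rcases orb_inter_switchingLine hpu hpv hmapv ⟨hmem, R.pt_mem s x⟩ with e | e
      · have := congrArg (R.crd s) e
        rw [crd_pt, crd_pt] at this
        linarith
      · have := congrArg (R.crd s) e
        rw [pt_opp, crd_pt, crd_pt] at this
        linarith [R.gap' s])
    exact ht (hV γ hγ (hγ0' ▸ hxV) t ht0)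

end ReturnMap

end PWLSystem


/-! ### From sliding periodic orbits to the expanding return map -/

namespace PWLSystem

variable {S : PWLSystem} {s : Side}

/-- Two unstable foci, each in its own half plane, whose tangencies bound an attractive sliding
segment, have an expanding return map. -/
lemma exists_expanding (hv : ∀ s, S.VisibleUnstable s) {P Q : Fin 2 → ℝ}
    (hP : P ∈ switchingLine) (hP0 : S.vel s P = 0) (hP1 : S.vel s.opp P < 0)
    (hQ : Q ∈ switchingLine) (hQ0 : S.vel s.opp Q = 0) (hQ1 : S.vel s Q < 0) :
    ∃ R : ReturnMap S, R.Expanding := by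
  have e1 := S.vel_sub s hP hQ
  have e2 := S.vel_sub s.opp hP hQ
  rw [hP0, zero_add] at e1
  rw [hQ0, Side.sgn_opp] at e2
  obtain ⟨ε, hε, hA⟩ := exists_sign (A_ne_zero_of_disc (hv s).2.1)
  -- The velocities at the two tangencies force the coefficients `A 0 1` of the two sides to have
  -- equal sign, so a single orientation `ε` of the line serves both.
  have hA' : 0 < ε * S.A s.opp 0 1 := by
    have h1 : 0 < (s.sgn * S.A s 0 1 * (Q 1 - P 1)) * (s.sgn * S.A s.opp 0 1 * (Q 1 - P 1)) :=
      mul_pos_of_neg_of_neg (e1 ▸ hQ1) (by linarith)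
    have h2 : (s.sgn * S.A s 0 1 * (Q 1 - P 1)) * (s.sgn * S.A s.opp 0 1 * (Q 1 - P 1)) =
        (ε * S.A s 0 1) * (ε * S.A s.opp 0 1) * (Q 1 - P 1) ^ 2 := by
      linear_combination (S.A s 0 1 * S.A s.opp 0 1 * (Q 1 - P 1) ^ 2) * (s.sgn_mul_self - hε)
    rw [h2] at h1
    exact pos_of_mul_pos_right (pos_of_mul_pos_left h1 (sq_nonneg _)) hA.le
  have hAll : ∀ s', 0 < ε * S.A s' 0 1 := by
    intro s'
    rcases s.eq_or_eq_opp s' with rfl | rfl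
    · exact hA
    · exact hA'
  set H : ∀ s', HalfReturn S s' ε := fun s' => focusHalf (hv s') hε (hAll s') with hH
  have hgap : 0 < (H s).p + (H s.opp).p := by
    have h1 := (H s).vel_eq P hP
    have h2 := (H s.opp).vel_eq P hP
    rw [hP0, eq_comm, mul_eq_zero, or_iff_right (H s).m_pos.ne'] at h1
    rw [h2, Side.crd_opp] at hP1
    have := neg_of_mul_neg_right hP1 (H s.opp).m_pos.le
    linarith
  refine ⟨⟨ε, hε, H, fun s' => ?_⟩, ⟨hv, fun s' => ?_, fun s' => ?_, fun s' => ?_, fun s' => ?_,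
    fun s' => ?_⟩⟩
  · rcases s.eq_or_eq_opp s' with rfl | rfl
    · exact hgap
    · rw [Side.opp_opp, add_comm]
      exact hgap
  · exact continuous_focusHalf (hv s') hε (hAll s')
  · exact monotone_focusHalf (hv s') hε (hAll s')
  · exact convexOn_focusHalf (hv s') hε (hAll s')
  · exact le_focusHalf (hv s') hε (hAll s')
  · exact le_focusHalf_τ (hv s') hε (hAll s')

lemma ReturnMap.crd_of_vel (R : ReturnMap S) {P : Fin 2 → ℝ} (hP : P ∈ switchingLine)
    (hP0 : S.vel s P = 0) : R.crd s P = R.p s := by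
  have h := R.vel_eq s hP
  rw [hP0, eq_comm, mul_eq_zero, or_iff_right (R.H s).m_pos.ne'] at h
  linarith

/-- Both orbits through the tangencies land in the attractive sliding segment. -/
lemma exists_unique_of_landings {c d : ℝ → Fin 2 → ℝ} {a b a' b' : ℝ}
    (hc : S.IsArc s c a b) (ha : c a ∈ switchingLine) (ha0 : S.vel s (c a) = 0)
    (ha1 : S.vel s.opp (c a) < 0) (hb : c b ∈ S.attractiveRegion)
    (hd : S.IsArc s.opp d a' b') (ha' : d a' ∈ switchingLine) (ha0' : S.vel s.opp (d a') = 0)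
    (ha1' : S.vel s (d a') < 0) (hb' : d b' ∈ S.attractiveRegion) :
    ∃ Γ, S.IsCrossingPeriodicOrbit Γ ∧ (∀ Γ', S.IsCrossingPeriodicOrbit Γ' → Γ' = Γ) ∧
      S.IsUnstable Γ := by
  have hv : ∀ s', S.VisibleUnstable s' := by
    intro s'
    rcases s.eq_or_eq_opp s' with rfl | rfl
    · exact hc.visibleUnstable ha ha0 hb.1 ((mem_attractiveRegion s').1 hb).2.1
    · exact hd.visibleUnstable ha' ha0' hb'.1 ((mem_attractiveRegion s).1 hb').2.2
  obtain ⟨R, hR⟩ := exists_expanding hv ha ha0 ha1 ha' ha0' ha1'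
  refine R.exists_unique_unstable hR s ?_
  have h1 := R.crd_end hc ha hb.1
  have h2 := R.crd_end hd ha' hb'.1
  rw [R.crd_of_vel ha ha0] at h1
  rw [R.crd_of_vel ha' ha0', Side.opp_opp] at h2
  have h3 := (R.mem_attractiveRegion s).1 hb
  have h4 := (R.mem_attractiveRegion s).1 hb'
  -- The opposite tangency lands short of the tangency of `s`, so the latter is the farther point.
  rw [max_eq_left (by linarith), ← h1]
  exact h3.2.2

/-- The orbit through one tangency runs through both half planes into the attractive sliding
segment. -/
lemma exists_unique_of_return (hv : S.VisibleUnstable s) {d : ℝ → Fin 2 → ℝ} {a b e : ℝ}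
    (hP : d a ∈ switchingLine) (hP0 : S.vel s.opp (d a) = 0) (hP1 : S.vel s (d a) < 0)
    (hd : S.IsArc s.opp d a b) (hb : d b ∈ switchingLine) (hb0 : S.vel s.opp (d b) < 0)
    (hc : S.IsArc s d b e) (he : d e ∈ S.attractiveRegion) {Q : Fin 2 → ℝ}
    (hQ : Q ∈ switchingLine) (hQ0 : S.vel s Q = 0) (hQ1 : S.vel s.opp Q < 0) :
    ∃ Γ, S.IsCrossingPeriodicOrbit Γ ∧ (∀ Γ', S.IsCrossingPeriodicOrbit Γ' → Γ' = Γ) ∧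
      S.IsUnstable Γ := by
  have hv : ∀ s', S.VisibleUnstable s' := by
    intro s'
    rcases s.eq_or_eq_opp s' with rfl | rfl
    · exact hv
    · exact hd.visibleUnstable hP hP0 hb hb0
  obtain ⟨R, hR⟩ := exists_expanding hv hQ hQ0 hQ1 hP hP0 hP1
  refine R.exists_unique_unstable hR s ?_
  have h1 := R.crd_end hd hP hb
  rw [R.crd_of_vel hP hP0, Side.opp_opp] at h1
  have h2 := R.crd_end hc hb he.1
  have h3 := R.le_crd_start hc hb
  rw [h1] at h2 h3
  -- Here the opposite tangency lands where an arc of `s` starts, so its landing point is the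
  -- farther one, and its next landing is the given attractive point.
  rw [max_eq_right h3, ← h2]
  exact ((R.mem_attractiveRegion s).1 he).2.2

theorem exists_unique_of_pairB (h : S.HasPairB) :
    ∃ Γ, S.IsCrossingPeriodicOrbit Γ ∧ (∀ Γ', S.IsCrossingPeriodicOrbit Γ' → Γ' = Γ) ∧
      S.IsUnstable Γ := by
  obtain ⟨s, Γ₁, Γ₂, h1, h2⟩ := h
  obtain ⟨c, a, b, hc, ha, ha0, ha1, hb⟩ := h1.exists_arc
  obtain ⟨d, a', b', hd, ha', ha0', ha1', hb'⟩ := h2.exists_arc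
  rw [Side.opp_opp] at ha1'
  exact exists_unique_of_landings hc ha ha0 ha1 hb hd ha' ha0' ha1' hb'

/-- The orbit of type (b) is the orbit of its exit tangency through both half planes into the
sliding segment; the orbit of type (a) supplies the focus and the tangency of the other side. -/
theorem exists_unique_of_pairC (h : S.HasPairC) :
    ∃ Γ, S.IsCrossingPeriodicOrbit Γ ∧ (∀ Γ', S.IsCrossingPeriodicOrbit Γ' → Γ' = Γ) ∧
      S.IsUnstable Γ := by
  obtain ⟨s, Γ₁, Γ₂, h1, γ, T, ⟨hT, hsol, hper, -⟩, -, t₁, t₂, hsl, hl1, hcr, hl2⟩ := h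
  obtain ⟨c, a, b, hc, ha, ha0, ha1, hb⟩ := h1.exists_arc
  have hv := hc.visibleUnstable ha ha0 hb.1 ((mem_attractiveRegion s).1 hb).2.1
  have harc1 := hl1.isArc hsol
  have harc2 := hl2.isArc hsol
  obtain ⟨e0, e1⟩ := hsl.vel_exit hsol hl1.2.1 harc1
  rw [Side.opp_opp] at e1 harc2
  have hT0 : γ T = γ 0 := by simpa using hper 0
  have hend : γ T ∈ S.attractiveRegion := by
    rw [hT0]
    exact hsl.2 0 ⟨le_rfl, hsl.1⟩
  refine exists_unique_of_return hv hl1.2.1 e0 e1 harc1 hl1.2.2.1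
    (lt_of_le_of_ne (harc1.vel_end_nonpos hl1.2.2.1) fun h0 => ?_) harc2 hend ha ha0 ha1
  have := ((mem_crossingRegion s).1 hcr).2
  rw [h0, mul_zero] at this
  exact this.false

/-- The orbit of the exit tangency meets the other tangency on its way. That point is at once the
start of the second arc and the tangency needed for the second focus, so the argument applies with
the sides exchanged. -/
theorem exists_unique_of_typeC {Γ : Set (Fin 2 → ℝ)} (h : S.IsTypeC s Γ) :
    ∃ Γ, S.IsCrossingPeriodicOrbit Γ ∧ (∀ Γ', S.IsCrossingPeriodicOrbit Γ' → Γ' = Γ) ∧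
      S.IsUnstable Γ := by
  obtain ⟨γ, T, ⟨hT, hsol, hper, -⟩, -, t₁, t₂, hsl, hl1, htan, hl2⟩ := h
  have harc1 := hl1.isArc hsol
  have harc2 := hl2.isArc hsol
  obtain ⟨e0, e1⟩ := hsl.vel_exit hsol hl1.2.1 harc1
  have hT0 : γ T = γ 0 := by simpa using hper 0
  have h00 : γ 0 ∈ S.attractiveRegion := hsl.2 0 ⟨le_rfl, hsl.1⟩
  have hend : γ T ∈ S.attractiveRegion := hT0 ▸ h00
  have q0 : S.vel s.opp (γ t₂) = 0 := by rw [vel, htan.2.1, mul_zero]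
  -- If the velocity of `s` vanished here too, it would vanish on the whole line, against the
  -- attractive segment, or both tangencies would coincide, against the negative opposite velocity
  -- at the exit.
  have q1 : S.vel s (γ t₂) < 0 := by
    refine lt_of_le_of_ne (harc1.vel_end_nonpos hl1.2.2.1) fun hz => ?_
    have h0 := (mem_attractiveRegion s).1 h00
    have d1 := S.vel_sub s hl1.2.1 h0.1
    have d2 := S.vel_sub s hl1.2.1 hl1.2.2.1
    have d3 := S.vel_sub s.opp hl1.2.1 hl1.2.2.1
    rw [e0, zero_add] at d1 d2
    rw [hz, eq_comm, mul_eq_zero] at d2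
    rcases d2 with d2 | d2
    · rw [d2, zero_mul] at d1
      linarith [h0.2.1]
    · rw [d2, mul_zero, add_zero, q0] at d3
      linarith
  have hv2 := harc2.visibleUnstable hl1.2.2.1 q0 hend.1 ((mem_attractiveRegion s).1 hend).2.2
  refine exists_unique_of_return (s := s.opp) hv2 (d := γ) hl1.2.1 ?_ e1 ?_ hl1.2.2.1 ?_
    harc2 hend hl1.2.2.1 q0 ?_
  all_goals rwa [Side.opp_opp]

theorem exists_unique_of_typeD {Γ : Set (Fin 2 → ℝ)} (h : S.IsTypeD s Γ) :
    ∃ Γ, S.IsCrossingPeriodicOrbit Γ ∧ (∀ Γ', S.IsCrossingPeriodicOrbit Γ' → Γ' = Γ) ∧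
      S.IsUnstable Γ := by
  obtain ⟨γ, T, ⟨hT, hsol, hper, -⟩, -, t₁, t₂, t₃, hsl, hl1, hsl', hl2⟩ := h
  have harc1 := hl1.isArc hsol
  have harc2 := hl2.isArc hsol
  obtain ⟨e0, e1⟩ := hsl.vel_exit hsol hl1.2.1 harc1
  obtain ⟨e0', e1'⟩ := hsl'.vel_exit hsol hl2.2.1 harc2
  rw [Side.opp_opp] at e1'
  have hT0 : γ T = γ 0 := by simpa using hper 0
  have hend : γ T ∈ S.attractiveRegion := by
    rw [hT0]
    exact hsl.2 0 ⟨le_rfl, hsl.1⟩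
  exact exists_unique_of_landings harc1 hl1.2.1 e0 e1 (hsl'.2 t₂ ⟨le_rfl, hsl'.1⟩) harc2 hl2.2.1
    e0' e1' hend

end PWLSystem


/-! ### The fixed point equation of a focus and a node -/

/-- A quartic whose constant, linear and leading coefficients are negative has no two positive
zeros to the right of a positive point where it is positive. -/
lemma quartic_nonpos {K₀ K₁ K₂ K₃ K₄ x y z : ℝ} (h0 : K₀ < 0) (h1 : K₁ < 0) (h4 : K₄ < 0)
    (hx : 0 < x) (hxy : x < y) (hyz : y < z)
    (hy : K₀ + K₁ * y + K₂ * y ^ 2 + K₃ * y ^ 3 + K₄ * y ^ 4 = 0)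
    (hz : K₀ + K₁ * z + K₂ * z ^ 2 + K₃ * z ^ 3 + K₄ * z ^ 4 = 0) :
    K₀ + K₁ * x + K₂ * x ^ 2 + K₃ * x ^ 3 + K₄ * x ^ 4 < 0 := by
  have hy0 : 0 < y := hx.trans hxy
  have hz0 : 0 < z := hy0.trans hyz
  have d1 : 0 < y - x := sub_pos.2 hxy
  have d2 : 0 < z - x := sub_pos.2 (hxy.trans hyz)
  have d3 : 0 < z - y := sub_pos.2 hyz
  -- The two zeros eliminate `K₂` and `K₃`; what remains involves only the coefficients of known
  -- sign.
  have key : (K₀ + K₁ * x + K₂ * x ^ 2 + K₃ * x ^ 3 + K₄ * x ^ 4) * (y ^ 2 * z ^ 2) =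
      (y - x) * (z - x) * (K₄ * (x * y * z) ^ 2 + K₁ * (x * y * z) +
        K₀ * (x * y + y * z + x * z)) := by
    apply mul_left_cancel₀ d3.ne'
    linear_combination (x ^ 2 * z ^ 2 * (z - x)) * hy - (x ^ 2 * y ^ 2 * (y - x)) * hz
  have hneg : K₄ * (x * y * z) ^ 2 + K₁ * (x * y * z) + K₀ * (x * y + y * z + x * z) < 0 := by
    have e1 := mul_neg_of_neg_of_pos h4 (show 0 < (x * y * z) ^ 2 by positivity)
    have e2 := mul_neg_of_neg_of_pos h1 (show 0 < x * y * z by positivity)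
    have e3 := mul_neg_of_neg_of_pos h0 (show 0 < x * y + y * z + x * z by positivity)
    linarith
  have h5 := mul_neg_of_pos_of_neg (mul_pos d1 d2) hneg
  rw [← key] at h5
  exact neg_of_mul_neg_left h5 (by positivity)

/-- The half return map of the node, as a function of the distance to its tangency. -/
noncomputable def nodeMap (c V : ℝ) : ℝ := -c + 4 * c * V / (4 * c + V)

lemma hasDerivAt_nodeMap {c V : ℝ} (hc : 0 < c) (hV : 0 ≤ V) :
    HasDerivAt (nodeMap c) ((4 * c) ^ 2 / (4 * c + V) ^ 2) V := by
  have hne : 4 * c + V ≠ 0 := by positivity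
  have h := ((((hasDerivAt_id V).const_mul (4 * c)).div
    ((hasDerivAt_id V).const_add (4 * c)) hne).const_add (-c))
  refine h.congr_deriv ?_
  simp only [id]
  field_simp
  ring

lemma strictMonoOn_nodeMap {c : ℝ} (hc : 0 < c) : StrictMonoOn (nodeMap c) (Ici 0) := by
  intro a ha b hb hab
  have ha' : 0 ≤ a := ha
  have hb' : 0 ≤ b := hb
  unfold nodeMap
  have : 4 * c * a / (4 * c + a) < 4 * c * b / (4 * c + b) := by
    rw [div_lt_div_iff₀ (by positivity) (by positivity)]
    nlinarith [mul_pos hc hc, mul_pos (mul_pos hc hc) (sub_pos.2 hab)]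
  linarith

lemma neg_lt_nodeMap {c V : ℝ} (hc : 0 < c) (hV : 0 < V) : -c < nodeMap c V := by
  have : 0 < 4 * c * V / (4 * c + V) := by positivity
  unfold nodeMap
  linarith

lemma nodeMap_lt {c V : ℝ} (hc : 0 < c) (hV : 0 ≤ V) : nodeMap c V < 3 * c := by
  unfold nodeMap
  have : 4 * c * V / (4 * c + V) < 4 * c := by
    rw [div_lt_iff₀ (by positivity)]
    nlinarith [mul_pos hc hc]
  linarith

lemma nodeMap_zero_right (c : ℝ) : nodeMap c (4 * c / 3) = 0 := by
  unfold nodeMap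
  field_simp
  ring

/-- The defect of the fixed point equation. -/
noncomputable def nodeDefect (c V : ℝ) : ℝ := focusPrim (-1) (c + V) - focusPrim 1 (nodeMap c V)

/-- The numerator of the derivative of the defect, up to sign. -/
noncomputable def nodeQuartic (c V : ℝ) : ℝ :=
  (V - c * (1 + V / (4 * c))) * (1 + (V + (c - 1)) ^ 2) -
    (V + c) * (1 + V / (4 * c)) * ((1 + V / (4 * c)) ^ 2 + (V - (c - 1) * (1 + V / (4 * c))) ^ 2)

lemma hasDerivAt_nodeDefect {c V : ℝ} (hc : 0 < c) (hV : 0 < V) :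
    ∃ k : ℝ, 0 < k ∧ HasDerivAt (nodeDefect c) (-nodeQuartic c V * k) V := by
  set q := 1 + V / (4 * c) with hq
  have hq0 : 0 < q := by positivity
  set D₁ := 1 + (V + (c - 1)) ^ 2 with hD₁
  set D₂ := q ^ 2 + (V - (c - 1) * q) ^ 2 with hD₂
  have hD₁0 : 0 < D₁ := by positivity
  have hD₂0 : 0 < D₂ := by positivity
  have hcV : 4 * c + V = 4 * c * q := by rw [hq]; field_simp
  have hn : nodeMap c V = (V - c * q) / q := by
    rw [nodeMap, hcV]; field_simp; ring
  have h1 : HasDerivAt (fun V => focusPrim (-1) (c + V))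
      ((c + V) / (1 + (c + V + -1) ^ 2) * 1) V :=
    (hasDerivAt_focusPrim (-1) (c + V)).comp V ((hasDerivAt_id V).const_add c)
  have h2 := (hasDerivAt_focusPrim 1 (nodeMap c V)).comp V (hasDerivAt_nodeMap hc hV.le)
  refine ⟨1 / (q * D₂ * D₁), by positivity, (h1.sub h2).congr_deriv ?_⟩
  have e1 : 1 + (c + V + -1) ^ 2 = D₁ := by rw [hD₁]; ring
  have e2 : 1 + (nodeMap c V + 1) ^ 2 = D₂ / q ^ 2 := by
    rw [hn, hD₂]; field_simp; ring
  rw [e1, e2, hn, hcV, nodeQuartic, ← hq, ← hD₁, ← hD₂]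
  field_simp
  ring

/-- Only the signs of the constant, linear and leading coefficients matter; the middle two may have
any sign. -/
lemma nodeQuartic_eq {c : ℝ} (hc : 0 < c) : ∃ K₀ K₁ K₂ K₃ K₄ : ℝ, K₀ < 0 ∧ K₁ < 0 ∧ K₄ < 0 ∧
    ∀ V, nodeQuartic c V = K₀ + K₁ * V + K₂ * V ^ 2 + K₃ * V ^ 3 + K₄ * V ^ 4 := by
  set a := 1 / (4 * c) with ha
  set e := c - 1 with he
  have ha0 : 0 < a := by positivity
  have hac : a * c = 1 / 4 := by rw [ha]; field_simp
  refine ⟨-2 * c * (1 + e ^ 2), -(1 + e ^ 2),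
    3 / 2 * e - c - c * (a ^ 2 + (1 - e * a) ^ 2) - 5 / 4 * (2 * (a - e * (1 - e * a))) -
      a * (1 + e ^ 2),
    3 / 4 - 5 / 4 * (a ^ 2 + (1 - e * a) ^ 2) - a * (2 * (a - e * (1 - e * a))),
    -(a * (a ^ 2 + (1 - e * a) ^ 2)), ?_, ?_, ?_, fun V => ?_⟩
  · have : 0 < 2 * c * (1 + e ^ 2) := by positivity
    linarith
  · have : 0 < 1 + e ^ 2 := by positivity
    linarith
  · have : 0 < a * (a ^ 2 + (1 - e * a) ^ 2) := by positivity
    linarith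
  · have hV : V / (4 * c) = a * V := by rw [ha]; ring
    rw [nodeQuartic, hV, ← he]
    linear_combination (-V * (1 + (V + e) ^ 2) - V * ((1 + a * V) ^ 2 + (V - e * (1 + a * V)) ^ 2)
      - 2 * V * (1 + e ^ 2)) * hac

/-- From `4c/3` on the node returns to a nonnegative coordinate, beyond the tangency of the focus,
and there the implicit equation of `focusMap` applies. -/
lemma nodeDefect_eq_iff {c V : ℝ} (hc : 0 < c) (hV : 4 * c / 3 ≤ V) :
    nodeDefect c V = 2 * Real.pi ↔ focusMap 1 (nodeMap c V) = c + V := by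
  have hV0 : 0 ≤ V := le_trans (by positivity) hV
  have hu : 0 ≤ nodeMap c V := by
    rw [← nodeMap_zero_right c]
    exact (strictMonoOn_nodeMap hc).monotoneOn (show 0 ≤ 4 * c / 3 by positivity) hV0 hV
  have h1 := focusPrim_focusMap one_pos hu
  constructor
  · intro h
    refine (eq_focusMap hu (by linarith) ?_).symm
    rw [nodeDefect] at h
    linarith
  · intro h
    rw [h] at h1
    rw [nodeDefect]
    linarith

/-- The return map of the focus and the node has exactly two fixed points beyond the
tangencies. -/
theorem exists_two_fixed {c : ℝ} (hc : 0 < c) (hr : focusMap 1 0 < 7 * c / 3) :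
    ∃ V₁ V₂, 4 * c / 3 < V₁ ∧ V₁ < V₂ ∧
      ∀ V, 4 * c / 3 < V → (focusMap 1 (nodeMap c V) = c + V ↔ V = V₁ ∨ V = V₂) := by
  have hdiff : ∀ V, 0 < V → DifferentiableAt ℝ (nodeDefect c) V := fun V hV => by
    obtain ⟨k, -, hk⟩ := hasDerivAt_nodeDefect hc hV
    exact hk.differentiableAt
  have hcont : ∀ a b, 0 < a → ContinuousOn (nodeDefect c) (Icc a b) := fun a b ha t ht =>
    (hdiff t (ha.trans_le ht.1)).continuousAt.continuousWithinAt
  have h43 : 0 < 4 * c / 3 := by positivity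
  -- At `4c/3` the node lands on the focus tangency, and by `hr` the focus then returns short of the
  -- starting point.
  have hA : 2 * Real.pi < nodeDefect c (4 * c / 3) := by
    have h1 := focusPrim_focusMap one_pos (le_refl (0 : ℝ))
    have h2 := strictMonoOn_focusPrim (-1) (focusMap_pos one_pos 0).le
      (show 0 ≤ 7 * c / 3 by positivity) hr
    rw [nodeDefect, nodeMap_zero_right, show c + 4 * c / 3 = 7 * c / 3 by ring]
    linarith
  -- At `4c` the node lands at `c`, and the focus expands by more than `exp π > 5`, hence beyond the
  -- starting point `5c`.
  have hB : nodeDefect c (4 * c) < 2 * Real.pi := by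
    have h1 := focusPrim_focusMap one_pos hc.le
    have h5 : 5 * c < focusMap 1 c := by
      have h3 := exp_mul_lt_focusMap one_pos hc.le
      have h4 : (5 : ℝ) < Real.exp (Real.pi * 1) := by
        have e1 : Real.exp 3 < Real.exp (Real.pi * 1) :=
          Real.exp_lt_exp.2 (by linarith [Real.pi_gt_three])
        have e2 : Real.exp 3 = Real.exp 1 ^ 3 := by rw [← Real.exp_nat_mul]; norm_num
        have e3 := Real.exp_one_gt_d9
        have e4 : (2 : ℝ) ^ 3 < Real.exp 1 ^ 3 := by gcongr; linarith
        rw [e2] at e1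
        linarith
      nlinarith
    have h2 := strictMonoOn_focusPrim (-1) (show 0 ≤ 5 * c by positivity)
      (focusMap_pos one_pos c).le h5
    have e : nodeMap c (4 * c) = c := by unfold nodeMap; field_simp; ring
    rw [nodeDefect, e, show c + 4 * c = 5 * c by ring]
    linarith
  -- The node map stays below `3c`, so for large `V` the unbounded primitive wins.
  obtain ⟨W, hW4, hW⟩ : ∃ W, 4 * c < W ∧ 2 * Real.pi < nodeDefect c W := by
    have h1 : Tendsto (fun V => focusPrim (-1) (c + V)) atTop atTop :=
      (tendsto_focusPrim (-1)).comp (tendsto_atTop_add_const_left _ c tendsto_id)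
    obtain ⟨W, hW1, hW2⟩ := ((h1.eventually_gt_atTop (2 * Real.pi + focusPrim 1 (3 * c))).and
      (eventually_gt_atTop (4 * c))).exists
    refine ⟨W, hW2, ?_⟩
    have hW0 : 0 ≤ W := by linarith
    have hn : 0 ≤ nodeMap c W := by
      rw [← nodeMap_zero_right c]
      exact (strictMonoOn_nodeMap hc).monotoneOn h43.le hW0 (by linarith)
    have h2 := strictMonoOn_focusPrim 1 hn (show 0 ≤ 3 * c by positivity) (nodeMap_lt hc hW0)
    rw [nodeDefect]
    linarith
  obtain ⟨V₁, hV₁, hE₁⟩ := intermediate_value_Ioo' (show 4 * c / 3 ≤ 4 * c by linarith)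
    (hcont _ _ h43) ⟨hB, hA⟩
  obtain ⟨V₂, hV₂, hE₂⟩ := intermediate_value_Ioo hW4.le
    (hcont _ _ (by positivity)) ⟨hB, hW⟩
  -- The defect falls from above `2π` at `4c/3` to `2π` at `x`, so the quartic is positive somewhere
  -- before `x`. Three solutions would add two zeros of the quartic to the right, which its signs
  -- exclude.
  have no3 : ∀ x y z, 4 * c / 3 < x → x < y → y < z → nodeDefect c x = 2 * Real.pi →
      nodeDefect c y = 2 * Real.pi → nodeDefect c z = 2 * Real.pi → False := by
    intro x y z hx hxy hyz ex ey ez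
    obtain ⟨K₀, K₁, K₂, K₃, K₄, h0, h1, h4, hN⟩ := nodeQuartic_eq hc
    have hrolle : ∀ a b, 0 < a → a < b → nodeDefect c a = nodeDefect c b →
        ∃ ξ ∈ Ioo a b, nodeQuartic c ξ = 0 := by
      intro a b ha hab he
      obtain ⟨ξ, hξ, hd⟩ := exists_deriv_eq_zero hab (hcont a b ha) he
      obtain ⟨k, hk, hd'⟩ := hasDerivAt_nodeDefect hc (ha.trans hξ.1)
      rw [hd'.deriv, mul_eq_zero, or_iff_left hk.ne', neg_eq_zero] at hd
      exact ⟨ξ, hξ, hd⟩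
    obtain ⟨ξ₁, hξ₁, hz₁⟩ := hrolle x y (h43.trans hx) hxy (ex.trans ey.symm)
    obtain ⟨ξ₂, hξ₂, hz₂⟩ := hrolle y z (h43.trans (hx.trans hxy)) hyz (ey.trans ez.symm)
    obtain ⟨ξ₀, hξ₀, hd⟩ := exists_deriv_eq_slope (nodeDefect c) hx (hcont _ _ h43)
      fun t ht => (hdiff t (h43.trans ht.1)).differentiableWithinAt
    obtain ⟨k, hk, hd'⟩ := hasDerivAt_nodeDefect hc (h43.trans hξ₀.1)
    rw [hd'.deriv, ex] at hd
    have hneg : (2 * Real.pi - nodeDefect c (4 * c / 3)) / (x - 4 * c / 3) < 0 :=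
      div_neg_of_neg_of_pos (by linarith) (by linarith)
    rw [← hd] at hneg
    have hpos := neg_of_mul_neg_left hneg hk.le
    rw [hN] at hz₁ hz₂ hpos
    have := quartic_nonpos h0 h1 h4 (h43.trans hξ₀.1) (hξ₀.2.trans hξ₁.1) (hξ₁.2.trans hξ₂.1)
      hz₁ hz₂
    linarith
  refine ⟨V₁, V₂, hV₁.1, hV₁.2.trans hV₂.1, fun V hV => ?_⟩
  rw [← nodeDefect_eq_iff hc hV.le]
  have h12 := hV₁.2.trans hV₂.1
  constructor
  · intro hE
    by_contra hcon
    push Not at hcon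
    rcases lt_or_gt_of_ne hcon.1 with h | h
    · exact no3 _ _ _ hV h h12 hE hE₁ hE₂
    · rcases lt_or_gt_of_ne hcon.2 with h' | h'
      · exact no3 _ _ _ hV₁.1 h h' hE₁ hE hE₂
      · exact no3 _ _ _ hV₁.1 h12 h' hE₁ hE₂ hE
  · rintro (rfl | rfl)
    · exact hE₁
    · exact hE₂


/-! ### The focus–node system and its half return maps -/

namespace PWLSystem

/-- An unstable focus in the right half plane, with its tangency at the origin, and a node of the
left field with an invisible tangency at `(0, -c)`. -/
noncomputable def focusNode (c : ℝ) : PWLSystem where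
  A := fun
    | .right => !![2, 1; -2, 0]
    | .left => !![-3 / (4 * c), 1; -1 / (8 * c ^ 2), 0]
  b := fun
    | .right => ![0, 2]
    | .left => ![c, 2]

variable {c : ℝ}

lemma focusNode_field_right (c : ℝ) (z : Fin 2 → ℝ) :
    (focusNode c).field .right z = ![2 * z 0 + z 1, -2 * z 0 + 2] := by
  funext i
  fin_cases i <;> simp [field_zero, field_one, focusNode]

lemma focusNode_field_left (c : ℝ) (z : Fin 2 → ℝ) :
    (focusNode c).field .left z = ![-3 / (4 * c) * z 0 + z 1 + c, -1 / (8 * c ^ 2) * z 0 + 2] := by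
  funext i
  fin_cases i <;> simp [field_zero, field_one, focusNode]

lemma nondegenerate_focusNode (hc : 0 < c) : (focusNode c).Nondegenerate := by
  rintro (_ | _)
  · simp [focusNode]
  · simp [focusNode, hc.ne']

lemma visibleUnstable_focusNode (c : ℝ) : (focusNode c).VisibleUnstable .right := by
  refine ⟨?_, ?_, ?_⟩ <;> norm_num [tr, dt, kap, focusNode, Side.sgn]

lemma gam_focusNode (c : ℝ) : (focusNode c).gam .right = 1 := by
  norm_num [gam, om, tr, dt, focusNode]

/-- The orbit of the node that starts on the switching line at distance `V` from the tangency. -/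
noncomputable def nodeFlow (c V : ℝ) : ℝ → Fin 2 → ℝ :=
  (focusNode c).lift .left
    (fun t => (1 - Real.exp (-(1 / (4 * c)) * t)) *
      (-(16 * c ^ 2) + (16 * c ^ 2 + 4 * c * V) * Real.exp (-(1 / (4 * c)) * t)))
    (fun t => -(1 / (4 * c)) * Real.exp (-(1 / (4 * c)) * t) *
      ((32 * c ^ 2 + 4 * c * V) - 2 * (16 * c ^ 2 + 4 * c * V) * Real.exp (-(1 / (4 * c)) * t)))

lemma focusNode_A_left (c : ℝ) : (focusNode c).A .left 0 1 ≠ 0 := by simp [focusNode]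

/-- The eigenvalues are `l = -1/(4c)` and `2l`, so the distance is a quadratic polynomial in `exp (l
t)`, with an explicit second root; this is why the return map is a Möbius map. -/
lemma isFlow_nodeFlow (hc : 0 < c) (V : ℝ) : (focusNode c).IsFlow .left (nodeFlow c V) := by
  set l := -(1 / (4 * c)) with hl
  have hlc : l * (4 * c) = -1 := by rw [hl]; field_simp
  refine isFlow_lift (focusNode_A_left c) (fun t => ?_) fun t => ?_
  · have hE := hasDerivAt_exp_mul l t
    refine ((hE.const_sub 1).mul ((hE.const_mul (16 * c ^ 2 + 4 * c * V)).const_add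
      (-(16 * c ^ 2)))).congr_deriv ?_
    ring
  · have hE := hasDerivAt_exp_mul l t
    refine ((hE.const_mul l).mul ((hE.const_mul (2 * (16 * c ^ 2 + 4 * c * V))).const_sub
      (32 * c ^ 2 + 4 * c * V))).congr_deriv ?_
    have h1 : (focusNode c).tr .left = 3 * l := by simp [tr, focusNode, hl]; ring
    have h2 : (focusNode c).dt .left = 2 * l ^ 2 := by
      simp [dt, focusNode, hl]
      field_simp
      norm_num
    have h3 : (focusNode c).kap .left = -2 := by norm_num [kap, focusNode, Side.sgn]
    rw [h1, h2, h3]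
    linear_combination (2 - 8 * l * c) * hlc

/-- The half return map of the node. -/
noncomputable def nodeHalf (hc : 0 < c) : HalfReturn (focusNode c) .left 1 where
  p := c
  m := 1
  m_pos := one_pos
  vel_eq := by
    intro z hz
    rw [PWLSystem.vel_eq, mem_switchingLine.1 hz]
    simp [focusNode, Side.sgn, Side.crd]
    ring
  h v := nodeMap c (v - c)
  flow v := nodeFlow c (v - c)
  τ v := 4 * c * Real.log (1 + (v - c) / (4 * c))
  dom := Ioi c
  isFlow v := isFlow_nodeFlow hc _
  flow_zero v := by
    funext i
    fin_cases i
    · simp [nodeFlow, lift, Side.pt]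
    · simp [nodeFlow, lift, Side.pt, focusNode, Side.sgn]
      field_simp
      ring
  mem_dom v hv := hv
  le_of_mem v hv := le_of_lt hv
  -- At the tangency the distance is `-16 c² (1 - E)²`, so its orbit never enters the left half
  -- plane and the domain is an open ray.
  notMem := by
    intro _ t ht
    rw [Side.mem_region, nodeFlow, sgn_mul_lift, sub_self] at ht
    set E := Real.exp (-(1 / (4 * c)) * t)
    nlinarith [mul_nonneg (sq_nonneg c) (sq_nonneg (1 - E))]
  τ_pos v hv := by
    have hv' : 0 < v - c := sub_pos.2 hv
    have : 0 < Real.log (1 + (v - c) / (4 * c)) :=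
      Real.log_pos (by linarith [div_pos hv' (show 0 < 4 * c by positivity)])
    positivity
  region := by
    intro v hv t ht
    have hv' : 0 < v - c := sub_pos.2 hv
    rw [Side.mem_region, nodeFlow, sgn_mul_lift]
    have hq : 0 < 1 + (v - c) / (4 * c) := by positivity
    have h1 : Real.exp (-(1 / (4 * c)) * t) < 1 := by
      rw [Real.exp_lt_one_iff]
      have : 0 < 1 / (4 * c) * t := mul_pos (by positivity) ht.1
      linarith
    -- The distance is positive exactly while the exponential lies between the two roots, of which
    -- this inverse is the smaller.
    have h2 : (1 + (v - c) / (4 * c))⁻¹ < Real.exp (-(1 / (4 * c)) * t) := by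
      rw [← Real.exp_log (inv_pos.2 hq), Real.exp_lt_exp, Real.log_inv]
      have := ht.2
      have h3 : 1 / (4 * c) * t < Real.log (1 + (v - c) / (4 * c)) := by
        rw [one_div, inv_mul_lt_iff₀ (by positivity)]
        exact this
      linarith
    rw [inv_lt_iff_one_lt_mul₀' hq] at h2
    refine mul_pos (sub_pos.2 h1) ?_
    have e : (16 * c ^ 2 + 4 * c * (v - c)) = 16 * c ^ 2 * (1 + (v - c) / (4 * c)) := by
      field_simp
      ring
    rw [e, mul_assoc]
    have : 0 < 16 * c ^ 2 := by positivity
    nlinarith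
  flow_τ := by
    intro v hv
    have hv' : 0 < v - c := sub_pos.2 hv
    have hq : 0 < 1 + (v - c) / (4 * c) := by positivity
    have hE : Real.exp (-(1 / (4 * c)) * (4 * c * Real.log (1 + (v - c) / (4 * c)))) =
        4 * c / (4 * c + (v - c)) := by
      rw [show -(1 / (4 * c)) * (4 * c * Real.log (1 + (v - c) / (4 * c))) =
        -Real.log (1 + (v - c) / (4 * c)) by field_simp, Real.exp_neg, Real.exp_log hq]
      field_simp
    have hne : 4 * c + (v - c) ≠ 0 := by positivity
    have hne' : 3 * c + v ≠ 0 := by convert hne using 1; ring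
    refine eq_of_vel_eq (focusNode_A_left c) ?_ ?_
    · rw [mem_switchingLine.1 (Side.pt_mem _ _ _)]
      simp only [nodeFlow, lift, Matrix.cons_val_zero, hE]
      field_simp
      ring
    · rw [nodeFlow, vel_lift (focusNode_A_left c), hE, PWLSystem.vel_eq]
      simp [focusNode, Side.sgn, Side.pt, Side.opp, nodeMap]
      field_simp
      ring
  neg_lt v hv := neg_lt_nodeMap hc (sub_pos.2 hv)
  mono := by
    intro a ha b hb hab
    exact strictMonoOn_nodeMap hc (mem_Ici.2 (sub_nonneg.2 ha)) (mem_Ici.2 (sub_nonneg.2 hb))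
      (sub_lt_sub_right hab c)

/-- The half return maps of the focus and the node. -/
noncomputable def focusNodeReturn (hc : 0 < c) : ReturnMap (focusNode c) where
  ε := 1
  hε := by norm_num
  H := fun
    | .right => focusHalf (visibleUnstable_focusNode c) (by norm_num) (by simp [focusNode])
    | .left => nodeHalf hc
  gap := by
    rintro (_ | _) <;> simp [focusHalf, nodeHalf, Side.opp, focusNode, hc]

variable (hc : 0 < c)

lemma focusNodeReturn_p_right : (focusNodeReturn hc).p .right = 0 := by
  simp [ReturnMap.p, focusNodeReturn, focusHalf, focusNode]

lemma focusNodeReturn_p_left : (focusNodeReturn hc).p .left = c := rfl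

lemma focusNodeReturn_h_right : (focusNodeReturn hc).h .right = focusMap 1 := by
  funext u
  have hg := gam_focusNode c
  have h1 : (focusNode c).nst .right = 1 := by norm_num [nst, dt, kap, focusNode, Side.sgn]
  have h2 : (focusNode c).om .right = 1 := by norm_num [om, tr, dt, focusNode]
  have h3 : (focusNode c).A .right 0 1 = 1 := by simp [focusNode]
  have h4 : (focusNode c).b .right 0 = 0 := by simp [focusNode]
  simp [ReturnMap.h, focusNodeReturn, focusHalf, hg, h1, h2, h3, h4]

lemma focusNodeReturn_h_left (v : ℝ) : (focusNodeReturn hc).h .left v = nodeMap c (v - c) := rfl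

lemma focusNodeReturn_crd_right (z : Fin 2 → ℝ) : (focusNodeReturn hc).crd .right z = z 1 := by
  simp [ReturnMap.crd, Side.crd, Side.sgn, focusNodeReturn]

lemma focusNodeReturn_crd_left (z : Fin 2 → ℝ) : (focusNodeReturn hc).crd .left z = -z 1 := by
  simp [ReturnMap.crd, Side.crd, Side.sgn, focusNodeReturn]

lemma focusNodeReturn_dom_left {v : ℝ} :
    v ∈ ((focusNodeReturn hc).H .left).dom ↔ c < v := Iff.rfl

lemma focusNodeReturn_dom_right {u : ℝ} :
    u ∈ ((focusNodeReturn hc).H .right).dom ↔ 0 ≤ u := by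
  simp [focusNodeReturn, focusHalf, focusNode]

end PWLSystem


/-! ### Exactly two crossing periodic orbits -/

namespace PWLSystem

variable {c : ℝ}

theorem encard_crossing_focusNode (hc : 0 < c) (hr : focusMap 1 0 < 7 * c / 3) :
    {Γ | (focusNode c).IsCrossingPeriodicOrbit Γ}.encard = 2 := by
  set R := focusNodeReturn hc
  obtain ⟨V₁, V₂, h1, h12, hV⟩ := exists_two_fixed hc hr
  have h43 : 0 < 4 * c / 3 := by positivity
  have hfix : ∀ V, 4 * c / 3 < V → focusMap 1 (nodeMap c V) = c + V →
      R.p .left < c + V ∧ R.p Side.left.opp < R.h .left (c + V) ∧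
        R.h Side.left.opp (R.h .left (c + V)) = c + V := by
    intro V hV hE
    have e1 : R.h .left (c + V) = nodeMap c V := by
      rw [focusNodeReturn_h_left, add_sub_cancel_left]
    refine ⟨?_, ?_, ?_⟩
    · rw [focusNodeReturn_p_left]
      linarith
    · change R.p .right < _
      rw [e1, focusNodeReturn_p_right, ← nodeMap_zero_right c]
      exact strictMonoOn_nodeMap hc h43.le (h43.trans hV).le hV
    · change R.h .right _ = _
      rw [e1, focusNodeReturn_h_right, hE]
  have hf₁ := hfix V₁ h1 ((hV V₁ h1).2 (Or.inl rfl))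
  have hf₂ := hfix V₂ (h1.trans h12) ((hV V₂ (h1.trans h12)).2 (Or.inr rfl))
  have hset : {Γ | (focusNode c).IsCrossingPeriodicOrbit Γ} =
      {R.orb .left (c + V₁), R.orb .left (c + V₂)} := by
    apply Subset.antisymm
    · intro Γ hΓ
      obtain ⟨v, hv1, hv2, hv3, rfl⟩ := R.exists_fixed_of_crossing .left hΓ
      change R.p .right ≤ _ at hv2
      change R.h .right _ = _ at hv3
      rw [focusNodeReturn_p_left] at hv1
      rw [focusNodeReturn_p_right, focusNodeReturn_h_left, ← nodeMap_zero_right c] at hv2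
      rw [focusNodeReturn_h_right, focusNodeReturn_h_left] at hv3
      have hle : 4 * c / 3 ≤ v - c :=
        ((strictMonoOn_nodeMap hc).le_iff_le h43.le (sub_nonneg.2 hv1 : (0 : ℝ) ≤ v - c)).1 hv2
      -- A crossing orbit through the focus tangency would force `focusMap 1 0 = 7c/3`.
      have hlt : 4 * c / 3 < v - c := by
        refine lt_of_le_of_ne hle fun e => ?_
        rw [← e, nodeMap_zero_right] at hv3
        linarith
      have e : v = c + (v - c) := by ring
      rw [e]
      rcases (hV _ hlt).1 (by rw [hv3]; ring) with h | h <;> rw [h]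
      · exact Or.inl rfl
      · exact Or.inr rfl
    · rintro Γ (rfl | rfl)
      · exact ReturnMap.isCrossingPeriodicOrbit_orb hf₁.1 hf₁.2.1 hf₁.2.2
      · exact ReturnMap.isCrossingPeriodicOrbit_orb hf₂.1 hf₂.2.1 hf₂.2.2
  -- The two orbits differ because each one meets the part of the line beyond the left tangency in a
  -- single point.
  rw [hset, encard_pair]
  intro heq
  have hm : R.pt .left (c + V₁) ∈ R.orb .left (c + V₁) := by
    refine Or.inl ⟨0, ⟨le_rfl, ?_⟩, (R.H .left).flow_zero _⟩
    exact ((R.H .left).τ_pos _ ((R.H .left).mem_dom _ hf₁.1)).le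
  rw [heq] at hm
  rcases ReturnMap.orb_inter_switchingLine hf₂.1 hf₂.2.1 hf₂.2.2 ⟨hm, R.pt_mem _ _⟩ with h | h
  · have := congrArg (R.crd .left) h
    rw [R.crd_pt, R.crd_pt] at this
    linarith
  · have := congrArg (R.crd .left) h
    rw [R.pt_opp, R.crd_pt, R.crd_pt] at this
    have h3 := hf₂.2.1
    change R.p .right < _ at h3
    rw [focusNodeReturn_p_right] at h3
    linarith

end PWLSystem


/-! ### Sliding with constant velocity and recurrent periodic curves -/

namespace PWLSystem

variable {S : PWLSystem} {s : Side} {γ : ℝ → Fin 2 → ℝ} {k : ℝ}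

/-- A solution runs through one half plane, or slides, for some time after every instant. -/
lemma IsSolutionOn.exists_next (h : S.IsSolutionOn γ univ) (a : ℝ) :
    ∃ b, a < b ∧ ((∃ s, S.IsArc s γ a b) ∨
      ∀ t ∈ Ioo a b, γ t ∈ S.slidingRegion ∧ HasDerivAt γ (S.slidingField (γ t)) t) := by
  obtain ⟨D, hD, hreg, -⟩ := h.exists_break
  obtain ⟨δ, hδ, hfree⟩ := exists_Ioo_notMem hD a
  exact ⟨a + δ, by linarith, h.exists_isArc_or_slides (by linarith) (subset_univ _)
    fun t ht => hreg t (by simp) (hfree t ht)⟩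

lemma slide_eq (hk : ∀ z ∈ switchingLine, S.slidingField z = ![0, k]) {a b : ℝ} (hab : a < b)
    (hc : Continuous γ)
    (hs : ∀ t ∈ Ioo a b, γ t ∈ S.slidingRegion ∧ HasDerivAt γ (S.slidingField (γ t)) t) :
    γ b 1 = γ a 1 + k * (b - a) := by
  obtain ⟨ξ, hξ, hd⟩ := exists_hasDerivAt_eq_slope (fun t => γ t 1) (fun _ => k) hab
    ((continuous_apply 1).comp hc).continuousOn fun t ht => by
      obtain ⟨h1, h2⟩ := hs t ht
      rw [hk _ h1.1] at h2
      simpa using hasDerivAt_pi.1 h2 1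
  rw [eq_div_iff (sub_pos.2 hab).ne'] at hd
  linarith

/-- A solution slides with constant speed as long as it is in the interior of the sliding
region. -/
lemma IsSolutionOn.slides (h : S.IsSolutionOn γ univ)
    (hk : ∀ z ∈ switchingLine, S.slidingField z = ![0, k]) {a b : ℝ} (h0 : γ a ∈ switchingLine)
    (hint : ∀ t ∈ Ico a b, ![0, γ a 1 + k * (t - a)] ∈ S.slidingInterior) :
    ∀ t ∈ Icc a b, γ t = ![0, γ a 1 + k * (t - a)] := by
  have hc : Continuous γ := continuousOn_univ.1 h.1
  set K := {t | γ t = ![0, γ a 1 + k * (t - a)]} with hK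
  have hcl : IsClosed K := by
    refine isClosed_eq hc (continuous_pi fun i => ?_)
    fin_cases i
    · simpa using continuous_const
    · simp only [Fin.mk_one, Matrix.cons_val_one, Matrix.cons_val_zero]
      fun_prop
  have ha : a ∈ K := by
    funext i
    fin_cases i
    · simpa using mem_switchingLine.1 h0
    · simp
  -- Continuous induction: from a time at which the formula holds the point is in the sliding
  -- interior, so the solution slides for a moment and the formula persists.
  refine (hcl.inter isClosed_Icc).Icc_subset_of_forall_exists_gt ha ?_
  rintro x ⟨hx, hxa⟩ y hy
  have hxi : γ x ∈ S.slidingInterior := by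
    rw [show γ x = _ from hx]
    exact hint x hxa
  obtain ⟨b', hb', hnext⟩ := h.exists_next x
  have hev := h.2.2 x trivial hxi
  obtain ⟨w, hw, hwS⟩ := mem_nhdsGT_iff_exists_Ioo_subset.1 hev
  have hw' : x < w := hw
  rcases hnext with ⟨s, hs⟩ | hs
  · exfalso
    have hm : (x + min b' w) / 2 ∈ Ioo x (min b' w) := by
      have := lt_min hb' hw'
      exact ⟨by linarith, by linarith⟩
    exact Side.notMem_switchingLine (hs.2.2 _ ⟨hm.1, hm.2.trans_le (min_le_left _ _)⟩).1
      (hwS ⟨hm.1, hm.2.trans_le (min_le_right _ _)⟩)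
  · have hxy : x < min b' (min w y) := lt_min hb' (lt_min hw' hy)
    set u := (x + min b' (min w y)) / 2 with hu
    have hu1 : x < u := by linarith
    have hu2 : u < min b' (min w y) := by linarith
    have hub : u < b' := hu2.trans_le (min_le_left _ _)
    have huw : u < w := hu2.trans_le ((min_le_right _ _).trans (min_le_left _ _))
    have huy : u < y := hu2.trans_le ((min_le_right _ _).trans (min_le_right _ _))
    refine ⟨u, ?_, hu1, huy.le⟩
    have e := slide_eq hk hu1 hc fun t ht => hs t ⟨ht.1, ht.2.trans hub⟩
    have e0 : γ x 1 = γ a 1 + k * (x - a) := by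
      have := congrFun (show γ x = _ from hx) 1
      simpa using this
    have e1 : γ u 0 = 0 := hwS ⟨hu1, huw⟩
    funext i
    fin_cases i
    · simpa using e1
    · simp only [Fin.mk_one, Matrix.cons_val_one, Matrix.cons_val_zero]
      rw [e, e0]
      ring

/-- A solution that stays on the switching line for some time slides through the interior of the
sliding region. -/
lemma IsSolutionOn.exists_between (h : S.IsSolutionOn γ univ)
    (hk : ∀ z ∈ switchingLine, S.slidingField z = ![0, k]) {a b : ℝ} (hab : a < b)
    (hs : ∀ t ∈ Icc a b, γ t ∈ switchingLine) :
    ∃ t₁ t t₂, t₁ < t ∧ t < t₂ ∧ γ t₁ ∈ S.slidingRegion ∧ γ t ∈ switchingLine ∧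
      γ t₂ ∈ S.slidingRegion ∧ γ t 1 = γ t₁ 1 + k * (t - t₁) ∧ γ t₂ 1 = γ t 1 + k * (t₂ - t) := by
  have hc : Continuous γ := continuousOn_univ.1 h.1
  obtain ⟨b', hb', hnext⟩ := h.exists_next a
  have hm : a < min b b' := lt_min hab hb'
  set d := min b b' - a with hd
  have hd0 : 0 < d := by linarith
  have hle1 : a + d ≤ b := by rw [hd]; linarith [min_le_left b b']
  have hle2 : a + d ≤ b' := by rw [hd]; linarith [min_le_right b b']
  rcases hnext with ⟨s, harc⟩ | hsl
  · exfalso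
    exact Side.notMem_switchingLine (harc.2.2 (a + d / 2) ⟨by linarith, by linarith⟩).1
      (hs _ ⟨by linarith, by linarith⟩)
  · refine ⟨a + d / 4, a + d / 2, a + 3 * d / 4, by linarith, by linarith,
      (hsl _ ⟨by linarith, by linarith⟩).1, hs _ ⟨by linarith, by linarith⟩,
      (hsl _ ⟨by linarith, by linarith⟩).1, ?_, ?_⟩
    · exact slide_eq hk (by linarith) hc fun t ht => hsl t ⟨by linarith [ht.1], by linarith [ht.2]⟩
    · exact slide_eq hk (by linarith) hc fun t ht => hsl t ⟨by linarith [ht.1], by linarith [ht.2]⟩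

/-- A periodic curve that runs through the set `X` in the time `τ` whenever it is at `z`, and
comes back to `z`, has the range `X`. -/
lemma range_eq_of_recurrent {T τ : ℝ} (hT : 0 < T) (hper : Function.Periodic γ T) (hτ : 0 < τ)
    {z : Fin 2 → ℝ} {X : Set (Fin 2 → ℝ)} {t₀ : ℝ} (h0 : γ t₀ = z)
    (hrec : ∀ t, γ t = z → γ '' Icc t (t + τ) = X ∧ γ (t + τ) = z) : range γ = X := by
  have hz : ∀ n : ℕ, γ (t₀ + n * τ) = z := by
    intro n
    induction n with
    | zero => simpa using h0
    | succ n ih =>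
      have := (hrec _ ih).2
      rwa [show t₀ + n * τ + τ = t₀ + (n + 1 : ℕ) * τ by push_cast; ring] at this
  apply Subset.antisymm
  · rintro _ ⟨t, rfl⟩
    obtain ⟨N, hN⟩ := exists_nat_add_mul_gt hT t t₀
    rw [← hper.nat_mul N t]
    set w := t + N * T
    have hq : 0 ≤ (w - t₀) / τ := div_nonneg (by linarith) hτ.le
    have h1 := Nat.floor_le hq
    have h2 := Nat.lt_floor_add_one ((w - t₀) / τ)
    rw [le_div_iff₀ hτ] at h1
    rw [div_lt_iff₀ hτ] at h2
    rw [← (hrec _ (hz ⌊(w - t₀) / τ⌋₊)).1]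
    exact ⟨w, ⟨by linarith, by linarith⟩, rfl⟩
  · rw [← (hrec _ h0).1]
    exact image_subset_range _ _

end PWLSystem


/-! ### Sliding motion in the focus–node system -/

namespace PWLSystem

section

variable {S : PWLSystem} {s : Side} {γ : ℝ → Fin 2 → ℝ} {T : ℝ}

lemma reverse_slidingRegion (S : PWLSystem) : S.reverse.slidingRegion = S.slidingRegion := by
  ext z
  rw [mem_slidingRegion .right, mem_slidingRegion .right, reverse_vel, reverse_vel, neg_mul_neg]

lemma reverse_slidingInterior (S : PWLSystem) : S.reverse.slidingInterior = S.slidingInterior := by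
  simp only [slidingInterior, reverse_slidingRegion]

/-- A periodic solution that leaves the switching line comes back to it. -/
lemma IsPeriodicSolution.exists_arc (h : S.IsPeriodicSolution γ T) {a b : ℝ}
    (ha : γ a ∈ switchingLine) (hab : a < b) (hfree : ∀ t ∈ Ioo a b, γ t ∉ switchingLine) :
    ∃ s e, S.IsArc s γ a e ∧ γ e ∈ switchingLine := by
  obtain ⟨hT, hsol, hper, -⟩ := h
  obtain ⟨e, h1, -, h2, h3⟩ := exists_next_time (continuousOn_univ.1 hsol.1).continuousOn
    (sub_pos.2 hab) (by simpa using hfree) (show a < a + T by linarith) (by rw [hper]; exact ha)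
  obtain ⟨s, hs⟩ := hsol.exists_isArc h1 (subset_univ _) h3
  exact ⟨s, e, hs, h2⟩

/-- Nonzero sliding speed makes any stay on the line a nontrivial segment. -/
lemma IsPeriodicSolution.isForwardSliding (h : S.IsPeriodicSolution γ T) {k : ℝ} (hk0 : k ≠ 0)
    (hk : ∀ z ∈ switchingLine, S.slidingField z = ![0, k]) {a b : ℝ} (hab : a < b)
    (hs : ∀ t ∈ Ico a b, γ t ∈ switchingLine) : S.IsForwardSlidingPeriodicOrbit (range γ) := by
  refine ⟨γ, T, h, rfl, ?_⟩
  obtain ⟨e, he, hnext⟩ := h.2.1.exists_next a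
  have hm : a < min b e := lt_min hab he
  have hm1 : (a + min b e) / 2 < b := by linarith [min_le_left b e]
  have hm2 : (a + min b e) / 2 < e := by linarith [min_le_right b e]
  refine ⟨a, (a + min b e) / 2, by linarith, ?_, fun t ht => hs t ⟨ht.1, by linarith [ht.2]⟩⟩
  rcases hnext with ⟨s, hs'⟩ | hs'
  · exact absurd (hs _ ⟨by linarith, hm1⟩)
      (Side.notMem_switchingLine (hs'.2.2 _ ⟨by linarith, hm2⟩).1)
  · intro heq
    have h1 := slide_eq hk (show a < (a + min b e) / 2 by linarith) (continuousOn_univ.1 h.2.1.1)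
      fun t ht => hs' t ⟨ht.1, ht.2.trans hm2⟩
    rw [← heq, left_eq_add, mul_eq_zero] at h1
    rcases h1 with h1 | h1
    · exact hk0 h1
    · linarith

end

variable {c : ℝ}

/-- Both fields have second component `2` on the line, and the difference of the first components is
the constant `c`, so sliding has constant speed. -/
lemma slidingField_focusNode (hc : 0 < c) {z : Fin 2 → ℝ} (hz : z ∈ switchingLine) :
    (focusNode c).slidingField z = ![0, 2] := by
  have hz0 := mem_switchingLine.1 hz
  have hne : (focusNode c).field .left z 0 ≠ (focusNode c).field .right z 0 := by
    simp [focusNode_field_left, focusNode_field_right, hz0, hc.ne']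
  rw [slidingField, if_pos hne, filippovField, focusNode_field_left, focusNode_field_right]
  funext i
  fin_cases i
  · simp [hz0, mul_comm]
  · simp [hz0]
    field_simp
    ring

lemma slidingField_reverse_focusNode (hc : 0 < c) {z : Fin 2 → ℝ} (hz : z ∈ switchingLine) :
    (focusNode c).reverse.slidingField z = ![0, -2] := by
  have hz0 := mem_switchingLine.1 hz
  have hne : (focusNode c).reverse.field .left z 0 ≠ (focusNode c).reverse.field .right z 0 := by
    simp [reverse_field, focusNode_field_left, focusNode_field_right, hz0, hc.ne']
  rw [slidingField, if_pos hne, filippovField, reverse_field, reverse_field, focusNode_field_left,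
    focusNode_field_right]
  funext i
  fin_cases i
  · simp [hz0, mul_comm]
  · simp [hz0]
    have : -c + -z 1 + z 1 ≠ 0 := by simpa using hc.ne'
    field_simp
    ring

lemma mem_slidingRegion_focusNode (hc : 0 < c) {z : Fin 2 → ℝ} :
    z ∈ (focusNode c).slidingRegion ↔ z ∈ switchingLine ∧ -c ≤ z 1 ∧ z 1 ≤ 0 := by
  constructor
  · intro h
    have h1 := ((focusNodeReturn hc).mem_slidingRegion .right h.1).1 h
    change _ ∧ (focusNodeReturn hc).crd .left z ≤ (focusNodeReturn hc).p .left at h1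
    rw [focusNodeReturn_crd_right, focusNodeReturn_p_right, focusNodeReturn_crd_left,
      focusNodeReturn_p_left] at h1
    exact ⟨h.1, by linarith [h1.2], h1.1⟩
  · rintro ⟨h, h1, h2⟩
    rw [(focusNodeReturn hc).mem_slidingRegion .right h]
    change _ ∧ (focusNodeReturn hc).crd .left z ≤ (focusNodeReturn hc).p .left
    rw [focusNodeReturn_crd_right, focusNodeReturn_p_right, focusNodeReturn_crd_left,
      focusNodeReturn_p_left]
    exact ⟨h2, by linarith⟩

lemma mem_attractiveRegion_focusNode {y : ℝ} (h1 : -c < y) (h2 : y < 0) :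
    ![0, y] ∈ (focusNode c).attractiveRegion := by
  simp [attractiveRegion, focusNode_field_left, focusNode_field_right, switchingLine, h2]
  linarith

lemma mem_slidingInterior_focusNode {y : ℝ} (h1 : -c < y) (h2 : y < 0) :
    ![0, y] ∈ (focusNode c).slidingInterior := by
  have h := (mem_attractiveRegion .right).1 (mem_attractiveRegion_focusNode h1 h2)
  exact mem_slidingInterior_of_neg h.1 h.2.1 h.2.2

section forward

variable {γ : ℝ → Fin 2 → ℝ} {T : ℝ}

/-- From the attractive sliding segment the solutions slide up to the origin. -/
lemma slides_focusNode (hc : 0 < c) (h : (focusNode c).IsPeriodicSolution γ T) {a : ℝ}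
    (ha : γ a ∈ switchingLine) (h1 : -c < γ a 1) (h2 : γ a 1 < 0) :
    γ '' Icc a (a + -γ a 1 / 2) = (fun y => ![0, y]) '' Icc (γ a 1) 0 ∧
      γ (a + -γ a 1 / 2) = ![0, 0] := by
  have key := h.2.1.slides (fun z => slidingField_focusNode hc) (b := a + -γ a 1 / 2) ha
    fun t ht => mem_slidingInterior_focusNode (by linarith [ht.1]) (by linarith [ht.2])
  constructor
  · ext z
    constructor
    · rintro ⟨t, ht, rfl⟩
      exact ⟨γ a 1 + 2 * (t - a), ⟨by linarith [ht.1], by linarith [ht.2]⟩, (key t ht).symm⟩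
    · rintro ⟨y, hy, rfl⟩
      have hm : a + (y - γ a 1) / 2 ∈ Icc a (a + -γ a 1 / 2) :=
        ⟨by linarith [hy.1], by linarith [hy.2]⟩
      refine ⟨_, hm, ?_⟩
      rw [key _ hm]
      congr 1
      ring_nf
  · rw [key _ ⟨by linarith, le_rfl⟩]
    congr 1
    ring_nf

/-- At the origin the solutions enter the right half plane. -/
lemma exists_arc_origin (hc : 0 < c) (h : (focusNode c).IsPeriodicSolution γ T) {a : ℝ}
    (ha : γ a = ![0, 0]) :
    ∃ b, (focusNode c).IsArc .right γ a b ∧ γ b ∈ switchingLine ∧ γ b 1 = -focusMap 1 0 ∧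
      b = a + ((focusNodeReturn hc).H .right).τ 0 ∧
      γ '' Icc a b = (focusNodeReturn hc).arc .right 0 := by
  have haS : γ a ∈ switchingLine := by simp [ha, mem_switchingLine]
  obtain ⟨b, hab, hnext⟩ := h.2.1.exists_next a
  -- Sliding on from the origin would move upward, out of the sliding region.
  have hfree : ∀ t ∈ Ioo a b, γ t ∉ switchingLine := by
    rcases hnext with ⟨s, hs⟩ | hs
    · exact fun t ht => Side.notMem_switchingLine (hs.2.2 t ht).1
    · exfalso
      have hm : (a + b) / 2 ∈ Ioo a b := ⟨by linarith, by linarith⟩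
      have h1 := slide_eq (fun z => slidingField_focusNode hc) hm.1 (continuousOn_univ.1 h.2.1.1)
        fun t ht => hs t ⟨ht.1, ht.2.trans hm.2⟩
      have h2 := ((mem_slidingRegion_focusNode hc).1 (hs _ hm).1).2.2
      rw [h1, ha] at h2
      simp at h2
      linarith
  obtain ⟨s, e, harc, he⟩ := h.exists_arc haS hab hfree
  set R := focusNodeReturn hc with hR
  have hcr : R.crd .right (γ a) = 0 := by rw [focusNodeReturn_crd_right, ha]; simp
  obtain rfl : s = .right := R.side_eq harc haS (by rw [focusNodeReturn_p_right, hcr])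
  refine ⟨e, harc, he, ?_, ?_, ?_⟩
  · have h1 := R.crd_end harc haS he
    change R.crd .left _ = _ at h1
    rw [focusNodeReturn_crd_left, focusNodeReturn_h_right, hcr] at h1
    linarith
  · have h1 := (R.H .right).arc_time R.hε harc haS he
    change e - a = (R.H .right).τ (R.crd .right (γ a)) at h1
    rw [hcr] at h1
    linarith
  · rw [R.arc_image harc haS he, hcr]

/-- Sliding is upward until the top of the segment, so every sliding periodic orbit visits the
origin. -/
lemma exists_origin (hc : 0 < c) (h : (focusNode c).IsPeriodicSolution γ T) {a b : ℝ} (hab : a < b)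
    (hs : ∀ t ∈ Icc a b, γ t ∈ switchingLine) : ∃ t, γ t = ![0, 0] := by
  obtain ⟨t₁, t, t₂, h1, h2, hr1, ht, hr2, e1, e2⟩ :=
    h.2.1.exists_between (fun z => slidingField_focusNode hc) hab hs
  have g1 := (mem_slidingRegion_focusNode hc).1 hr1
  have g2 := (mem_slidingRegion_focusNode hc).1 hr2
  exact ⟨_, (slides_focusNode hc h ht (by linarith [g1.2.1]) (by linarith [g2.2.2])).2⟩

end forward

end PWLSystem


/-! ### Uniqueness of the sliding periodic orbit -/

namespace PWLSystem

variable {c : ℝ} {γ : ℝ → Fin 2 → ℝ} {T : ℝ}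

lemma image_Icc_union (γ : ℝ → Fin 2 → ℝ) {a b e : ℝ} (h1 : a ≤ b) (h2 : b ≤ e) :
    γ '' Icc a e = γ '' Icc a b ∪ γ '' Icc b e := by
  rw [← image_union, Icc_union_Icc_eq_Icc h1 h2]

/-- If the orbit of the right tangency lands in the attractive sliding segment, there is only one
periodic orbit through the origin. -/
lemma range_eq_of_landing_right (hc : 0 < c) (hr : focusMap 1 0 < c)
    (h : (focusNode c).IsPeriodicSolution γ T) {t₀ : ℝ} (h0 : γ t₀ = ![0, 0]) :
    range γ = (focusNodeReturn hc).arc .right 0 ∪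
      (fun y => ![0, y]) '' Icc (-focusMap 1 0) 0 := by
  have hr0 := focusMap_pos one_pos 0
  have hτ := ((focusNodeReturn hc).H .right).τ_pos 0 ((focusNodeReturn_dom_right hc).2 le_rfl)
  refine range_eq_of_recurrent h.1 h.2.2.1
    (τ := ((focusNodeReturn hc).H .right).τ 0 + focusMap 1 0 / 2) (by linarith) h0 fun t ht => ?_
  obtain ⟨b, harc, hb, hb1, hbt, himg⟩ := exists_arc_origin hc h ht
  have hsl := slides_focusNode hc h hb (by linarith) (by linarith)
  rw [hb1, neg_neg] at hsl
  have e : t + (((focusNodeReturn hc).H .right).τ 0 + focusMap 1 0 / 2) =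
      b + focusMap 1 0 / 2 := by rw [hbt]; ring
  rw [e]
  exact ⟨by rw [image_Icc_union γ harc.1.le (by linarith), himg, hsl.1], hsl.2⟩

/-- If the orbit of the right tangency crosses into the left half plane and then lands in the
attractive sliding segment, there is only one periodic orbit through the origin. -/
lemma range_eq_of_landing_left (hc : 0 < c) (hr : c < focusMap 1 0)
    (hn : nodeMap c (focusMap 1 0 - c) < 0)
    (h : (focusNode c).IsPeriodicSolution γ T) {t₀ : ℝ} (h0 : γ t₀ = ![0, 0]) :
    range γ = (focusNodeReturn hc).arc .right 0 ∪ ((focusNodeReturn hc).arc .left (focusMap 1 0) ∪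
      (fun y => ![0, y]) '' Icc (nodeMap c (focusMap 1 0 - c)) 0) := by
  set R := focusNodeReturn hc with hR
  have hτ := (R.H .right).τ_pos 0 ((focusNodeReturn_dom_right hc).2 le_rfl)
  have hτ' := (R.H .left).τ_pos (focusMap 1 0) ((focusNodeReturn_dom_left hc).2 hr)
  refine range_eq_of_recurrent h.1 h.2.2.1 (τ := (R.H .right).τ 0 + (R.H .left).τ (focusMap 1 0) +
    -nodeMap c (focusMap 1 0 - c) / 2) (by linarith) h0 fun t ht => ?_
  obtain ⟨b, harc, hb, hb1, hbt, himg⟩ := exists_arc_origin hc h ht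
  have hcr : R.crd .left (γ b) = focusMap 1 0 := by rw [focusNodeReturn_crd_left, hb1, neg_neg]
  have hp : R.p .left < R.crd .left (γ b) := by rw [hcr, focusNodeReturn_p_left]; exact hr
  obtain ⟨δ, hδ, hfree⟩ := h.2.1.exists_free (subset_univ _) (R.notMem_slidingRegion hp)
  obtain ⟨s, e, harc', he⟩ := h.exists_arc hb (by linarith) hfree
  obtain rfl := R.side_eq harc' hb hp.le
  have he1 : γ e 1 = nodeMap c (focusMap 1 0 - c) := by
    have h1 := R.crd_end harc' hb he
    change R.crd .right _ = _ at h1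
    rwa [focusNodeReturn_crd_right, hcr, focusNodeReturn_h_left] at h1
  have het : e = b + (R.H .left).τ (focusMap 1 0) := by
    have h1 := (R.H .left).arc_time R.hε harc' hb he
    change e - b = (R.H .left).τ (R.crd .left (γ b)) at h1
    rw [hcr] at h1
    linarith
  have himg' := R.arc_image harc' hb he
  rw [hcr] at himg'
  have hlow := neg_lt_nodeMap hc (sub_pos.2 hr)
  have hsl := slides_focusNode hc h he (by linarith) (by linarith)
  rw [he1] at hsl
  have e1 : t + ((R.H .right).τ 0 + (R.H .left).τ (focusMap 1 0) +
      -nodeMap c (focusMap 1 0 - c) / 2) = e + -nodeMap c (focusMap 1 0 - c) / 2 := by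
    rw [het, hbt]; ring
  rw [e1]
  refine ⟨?_, hsl.2⟩
  rw [image_Icc_union γ harc.1.le (by linarith [harc'.1]), himg,
    image_Icc_union γ harc'.1.le (by linarith), himg', hsl.1]

/-- The time-reversed system has no sliding periodic orbit. -/
lemma not_forwardSliding_reverse_focusNode (hc : 0 < c) (hr : focusMap 1 0 ≠ c)
    (Γ : Set (Fin 2 → ℝ)) : ¬ (focusNode c).reverse.IsForwardSlidingPeriodicOrbit Γ := by
  rintro ⟨γ, T, h, -, a, b, hab, -, hs⟩
  set R := focusNodeReturn hc with hR
  have hk := fun z => slidingField_reverse_focusNode hc (z := z)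
  have hcont : Continuous γ := continuousOn_univ.1 h.2.1.1
  obtain ⟨t₁, t, t₂, h1, h2, hr1, ht, hr2, e1, e2⟩ := h.2.1.exists_between hk hab hs
  rw [reverse_slidingRegion, mem_slidingRegion_focusNode hc] at hr1 hr2
  -- In reversed time sliding goes down with speed `2` and ends at the tangency of the node.
  have hx : γ (t + (γ t 1 + c) / 2) = ![0, -c] := by
    rw [h.2.1.slides hk (b := t + (γ t 1 + c) / 2) ht ?_ _ ⟨by linarith [hr2.2.1], le_rfl⟩]
    · congr 1
      ring_nf
    · intro u hu
      rw [reverse_slidingInterior]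
      exact mem_slidingInterior_focusNode (by linarith [hu.2]) (by linarith [hu.1, hr1.2.2])
  set x := t + (γ t 1 + c) / 2
  have hxS : γ x ∈ switchingLine := by simp [hx, mem_switchingLine]
  have hx1 : γ x 1 = -c := by simp [hx]
  obtain ⟨b', hb', hnext⟩ := h.2.1.exists_next x
  have hfree : ∀ t ∈ Ioo x b', γ t ∉ switchingLine := by
    rcases hnext with ⟨s, hs⟩ | hs
    · exact fun t ht => Side.notMem_switchingLine (hs.2.2 t ht).1
    · exfalso
      have hm : (x + b') / 2 ∈ Ioo x b' := ⟨by linarith, by linarith⟩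
      have g1 := slide_eq hk hm.1 hcont fun t ht => hs t ⟨ht.1, ht.2.trans hm.2⟩
      have g2 := (hs _ hm).1
      rw [reverse_slidingRegion, mem_slidingRegion_focusNode hc] at g2
      linarith [g2.2.1, hm.1]
  have hback : ∀ s a b, (focusNode c).reverse.IsArc s γ a b → γ a ∈ switchingLine →
      γ b ∈ switchingLine → R.crd s (γ b) ∈ (R.H s).dom ∧
        R.crd s.opp (γ a) = R.h s (R.crd s (γ b)) := by
    intro s a b harc ha hb
    have hrev := harc.reverse
    rw [reverse_reverse] at hrev
    have g1 := R.crd_start_mem hrev (by simpa using hb)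
    have g2 := R.crd_end hrev (by simpa using hb) (by simpa using ha)
    simp only [neg_neg] at g1 g2
    exact ⟨g1, g2⟩
  obtain ⟨s, e, harc, he⟩ := h.exists_arc hxS hb' hfree
  obtain ⟨g1, g2⟩ := hback s x e harc hxS he
  rcases s with _ | _
  · rw [focusNodeReturn_dom_right, focusNodeReturn_crd_right] at g1
    change R.crd .left _ = _ at g2
    rw [focusNodeReturn_crd_left, focusNodeReturn_crd_right, focusNodeReturn_h_right, hx1,
      neg_neg] at g2
    have hmono := monotone_focusMap 1 g1
    have hlt : focusMap 1 0 < c := lt_of_le_of_ne (g2 ▸ hmono) hr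
    have hpos : ∀ u, 0 ≤ u → focusMap 1 0 < focusMap 1 u → 0 < u := fun u hu h =>
      lt_of_le_of_ne hu fun e => by rw [← e] at h; exact h.false
    -- From the node tangency the reversed orbit can only run through the right half plane, to a
    -- point above the origin. From then on all visits to the line are outside the closed sliding
    -- segment, so the orbit never comes back to the tangency, against periodicity.
    have hind := h.2.1.sigma_induction (t₀ := e) (by simp)
      (good := fun z => 0 < z 1 ∨ z 1 < -c) ?_ he (Or.inl (hpos _ g1 (by linarith))) ?_
    · obtain ⟨N, hN⟩ := exists_nat_add_mul_gt h.1 x e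
      have := hind (x + N * T) hN.le (by rw [h.2.2.1.nat_mul N x]; exact hxS)
      rw [h.2.2.1.nat_mul N x, hx1] at this
      rcases this with h | h <;> linarith
    · intro z hz hz'
      rw [reverse_slidingRegion, mem_slidingRegion_focusNode hc] at hz'
      rcases hz with hz | hz
      · linarith [hz'.2.2]
      · linarith [hz'.2.1]
    · intro s a b _ harc ha hb hgood
      obtain ⟨g3, g4⟩ := hback s a b harc ha hb
      rcases s with _ | _
      · left
        rw [focusNodeReturn_dom_right, focusNodeReturn_crd_right] at g3
        change R.crd .left _ = _ at g4
        rw [focusNodeReturn_crd_left, focusNodeReturn_crd_right, focusNodeReturn_h_right] at g4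
        have := focusMap_pos one_pos (γ b 1)
        rcases hgood with hg | hg
        · linarith
        · exact hpos _ g3 (by linarith)
      · right
        rw [focusNodeReturn_dom_left, focusNodeReturn_crd_left] at g3
        linarith
  -- The node tangency is invisible, so no arc of the left half plane ends there in forward time.
  · rw [focusNodeReturn_dom_left] at g1
    change R.crd .right _ = _ at g2
    rw [focusNodeReturn_crd_right, focusNodeReturn_h_left, hx1] at g2
    linarith [neg_lt_nodeMap hc (sub_pos.2 g1)]

/-- A sliding segment is a piece of a solution. -/
lemma isPiece_slide (hc : 0 < c) {y τ : ℝ} (hτ : 0 < τ) (hy : -c < y) (hyτ : y + 2 * τ = 0) :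
    (focusNode c).IsPiece (fun t => ![0, y + 2 * t]) τ := by
  have hS : ∀ t : ℝ, (![0, y + 2 * t] : Fin 2 → ℝ) ∈ switchingLine := fun t => by
    simp [mem_switchingLine]
  have hd : ∀ t : ℝ, HasDerivAt (fun t : ℝ => (![0, y + 2 * t] : Fin 2 → ℝ)) ![0, 2] t := by
    intro t
    rw [hasDerivAt_pi]
    intro i
    fin_cases i
    · simpa using hasDerivAt_const t (0 : ℝ)
    · simpa using ((hasDerivAt_id t).const_mul 2).const_add y
  refine ⟨hτ, fun t _ => (hd t).continuousAt.continuousWithinAt, ?_,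
    fun t _ _ => Eventually.of_forall hS⟩
  convert finite_empty
  rw [eq_empty_iff_forall_notMem]
  rintro t ⟨ht, hreg⟩
  refine hreg (Or.inr ⟨?_, by rw [slidingField_focusNode hc (hS t)]; exact hd t⟩)
  filter_upwards [isOpen_Ioo.mem_nhds ht] with u hu
  rw [mem_slidingRegion_focusNode hc]
  refine ⟨hS u, ?_, ?_⟩ <;> simp <;> linarith [hu.1, hu.2]

end PWLSystem


/-! ### Existence of the sliding orbits and choice of the parameter -/

namespace PWLSystem

variable {c : ℝ}

lemma origin_notMem_slidingInterior (hc : 0 < c) :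
    ![0, 0] ∉ (focusNode c).slidingInterior := by
  intro h
  have h1 : Tendsto (fun y : ℝ => (![0, y] : Fin 2 → ℝ)) (𝓝[>] 0) (𝓝[switchingLine] ![0, 0]) := by
    refine tendsto_nhdsWithin_iff.2 ⟨?_, Eventually.of_forall fun y => by
      simp [mem_switchingLine]⟩
    have hcont : Continuous fun y : ℝ => (![0, y] : Fin 2 → ℝ) := by
      refine continuous_pi fun i => ?_
      fin_cases i
      · simpa using continuous_const
      · exact continuous_id
    exact (hcont.tendsto 0).mono_left nhdsWithin_le_nhds
  obtain ⟨y, hy, hy0⟩ := ((h1.eventually h.2).and self_mem_nhdsWithin).exists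
  have := ((mem_slidingRegion_focusNode hc).1 hy).2.2
  simp only [Matrix.cons_val_one, Matrix.cons_val_zero] at this
  exact absurd hy0 (not_lt.2 this)

lemma focusNode_flow_right (hc : 0 < c) :
    ((focusNodeReturn hc).H .right).flow 0 0 = ![0, 0] ∧
      ((focusNodeReturn hc).H .right).flow 0 (((focusNodeReturn hc).H .right).τ 0) =
        ![0, -focusMap 1 0] := by
  set R := focusNodeReturn hc
  constructor
  · rw [(R.H .right).flow_zero]
    simp [Side.pt]
  · rw [(R.H .right).flow_τ 0 ((focusNodeReturn_dom_right hc).2 le_rfl)]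
    change Side.left.pt 1 (R.h .right 0) = _
    rw [focusNodeReturn_h_right]
    simp [Side.pt, Side.sgn]

lemma isPiece_flow_right (hc : 0 < c) : (focusNode c).IsPiece
    (((focusNodeReturn hc).H .right).flow 0) (((focusNodeReturn hc).H .right).τ 0) := by
  refine (((focusNodeReturn hc).H .right).isArc_flow
    ((focusNodeReturn_dom_right hc).2 le_rfl)).isPiece ?_
  rw [(focusNode_flow_right hc).1]
  exact origin_notMem_slidingInterior hc

/-- If the orbit of the origin lands above `-c`, it lands in the sliding segment, and sliding up
from there for the time `focusMap 1 0 / 2` closes it. -/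
theorem exists_typeA_focusNode (hc : 0 < c) (hr : focusMap 1 0 < c) :
    ∃ Γ, (focusNode c).IsTypeA .right Γ := by
  set r := focusMap 1 0 with hr'
  have hr0 : 0 < r := focusMap_pos one_pos 0
  set H := (focusNodeReturn hc).H .right with hH
  have h0dom : 0 ∈ H.dom := (focusNodeReturn_dom_right hc).2 le_rfl
  have hτ : 0 < H.τ 0 := H.τ_pos 0 h0dom
  have hp1 := isPiece_slide hc (half_pos hr0) (show -c < -r by linarith) (by ring)
  have hp2 := isPiece_flow_right hc
  obtain ⟨hf0, hf1⟩ := focusNode_flow_right hc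
  have hj : (fun t : ℝ => (![0, -r + 2 * t] : Fin 2 → ℝ)) (r / 2) = H.flow 0 0 := by
    rw [hf0]; simp only; congr 1; ring_nf
  have hp := hp1.concat hp2 hj
  set δ := concatCurve (fun t : ℝ => (![0, -r + 2 * t] : Fin 2 → ℝ)) (r / 2) (H.flow 0) with hδ
  set T := r / 2 + H.τ 0 with hT
  have hT0 : 0 < T := hp.1
  have hδ1 : ∀ t, t ≤ r / 2 → δ t = ![0, -r + 2 * t] := fun t ht => concatCurve_of_le ht
  have hδ2 : ∀ t, r / 2 ≤ t → δ t = H.flow 0 (t - r / 2) := fun t ht => concatCurve_of_ge hj ht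
  have he : δ T = δ 0 := by
    rw [hδ1 0 (by linarith), hδ2 T (by linarith), show T - r / 2 = H.τ 0 by rw [hT]; ring, hf1]
    simp [hr']
  have hper := hp.isPeriodicSolution he ⟨r / 2, ⟨by linarith, by linarith⟩, fun e => by
    rw [hδ1 _ le_rfl, hδ1 _ (by linarith)] at e
    have := congrFun e 1
    simp at this
    linarith⟩
  have hP : ∀ t ∈ Ico 0 T, periodicCurve δ T t = δ t := fun t ht => periodicCurve_eq δ hT0 ht
  have hPT : periodicCurve δ T T = δ 0 := by
    have h1 := periodic_periodicCurve δ hT0 0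
    rw [zero_add] at h1
    rw [h1, hP 0 ⟨le_rfl, hT0⟩]
  refine ⟨_, periodicCurve δ T, T, hper, rfl, r / 2, ⟨by linarith, fun t ht => ?_⟩,
    by linarith, ?_, ?_, fun t ht => ?_⟩
  · rw [hP t ⟨ht.1, by linarith [ht.2]⟩, hδ1 t ht.2.le]
    exact mem_attractiveRegion_focusNode (by linarith [ht.1]) (by linarith [ht.2])
  · rw [hP _ ⟨by linarith, by linarith⟩, hδ1 _ le_rfl]
    simp [mem_switchingLine]
  · rw [hPT, hδ1 0 (by linarith)]
    simp [mem_switchingLine]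
  · rw [hP t ⟨by linarith [ht.1], ht.2⟩, hδ2 t ht.1.le]
    exact H.region 0 h0dom _ ⟨by linarith [ht.1], by linarith [ht.2]⟩

/-- If the orbit of the origin lands below `-c` it crosses, and the node sends it back to a point
`y` between `-c` and `0`, from where it slides up to the origin in the time `-y / 2`. -/
theorem exists_typeB_focusNode (hc : 0 < c) (hr : c < focusMap 1 0)
    (hn : nodeMap c (focusMap 1 0 - c) < 0) : ∃ Γ, (focusNode c).IsTypeB .right Γ := by
  set r := focusMap 1 0 with hr'
  set y := nodeMap c (r - c) with hy
  have hlow : -c < y := neg_lt_nodeMap hc (sub_pos.2 hr)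
  set R := focusNodeReturn hc with hR
  set H := R.H .right with hH
  set L := R.H .left with hL
  have h0dom : 0 ∈ H.dom := (focusNodeReturn_dom_right hc).2 le_rfl
  have hrdom : r ∈ L.dom := (focusNodeReturn_dom_left hc).2 hr
  have hτ : 0 < H.τ 0 := H.τ_pos 0 h0dom
  have hτ' : 0 < L.τ r := L.τ_pos r hrdom
  set d := -y / 2 with hd
  have hd0 : 0 < d := by rw [hd]; linarith
  have hp1 := isPiece_slide hc hd0 hlow (by rw [hd]; ring)
  have hp2 := isPiece_flow_right hc
  obtain ⟨hf0, hf1⟩ := focusNode_flow_right hc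
  have hg0 : L.flow r 0 = ![0, -r] := by
    rw [L.flow_zero]
    change Side.left.pt 1 r = _
    simp [Side.pt, Side.sgn]
  have hg1 : L.flow r (L.τ r) = ![0, y] := by
    rw [L.flow_τ r hrdom]
    change Side.right.pt 1 (R.h .left r) = _
    rw [focusNodeReturn_h_left]
    simp [Side.pt, Side.sgn, hy]
  have hp3 : (focusNode c).IsPiece (L.flow r) (L.τ r) := by
    refine (L.isArc_flow hrdom).isPiece (R.notMem_slidingInterior (s := .left) ?_)
    rw [hg0, focusNodeReturn_p_left, focusNodeReturn_crd_left]
    simpa using hr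
  have hj : (fun t : ℝ => (![0, y + 2 * t] : Fin 2 → ℝ)) d = H.flow 0 0 := by
    rw [hf0]; simp only [hd]; congr 1; ring_nf
  have hp4 := hp1.concat hp2 hj
  set δ₁ := concatCurve (fun t : ℝ => (![0, y + 2 * t] : Fin 2 → ℝ)) d (H.flow 0) with hδ₁
  have hδ1 : ∀ t, t ≤ d → δ₁ t = ![0, y + 2 * t] := fun t ht => concatCurve_of_le ht
  have hδ2 : ∀ t, d ≤ t → δ₁ t = H.flow 0 (t - d) := fun t ht => concatCurve_of_ge hj ht
  have hj' : δ₁ (d + H.τ 0) = L.flow r 0 := by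
    rw [hδ2 _ (by linarith), add_sub_cancel_left, hf1, hg0]
  have hp := hp4.concat hp3 hj'
  set δ := concatCurve δ₁ (d + H.τ 0) (L.flow r) with hδ
  set T := d + H.τ 0 + L.τ r with hT
  have hT0 : 0 < T := hp.1
  have hδ3 : ∀ t, t ≤ d + H.τ 0 → δ t = δ₁ t := fun t ht => concatCurve_of_le ht
  have hδ4 : ∀ t, d + H.τ 0 ≤ t → δ t = L.flow r (t - (d + H.τ 0)) :=
    fun t ht => concatCurve_of_ge hj' ht
  have hδ0 : δ 0 = ![0, y] := by
    rw [hδ3 0 (by linarith), hδ1 0 hd0.le]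
    simp
  have he : δ T = δ 0 := by
    rw [hδ0, hδ4 T (by linarith), show T - (d + H.τ 0) = L.τ r by rw [hT]; ring, hg1]
  have hper := hp.isPeriodicSolution he ⟨d, ⟨by linarith, by linarith⟩, fun e => by
    rw [hδ0, hδ3 _ (by linarith), hδ1 _ le_rfl] at e
    have := congrFun e 1
    simp at this
    linarith⟩
  have hP : ∀ t ∈ Ico 0 T, periodicCurve δ T t = δ t := fun t ht => periodicCurve_eq δ hT0 ht
  have hPT : periodicCurve δ T T = δ 0 := by
    have h1 := periodic_periodicCurve δ hT0 0
    rw [zero_add] at h1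
    rw [h1, hP 0 ⟨le_rfl, hT0⟩]
  have hQ : periodicCurve δ T (d + H.τ 0) = ![0, -r] := by
    rw [hP _ ⟨by linarith, by linarith⟩, hδ3 _ le_rfl, hj', hg0]
  refine ⟨_, periodicCurve δ T, T, hper, rfl, d, d + H.τ 0, ⟨hd0, fun t ht => ?_⟩,
    ⟨by linarith, ?_, ?_, fun t ht => ?_⟩, ?_, by linarith, ?_, ?_, fun t ht => ?_⟩
  · rw [hP t ⟨ht.1, by linarith [ht.2]⟩, hδ3 t (by linarith [ht.2]), hδ1 t ht.2.le]
    exact mem_attractiveRegion_focusNode (by linarith [ht.1]) (by linarith [ht.2])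
  · rw [hP _ ⟨by linarith, by linarith⟩, hδ3 _ (by linarith), hδ1 _ le_rfl]
    simp [mem_switchingLine]
  · rw [hQ]
    simp [mem_switchingLine]
  · rw [hP t ⟨by linarith [ht.1], by linarith [ht.2]⟩, hδ3 t ht.2.le, hδ2 t ht.1.le]
    exact H.region 0 h0dom _ ⟨by linarith [ht.1], by linarith [ht.2]⟩
  · rw [hQ]
    refine ⟨by simp [mem_switchingLine], ?_⟩
    rw [focusNode_field_left, focusNode_field_right]
    simp
    nlinarith
  · rw [hQ]
    simp [mem_switchingLine]
  · rw [hPT, hδ0]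
    simp [mem_switchingLine]
  · rw [hP t ⟨by linarith [ht.1], ht.2⟩, hδ4 t ht.1.le]
    exact L.region r hrdom _ ⟨by linarith [ht.1], by linarith [ht.2]⟩

/-- The sliding periodic orbits of `focusNode c` are those through the origin. -/
lemma sliding_eq_singleton_focusNode (hc : 0 < c) (hne : focusMap 1 0 ≠ c)
    {X : Set (Fin 2 → ℝ)}
    (hX : ∀ γ T t, (focusNode c).IsPeriodicSolution γ T → γ t = ![0, 0] → range γ = X)
    {γ : ℝ → Fin 2 → ℝ} {T b : ℝ} (h : (focusNode c).IsPeriodicSolution γ T)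
    (hs : (focusNode c).SlidesOn γ 0 b) :
    {Γ | (focusNode c).IsSlidingPeriodicOrbit Γ} = {range γ} := by
  have hfwd : (focusNode c).IsForwardSlidingPeriodicOrbit (range γ) :=
    h.isForwardSliding two_ne_zero (fun z => slidingField_focusNode hc) hs.1
      fun t ht => (hs.2 t ht).1
  have huniq : ∀ Γ, (focusNode c).IsForwardSlidingPeriodicOrbit Γ → Γ = X := by
    rintro Γ ⟨γ', T', h', rfl, a, b, hab, -, hs'⟩
    obtain ⟨t, ht⟩ := exists_origin hc h' hab hs'
    exact hX γ' T' t h' ht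
  ext Γ
  constructor
  · rintro (hΓ | hΓ)
    · rw [mem_singleton_iff, huniq _ hΓ, huniq _ hfwd]
    · exact absurd hΓ (not_forwardSliding_reverse_focusNode hc hne Γ)
  · rintro rfl
    exact Or.inl hfwd

/-- With `c = focusMap 1 0 + 1` the landing is in the sliding segment, and the bound `7c/3` for two
crossing orbits holds trivially. -/
theorem exists_typeA_two_crossing : ∃ S : PWLSystem, S.Nondegenerate ∧
    (∃ s Γ, S.IsTypeA s Γ ∧ {Γ' | S.IsSlidingPeriodicOrbit Γ'} = {Γ}) ∧
    {Γ | S.IsCrossingPeriodicOrbit Γ}.encard = 2 := by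
  have hr0 := focusMap_pos one_pos 0
  have hc : 0 < focusMap 1 0 + 1 := by linarith
  refine ⟨focusNode (focusMap 1 0 + 1), nondegenerate_focusNode hc, ?_,
    encard_crossing_focusNode hc (by linarith)⟩
  obtain ⟨Γ, hΓ⟩ := exists_typeA_focusNode hc (by linarith)
  refine ⟨.right, Γ, hΓ, ?_⟩
  obtain ⟨γ, T, h, rfl, t₁, hs, -⟩ := hΓ
  exact sliding_eq_singleton_focusNode hc (by linarith)
    (fun γ T t h h0 => range_eq_of_landing_right hc (by linarith) h h0) h hs

/-- With `r = focusMap 1 0` and `c = r / 2` the landing is at distance `c < 4c/3` beyond the node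
tangency, so the node returns below the origin; moreover `r = 2c < 7c/3`. -/
theorem exists_typeB_two_crossing : ∃ S : PWLSystem, S.Nondegenerate ∧
    (∃ s Γ, S.IsTypeB s Γ ∧ {Γ' | S.IsSlidingPeriodicOrbit Γ'} = {Γ}) ∧
    {Γ | S.IsCrossingPeriodicOrbit Γ}.encard = 2 := by
  have hr0 := focusMap_pos one_pos 0
  set r := focusMap 1 0 with hr
  have hc : 0 < r / 2 := by linarith
  have hlt : r / 2 < r := by linarith
  have hn : nodeMap (r / 2) (r - r / 2) < 0 := by
    rw [← nodeMap_zero_right (r / 2)]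
    exact strictMonoOn_nodeMap hc (show 0 ≤ r - r / 2 by linarith)
      (show 0 ≤ 4 * (r / 2) / 3 by linarith) (by linarith)
  refine ⟨focusNode (r / 2), nondegenerate_focusNode hc, ?_,
    encard_crossing_focusNode hc (by linarith)⟩
  obtain ⟨Γ, hΓ⟩ := exists_typeB_focusNode hc hlt hn
  refine ⟨.right, Γ, hΓ, ?_⟩
  obtain ⟨γ, T, h, rfl, t₁, t₂, hs, -⟩ := hΓ
  exact sliding_eq_singleton_focusNode hc hlt.ne'
    (fun γ T t h h0 => range_eq_of_landing_left hc hlt hn h h0) h hs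

end PWLSystem


theorem theorem2 :
    (∀ S : PWLSystem, S.HasPairA → ∀ Γ, ¬ S.IsCrossingPeriodicOrbit Γ) ∧
    (∀ S : PWLSystem,
      (S.HasPairB ∨ S.HasPairC ∨ ∃ s Γ, S.IsTypeC s Γ ∨ S.IsTypeD s Γ) →
      ∃ Γ, S.IsCrossingPeriodicOrbit Γ ∧ (∀ Γ', S.IsCrossingPeriodicOrbit Γ' → Γ' = Γ) ∧
        S.IsUnstable Γ) ∧
    (∃ S : PWLSystem, S.Nondegenerate ∧
      (∃ s Γ, S.IsTypeA s Γ ∧ {Γ' | S.IsSlidingPeriodicOrbit Γ'} = {Γ}) ∧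
      {Γ | S.IsCrossingPeriodicOrbit Γ}.encard = 2) ∧
    (∃ S : PWLSystem, S.Nondegenerate ∧
      (∃ s Γ, S.IsTypeB s Γ ∧ {Γ' | S.IsSlidingPeriodicOrbit Γ'} = {Γ}) ∧
      {Γ | S.IsCrossingPeriodicOrbit Γ}.encard = 2) := by
  refine ⟨fun S h => PWLSystem.not_crossing_of_pairA h, ?_, ?_, ?_⟩
  · rintro S (h | h | ⟨s, Γ, h | h⟩)
    · exact PWLSystem.exists_unique_of_pairB h
    · exact PWLSystem.exists_unique_of_pairC h
    · exact PWLSystem.exists_unique_of_typeC h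
    · exact PWLSystem.exists_unique_of_typeD h
  · exact PWLSystem.exists_typeA_two_crossing
  · exact PWLSystem.exists_typeB_two_crossing
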